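/- Let $G=(V,E)$ be a finite connected simple graph with $n=|V|$ vertices, $m=|E|\ge 1$ edges and maximum degree $\Delta$; let $d(v)$ be the degree of $v$. Let $\beta>0$, $x=\tanh\beta$ and $\varepsilon,\delta\in(0,1]$. Let $$\chi_\beta=\frac1n\operatorname{Var}_\beta\Big(\sum_{i\in V}\sigma_i\Big)$$ be the susceptibility of the zero-field ferromagnetic Ising model on $G$, in which $\sigma\in\{-1,1\}^V$ has probability proportional to $\exp\big(\beta\sum_{ij\in E}\sigma_i\sigma_j\big)$. For $A\subseteq E$ let $\partial A$ be the set of vertices of odd degree in $(V,A)$, let $\mathcal C_k=\{A\subseteq E:|\partial A|=k\}$, and let $\mathcal W=\mathcal C_0\cup\mathcal C_2$. The worm process with parameter $x$ is the Markov chain on $\mathcal W$ with the following transition probabilities $P_x(A,A\triangle uv)$, for $uv\in E$ and $A,\,A\triangle uv\in\mathcal W$: - $x^{\mathbf 1(uv\notin A)}\,\frac1{2n}\big(\frac1{d(u)}+\frac1{d(v)}\big)$ if $A\in\mathcal C_0$; - $x^{\mathbf 1(uv\notin A)}\,\frac14\big(\frac1{d(u)}+\frac1{d(v)}\big)$ if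 $A\triangle uv\in\mathcal C_0$; - $\min\big(\frac{d(u)}{d(v)}x^{\mathbf 1(uv\notin A)-\mathbf 1(uv\in A)},1\big)\frac1{4d(u)}$ if $A,\,A\triangle uv\in\mathcal C_2$ and $u\in\partial A$. All other off-diagonal entries are zero, and the rows sum to $1$. Let $(X_t)_{t\ge0}$ be a worm process with parameter $x=\tanh\beta$ and $X_0=\emptyset$ (the empty edge set), and put $$\tau=\Big\lceil 4\Big(\log 2+\frac{\log(2\delta^{-1})}{m}\Big)\Delta m^2n^4\Big\rceil,\qquad N=\Big\lceil 16\,\varepsilon^{-2}(1+\varepsilon)^2\delta^{-1}\Delta\, m\,n^5\Big\rceil,\qquad \hat S_0=\frac1N\sum_{t=\tau+1}^{\tau+N}\mathbf 1_{\mathcal C_0}(X_t).$$ Then the following hold. 1. $1/\hat S_0$ is an $(\varepsilon,\delta)$-approximation of $\chi_\beta$: with probability at least $1-\delta$, one has $\hat S_0>0$ and $|1/\hat S_0-\chi_\beta|\le\varepsilon\chi_\beta$. 2. The number of steps of the worm process that this takes satisfies $N+\tau=O(\delta^{-1}\varepsilon^{-2}\Delta m^2n^4)$, with an absolute implied constant.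 3. The procedure defines an fpras for $\chi_\beta$. Consider a random access machine with exact real arithmetic (including $\exp$ and $\log$) and random choices, with the following rules. Integers can be added and subtracted. Rounding a real number up to an integer $k\ge0$ costs $1+k$, and every other operation costs $1$. A program is fixed, contains no real constants, and receives $n$, the sorted adjacency lists of a graph on $\{0,\dots,n-1\}$, and $\beta,\varepsilon,\delta$ as input. Then there is one program such that, on every such input with $G$ connected, $m\ge1$, $\beta>0$ and $\varepsilon,\delta\in(0,1]$, the following three things hold. Its output has exactly the law of $1/\hat S_0$ (with the convention $1/0=0$). It takes time $O(\delta^{-1}\varepsilon^{-2}\Delta m^2n^4)$ whatever the random choices, with an absolute implied constant. It is an fpras for $\chi_\beta$: its running time is at most a polynomial in $n$, $\varepsilon^{-1}$ and $\delta^{-1}$, and with probability at least $1-\delta$ its output $Y$ satisfies $|Y-\chi_\beta|\le\varepsilon\chi_\beta$. -/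

import Mathlib

open scoped symmDiff

noncomputable section

/-! ### The zero-field ferromagnetic Ising model on a finite graph -/

section Ising

variable {V : Type*} [Fintype V] [DecidableEq V] (G : SimpleGraph V) [DecidableRel G.Adj]

/-- The product `σ_i σ_j` over the two ends of the pair `e = ij`, as a real number. -/
def edgeSpin (σ : V → ℤˣ) (e : Sym2 V) : ℝ :=
  Sym2.lift ⟨fun i j => ((σ i : ℤ) : ℝ) * ((σ j : ℤ) : ℝ), fun _ _ => mul_comm _ _⟩ e

/-- The zero-field Hamiltonian `H(σ) = - ∑_{ij ∈ E} σ_i σ_j`; spins take the values `±1`. -/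
def isingHamiltonian (σ : V → ℤˣ) : ℝ := -∑ e ∈ G.edgeFinset, edgeSpin σ e

/-- The Ising partition function. -/
def isingPartition (β : ℝ) : ℝ := ∑ σ : V → ℤˣ, Real.exp (-β * isingHamiltonian G σ)

/-- The Gibbs probability of a spin configuration. -/
def isingProb (β : ℝ) (σ : V → ℤˣ) : ℝ :=
  Real.exp (-β * isingHamiltonian G σ) / isingPartition G β

/-- Expectation with respect to the Gibbs measure. -/
def isingExp (β : ℝ) (f : (V → ℤˣ) → ℝ) : ℝ := ∑ σ : V → ℤˣ, isingProb G β σ * f σ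

/-- The magnetization `M(σ) = ∑_i σ_i`. -/
def magnetization (σ : V → ℤˣ) : ℝ := ∑ i, ((σ i : ℤ) : ℝ)

/-- The susceptibility `χ_β = Var_β(M) / n`. -/
def susceptibility (β : ℝ) : ℝ :=
  (1 / (Fintype.card V : ℝ)) *
    isingExp G β (fun σ => (magnetization σ - isingExp G β magnetization) ^ 2)

end Ising

/-! ### The worm process -/

section Worm

variable {V : Type*} [Fintype V] [DecidableEq V] (G : SimpleGraph V) [DecidableRel G.Adj]

/-- The degree of `v` in the spanning subgraph with edge set `A`. -/
def subDegree (A : Finset (Sym2 V)) (v : V) : ℕ :=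
  (Finset.univ.filter fun u => s(u, v) ∈ A).card

/-- The set `∂A` of odd vertices of the spanning subgraph with edge set `A`. -/
def oddVertices (A : Finset (Sym2 V)) : Finset V :=
  Finset.univ.filter fun v => Odd (subDegree A v)

/-- The configuration space `𝒲 = 𝒞₀ ∪ 𝒞₂`: the edge sets `A ⊆ E` with no or exactly two
odd vertices. -/
def WormState : Type _ :=
  {A : Finset (Sym2 V) // A ⊆ G.edgeFinset ∧
    ((oddVertices A).card = 0 ∨ (oddVertices A).card = 2)}

instance : Fintype (WormState G) :=
  Fintype.subtype
    (G.edgeFinset.powerset.filter fun A =>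
      (oddVertices A).card = 0 ∨ (oddVertices A).card = 2)
    (by intro A; simp)

instance : DecidableEq (WormState G) := inferInstanceAs (DecidableEq (Subtype _))

/-- The empty edge set, the cold start of the worm process. -/
def WormState.zero : WormState G := ⟨∅, by simp [oddVertices, subDegree]⟩

/-- The entry `P_x(A, A ∆ uv)` of the worm transition matrix, for adjacent `u`, `v` and a state
`A`.  In the last two cases both `A` and `A ∆ uv` have two odd vertices and exactly one of `u`, `v`
is odd in `A`; the last case is the third one with the roles of `u` and `v` exchanged. -/
def wormEntry (x : ℝ) (A : Finset (Sym2 V)) (u v : V) : ℝ :=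
  if (oddVertices A).card = 0 then
    (if s(u, v) ∈ A then 1 else x) *
      (1 / (2 * (Fintype.card V : ℝ)) * (1 / (G.degree u : ℝ) + 1 / (G.degree v : ℝ)))
  else if (oddVertices (A ∆ {s(u, v)})).card = 0 then
    (if s(u, v) ∈ A then 1 else x) *
      (1 / 4 * (1 / (G.degree u : ℝ) + 1 / (G.degree v : ℝ)))
  else if u ∈ oddVertices A then
    min ((G.degree u : ℝ) / (G.degree v : ℝ) * (if s(u, v) ∈ A then x⁻¹ else x)) 1 *
      (1 / (4 * (G.degree u : ℝ)))
  else
    min ((G.degree v : ℝ) / (G.degree u : ℝ) * (if s(u, v) ∈ A then x⁻¹ else x)) 1 *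
      (1 / (4 * (G.degree v : ℝ)))

/-- The off-diagonal entries of the worm matrix: `P_x(A, B)` is `wormEntry` if `B = A ∆ uv` for an
edge `uv`, and zero if there is no such edge.  The factor `1/2` is there since the sum meets that
edge twice, as `(u, v)` and as `(v, u)`. -/
def wormOffDiag (x : ℝ) (A B : WormState G) : ℝ :=
  1 / 2 * ∑ u : V, ∑ v : V,
    if G.Adj u v ∧ B.1 = A.1 ∆ {s(u, v)} then wormEntry G x A.1 u v else 0

/-- The transition matrix of the worm process with parameter `x`. -/
def wormMatrix (x : ℝ) : Matrix (WormState G) (WormState G) ℝ := fun A B =>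
  if A = B then 1 - ∑ C ∈ Finset.univ.erase A, wormOffDiag G x A C
  else wormOffDiag G x A B

/-- `X` is a time-homogeneous Markov chain with transition matrix `P` and initial state `a₀` on the
probability space `(Ω, μ)`. -/
structure IsMarkovChain {S Ω : Type*} [DecidableEq S] [MeasurableSpace Ω]
    (P : Matrix S S ℝ) (a₀ : S) (μ : MeasureTheory.Measure Ω) (X : ℕ → Ω → S) : Prop where
  measurable : ∀ t a, MeasurableSet {ω | X t ω = a}
  law : ∀ (T : ℕ) (a : ℕ → S),
    μ {ω | ∀ t ≤ T, X t ω = a t} =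
      ENNReal.ofReal (if a 0 = a₀ then ∏ t ∈ Finset.range T, P (a t) (a (t + 1)) else 0)

/-- `X` is a worm process on `G` with parameter `x`, started at the empty edge set. -/
def IsWormProcess {Ω : Type*} [MeasurableSpace Ω] (x : ℝ) (μ : MeasureTheory.Measure Ω)
    (X : ℕ → Ω → WormState G) : Prop :=
  IsMarkovChain (wormMatrix G x) (WormState.zero G) μ X

/-- The burn-in time `τ = ⌈4 (log 2 + log(2/δ)/m) Δ m² n⁴⌉`. -/
def burnIn (δ : ℝ) : ℕ :=
  ⌈4 * (Real.log 2 + Real.log (2 * δ⁻¹) / (G.edgeFinset.card : ℝ)) * (G.maxDegree : ℝ) *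
    (G.edgeFinset.card : ℝ) ^ 2 * (Fintype.card V : ℝ) ^ 4⌉₊

/-- The sample size `N = ⌈16 ε⁻² (1+ε)² δ⁻¹ Δ m n⁵⌉`. -/
def sampleSize (ε δ : ℝ) : ℕ :=
  ⌈16 * (ε ^ 2)⁻¹ * (1 + ε) ^ 2 * δ⁻¹ * (G.maxDegree : ℝ) * (G.edgeFinset.card : ℝ) *
    (Fintype.card V : ℝ) ^ 5⌉₊

/-- The sample mean `(1/N) ∑_{t=τ+1}^{τ+N} 1_{𝒞₀}(X_t)` of the indicator of `𝒞₀`. -/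
def wormSampleMean {Ω : Type*} (τ N : ℕ) (X : ℕ → Ω → WormState G) (ω : Ω) : ℝ :=
  (1 / (N : ℝ)) * ∑ t ∈ Finset.Icc (τ + 1) (τ + N),
    if (oddVertices (X t ω).1).card = 0 then 1 else 0

/-- The bound `δ⁻¹ ε⁻² Δ m² n⁴` in the running time. -/
def timeScale (ε δ : ℝ) : ℝ :=
  δ⁻¹ * (ε ^ 2)⁻¹ * (G.maxDegree : ℝ) * (G.edgeFinset.card : ℝ) ^ 2 * (Fintype.card V : ℝ) ^ 4

end Worm

/-- `y` estimates the quantity `z` with relative error `ε`. -/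
def EstimatesWithRelError (ε y z : ℝ) : Prop := |y - z| ≤ ε * z

/-! ### Randomized algorithms and their running time

The model is a random access machine with exact real arithmetic and random choices.  Its memory
consists of registers for natural numbers, registers for real numbers, and an array of natural
numbers with two indices.  Natural numbers can be added and subtracted only, and real numbers have
no other influence on the integer part of the memory than through rounding (which is charged for
the size of its result, as counting up to it would be) and as biases of coins.  A program is a fixed
finite text that does not depend on the input, and it contains no real constants. -/

/-- Memory of the machine, with a clock. -/
structure Memory where
  nat : ℕ → ℕ
  real : ℕ → ℝ
  arr : ℕ → ℕ → ℕ
  time : ℕ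

namespace Memory

def setNat (s : Memory) (r k : ℕ) : Memory := { s with nat := Function.update s.nat r k }

def setReal (s : Memory) (p : ℕ) (z : ℝ) : Memory := { s with real := Function.update s.real p z }

def setArr (s : Memory) (i j k : ℕ) : Memory :=
  { s with arr := Function.update s.arr i (Function.update (s.arr i) j k) }

/-- Advance the clock by `k` units of time. -/
def tick (s : Memory) (k : ℕ) : Memory := { s with time := s.time + k }

end Memory

/-- The instructions.  All arguments are names of registers, except for `k` in `const`. -/
inductive Instr
  | const (r k : ℕ)
  | add (r a b : ℕ)
  | sub (r a b : ℕ)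
  | load (r i j : ℕ)
  | store (i j a : ℕ)
  | cast (p a : ℕ)
  | ceil (r p : ℕ)
  | radd (p a b : ℕ)
  | rsub (p a b : ℕ)
  | rmul (p a b : ℕ)
  | rdiv (p a b : ℕ)
  | rexp (p a : ℕ)
  | rlog (p a : ℕ)
  | uniform (r a : ℕ)
  | flip (r p : ℕ)

/-- A uniformly random element of `{0, …, k - 1}` (and `0` if `k = 0`). -/
def uniformBelow (k : ℕ) : PMF ℕ :=
  if h : 0 < k then PMF.uniformOfFinset (Finset.range k) ⟨0, Finset.mem_range.2 h⟩
  else PMF.pure 0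

/-- A coin that shows `1` with probability `p` (truncated to `[0, 1]`), and `0` otherwise. -/
def coin (p : ℝ) : PMF ℕ :=
  (PMF.ofFintype
    (fun b : Bool => if b then min (ENNReal.ofReal p) 1 else 1 - min (ENNReal.ofReal p) 1)
    (by simp [add_tsub_cancel_of_le])).map fun b => if b then 1 else 0

/-- The effect of an instruction.  Every instruction takes one unit of time, except for `ceil`,
whose cost grows with the value it returns. -/
def Instr.exec : Instr → Memory → PMF Memory
  | .const r k, s => PMF.pure ((s.setNat r k).tick 1)
  | .add r a b, s => PMF.pure ((s.setNat r (s.nat a + s.nat b)).tick 1)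
  | .sub r a b, s => PMF.pure ((s.setNat r (s.nat a - s.nat b)).tick 1)
  | .load r i j, s => PMF.pure ((s.setNat r (s.arr (s.nat i) (s.nat j))).tick 1)
  | .store i j a, s => PMF.pure ((s.setArr (s.nat i) (s.nat j) (s.nat a)).tick 1)
  | .cast p a, s => PMF.pure ((s.setReal p (s.nat a : ℝ)).tick 1)
  | .ceil r p, s => PMF.pure ((s.setNat r ⌈s.real p⌉₊).tick (1 + ⌈s.real p⌉₊))
  | .radd p a b, s => PMF.pure ((s.setReal p (s.real a + s.real b)).tick 1)
  | .rsub p a b, s => PMF.pure ((s.setReal p (s.real a - s.real b)).tick 1)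
  | .rmul p a b, s => PMF.pure ((s.setReal p (s.real a * s.real b)).tick 1)
  | .rdiv p a b, s => PMF.pure ((s.setReal p (s.real a / s.real b)).tick 1)
  | .rexp p a, s => PMF.pure ((s.setReal p (Real.exp (s.real a))).tick 1)
  | .rlog p a, s => PMF.pure ((s.setReal p (Real.log (s.real a))).tick 1)
  | .uniform r a, s => (uniformBelow (s.nat a)).map fun k => (s.setNat r k).tick 1
  | .flip r p, s => (coin (s.real p)).map fun k => (s.setNat r k).tick 1

/-- Programs: `ifz r c d` runs `c` if register `r` holds zero and `d` otherwise; `loop r c` repeats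
`c` as often as the value of register `r` at the start of the loop says. -/
inductive Program
  | instr (i : Instr)
  | seq (c d : Program)
  | ifz (r : ℕ) (c d : Program)
  | loop (r : ℕ) (c : Program)

/-- The law of the memory after a run of the program.  Tests, and every round of a loop, take one
unit of time in addition to the time for what they control. -/
def Program.exec : Program → Memory → PMF Memory
  | .instr i => i.exec
  | .seq c d => fun s => (c.exec s).bind d.exec
  | .ifz r c d => fun s => if s.nat r = 0 then c.exec (s.tick 1) else d.exec (s.tick 1)
  | .loop r c => fun s =>
      (fun ν : PMF Memory => ν.bind fun s' => c.exec (s'.tick 1))^[s.nat r] (PMF.pure (s.tick 1))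

/-- The initial memory: natural register `0` holds the number `n` of vertices; real registers
`0`, `1`, `2` hold `β`, `ε`, `δ`; the graph is given by its sorted adjacency lists, where row `v < n`
of the array holds the degree of `v` followed by the neighbours of `v`; all else is zero. -/
def inputMemory {n : ℕ} (G : SimpleGraph (Fin n)) [DecidableRel G.Adj] (β ε δ : ℝ) : Memory where
  nat := fun r => if r = 0 then n else 0
  real := fun p => if p = 0 then β else if p = 1 then ε else if p = 2 then δ else 0
  arr := fun i j =>
    if h : i < n then
      (G.degree ⟨i, h⟩ ::
        ((G.neighborFinset ⟨i, h⟩).sort (· ≤ ·)).map (fun w : Fin n => (w : ℕ))).getD j 0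
    else 0
  time := 0

/-- The law of the memory when the program has run on the given input. -/
def Program.run (c : Program) {n : ℕ} (G : SimpleGraph (Fin n)) [DecidableRel G.Adj]
    (β ε δ : ℝ) : PMF Memory :=
  c.exec (inputMemory G β ε δ)

/-- The law of the output, which is the content of real register `0` at the end of the run. -/
def Program.output (c : Program) {n : ℕ} (G : SimpleGraph (Fin n)) [DecidableRel G.Adj]
    (β ε δ : ℝ) : PMF ℝ :=
  (c.run G β ε δ).map fun s => s.real 0

/-- The problem instances: connected graphs with at least one edge, `β > 0`, and accuracy
parameters in `(0, 1]`. -/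
def ValidInstance {V : Type*} [Fintype V] [DecidableEq V] (G : SimpleGraph V) [DecidableRel G.Adj]
    (β ε δ : ℝ) : Prop :=
  G.Connected ∧ 1 ≤ G.edgeFinset.card ∧ 0 < β ∧ 0 < ε ∧ ε ≤ 1 ∧ 0 < δ ∧ δ ≤ 1

/-- The program is a fully-polynomial randomized approximation scheme for the Ising observable `Q`:
its running time is bounded by a polynomial in `n`, `ε⁻¹` and `δ⁻¹` whatever the random choices are,
and its output estimates `Q` with relative error `ε` with probability at least `1 - δ`. -/
def IsFPRAS (c : Program)
    (Q : ∀ (n : ℕ) (G : SimpleGraph (Fin n)) [DecidableRel G.Adj], ℝ → ℝ) : Prop :=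
  (∃ p : MvPolynomial (Fin 3) ℝ, ∀ (n : ℕ) (G : SimpleGraph (Fin n)) [DecidableRel G.Adj]
      (β ε δ : ℝ), ValidInstance G β ε δ →
      ∀ s ∈ (c.run G β ε δ).support,
        (s.time : ℝ) ≤ MvPolynomial.eval ![(n : ℝ), ε⁻¹, δ⁻¹] p) ∧
  ∀ (n : ℕ) (G : SimpleGraph (Fin n)) [DecidableRel G.Adj] (β ε δ : ℝ), ValidInstance G β ε δ →
    ENNReal.ofReal (1 - δ) ≤
      (c.output G β ε δ).toMeasure {y | EstimatesWithRelError ε y (Q n G β)}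

end

/-! The quantity to be estimated is the inverse of a stationary probability. Writing `exp(βσ_iσ_j) =
cosh β (1 + xσ_iσ_j)`, expanding over edge sets and summing over the spins shows that the
expectation of a product of spins over `S` is `Z_S / Z_∅`, where `Z_S` (`oddSum`) is the sum of
`x^|A|` over all `A` with `∂A = S`. The magnetization has mean zero, hence `χ = Z / (n Z_∅)` with
`Z` the sum of `Z_{{i} ∆ {j}}` over all ordered pairs (`susceptibility_eq`). The worm process is
reversible for the weights `n x^|A|` on `𝒞₀` and `2 x^|A|` on `𝒞₂`, whose total is `Z`
(`lazyReversible_wormMatrix`). So `𝒞₀` has stationary probability `p = n Z_∅ / Z = 1/χ`. Moreover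
`Z_S ≤ Z_∅` (`oddSum_le`), which gives `p ≥ 1/n`: the event being sampled is not rare.

The spectral gap is at least `1/(4Δmn²)`, by canonical paths (`hasGap_wormMatrix`). An even state
`F` and a state `I` differ by a set `D = F ∆ I` that is itself a state. The edges of `D` can be
removed one at a time without leaving the state space (`exists_unwinding`), and this gives a path of
at most `m` flips between `I` and `F`. Paths with one even end are enough, because the variance of
`f` is at most its mean square distance to any constant, in particular to `f F`. For fixed `D` and
`e`, a transition that flips `e` is used by at most one `F`, and `pow_mul_pow_symmDiff` splits the
weight of the pair into the weight of the transition and a factor that depends on `D` and the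
transition only (`path_sum_le`). Summed over `D`, that factor is at most `n² Z_∅`, again because
`Z_S ≤ Z_∅`.

The statistical part takes place in `L²(π)`. Laziness gives `P² ≤ P`, so correlations decay
geometrically and the centred number of visits to `𝒞₀` has second moment at most `8KNp` with `K =
Δmn⁴` (`LazyReversible.visitSq_le`). The burn-in only has to bring the density of the law within
`√p` of `1`. Chebyshev's inequality together with `estimates_inv` then gives the accuracy
(`countLaw_accuracy`). It is proved once, for the explicit law `countLaw`, and transferred to an
arbitrary worm process by `IsMarkovChain.measure_count`.

For the program, a transition is factored into random choices that the machine can make: hold,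
choose a vertex, choose a neighbour, accept (`moveLaw_eq_step`). A coupling of memories with states
of the chain (`Sim`, `Represents`) is carried through the execution, together with a bound for the
clock. It yields both the exact law of the output and a time bound for every outcome of the random
choices (`wormProgram_spec`). -/

noncomputable section

set_option linter.unusedSectionVars false

/-! ### High-temperature expansion of the Ising model. -/

section OddVertices

variable {V : Type*} [Fintype V] [DecidableEq V]

theorem odd_card_symmDiff {α : Type*} [Fintype α] [DecidableEq α] (S T : Finset α) :
    Odd (S ∆ T).card ↔ ¬ (Odd S.card ↔ Odd T.card) := by
  have h1 : (S ∆ T).card + 2 * (S ∩ T).card = S.card + T.card := by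
    have e1 : (S ∆ T).card = (S \ T).card + (T \ S).card := by
      rw [symmDiff_def, Finset.sup_eq_union, Finset.card_union_of_disjoint disjoint_sdiff_sdiff]
    have e2 := Finset.card_sdiff_add_card_inter S T
    have e3 := Finset.card_sdiff_add_card_inter T S
    rw [Finset.inter_comm T S] at e3
    omega
  simp only [Nat.odd_iff]
  omega

theorem mem_oddVertices {A : Finset (Sym2 V)} {v : V} :
    v ∈ oddVertices A ↔ Odd (subDegree A v) := by
  simp [oddVertices]

/-- Degrees add modulo 2 under symmetric difference, so `∂` is the boundary map of chains over the
field with two elements. Later parity arguments reduce to this linearity. -/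
theorem oddVertices_symmDiff (A B : Finset (Sym2 V)) :
    oddVertices (A ∆ B) = oddVertices A ∆ oddVertices B := by
  ext v
  have : (Finset.univ.filter fun u => s(u, v) ∈ A ∆ B) =
      (Finset.univ.filter fun u => s(u, v) ∈ A) ∆ (Finset.univ.filter fun u => s(u, v) ∈ B) := by
    ext u; simp [Finset.mem_symmDiff]
  rw [Finset.mem_symmDiff]
  simp only [mem_oddVertices]
  rw [subDegree, this, odd_card_symmDiff]
  simp only [subDegree]
  tauto

theorem oddVertices_empty : oddVertices (∅ : Finset (Sym2 V)) = ∅ := by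
  simp [oddVertices, subDegree]

theorem oddVertices_singleton {u v : V} (h : u ≠ v) :
    oddVertices {s(u, v)} = ({u} : Finset V) ∆ {v} := by
  ext w
  have : (Finset.univ.filter fun a => s(a, w) ∈ ({s(u, v)} : Finset (Sym2 V))) =
      if w = v then {u} else if w = u then {v} else ∅ := by
    ext a
    by_cases h1 : w = v
    · subst h1; simp; intro h2 h3; exact h2.trans h3
    · by_cases h2 : w = u
      · subst h2; simp [h1]
      · simp [h1, h2]
  rw [mem_oddVertices, subDegree, this]
  simp only [Finset.mem_symmDiff, Finset.mem_singleton]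
  by_cases h1 : w = v
  · subst h1; simp [h.symm]
  · by_cases h2 : w = u
    · subst h2; simp [h]
    · simp [h1, h2]

/-- The product of the spins in `S`. -/
def spinProd (S : Finset V) (σ : V → ℤˣ) : ℝ := ∏ i ∈ S, ((σ i : ℤ) : ℝ)

theorem spin_mul_self (s : ℤˣ) : ((s : ℤ) : ℝ) * ((s : ℤ) : ℝ) = 1 := by
  rcases Int.units_eq_one_or s with rfl | rfl <;> simp

theorem spinProd_eq_prod_univ (S : Finset V) (σ : V → ℤˣ) :
    spinProd S σ = ∏ i, if i ∈ S then ((σ i : ℤ) : ℝ) else 1 := by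
  simp [spinProd, Finset.prod_ite_mem]

theorem spinProd_symmDiff (S T : Finset V) (σ : V → ℤˣ) :
    spinProd (S ∆ T) σ = spinProd S σ * spinProd T σ := by
  simp only [spinProd_eq_prod_univ, ← Finset.prod_mul_distrib]
  refine Finset.prod_congr rfl fun i _ => ?_
  by_cases h1 : i ∈ S <;> by_cases h2 : i ∈ T <;>
    simp [Finset.mem_symmDiff, h1, h2, spin_mul_self]

theorem spinProd_singleton (i : V) (σ : V → ℤˣ) : spinProd {i} σ = ((σ i : ℤ) : ℝ) := by
  simp [spinProd]

theorem abs_spinProd (S : Finset V) (σ : V → ℤˣ) : |spinProd S σ| = 1 := by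
  rw [spinProd, Finset.abs_prod]
  refine Finset.prod_eq_one fun i _ => ?_
  rcases Int.units_eq_one_or (σ i) with h | h <;> simp [h]

/-- The sum factors over the vertices: a vertex in `S` contributes `1 + (-1)`, any other vertex
contributes `2`. -/
theorem sum_spinProd (S : Finset V) :
    ∑ σ : V → ℤˣ, spinProd S σ = if S = ∅ then 2 ^ Fintype.card V else 0 := by
  simp only [spinProd_eq_prod_univ]
  rw [← Fintype.piFinset_univ, ← Finset.prod_univ_sum (fun _ => Finset.univ)
    (fun i (s : ℤˣ) => if i ∈ S then ((s : ℤ) : ℝ) else 1)]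
  have key : ∀ i, ∑ s : ℤˣ, (if i ∈ S then ((s : ℤ) : ℝ) else 1) = if i ∈ S then 0 else 2 := by
    intro i
    rw [show (Finset.univ : Finset ℤˣ) = {1, -1} from rfl, Finset.sum_pair (by decide)]
    split_ifs <;> norm_num
  simp only [key]
  split_ifs with h
  · subst h; simp
  · obtain ⟨i, hi⟩ := Finset.nonempty_iff_ne_empty.2 h
    exact Finset.prod_eq_zero (Finset.mem_univ i) (by simp [hi])

variable (G : SimpleGraph V) [DecidableRel G.Adj]

theorem edgeSpin_eq {u v : V} (σ : V → ℤˣ) :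
    edgeSpin σ s(u, v) = spinProd {u} σ * spinProd {v} σ := by
  simp [edgeSpin, spinProd_singleton]

/-- The spin at `v` occurs as often as the degree of `v` in `A`, and squares of spins are `1`. The
induction adds one edge at a time through linearity of `∂`. -/
theorem prod_edgeSpin {A : Finset (Sym2 V)} (hA : A ⊆ G.edgeFinset) (σ : V → ℤˣ) :
    ∏ e ∈ A, edgeSpin σ e = spinProd (oddVertices A) σ := by
  induction A using Finset.induction_on with
  | empty => simp [oddVertices_empty, spinProd]
  | insert e A he ih =>
    have hins : insert e A = {e} ∆ A := by
      ext a; simp only [Finset.mem_insert, Finset.mem_symmDiff, Finset.mem_singleton]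
      constructor
      · rintro (rfl | h)
        · exact Or.inl ⟨rfl, he⟩
        · exact Or.inr ⟨h, fun h' => he (h' ▸ h)⟩
      · tauto
    rw [Finset.prod_insert he, ih ((Finset.subset_insert e A).trans hA), hins,
      oddVertices_symmDiff, spinProd_symmDiff]
    have heG : e ∈ G.edgeFinset := hA (Finset.mem_insert_self e A)
    congr 1
    induction e using Sym2.ind with
    | _ u v =>
      have huv : u ≠ v := by
        have : G.Adj u v := by simpa using heG
        exact this.ne
      rw [oddVertices_singleton huv, spinProd_symmDiff, edgeSpin_eq]

/-- The generating function of the edge sets with odd vertices `S`. -/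
def oddSum (x : ℝ) (S : Finset V) : ℝ :=
  ∑ A ∈ G.edgeFinset.powerset.filter (fun A => oddVertices A = S), x ^ A.card

/-- Multiplying out the product gives one term per edge set `A`, with spin product over `∂A ∆ S`;
the sum over the spins kills it unless `∂A = S`. -/
theorem sum_spinProd_mul_prod (x : ℝ) (S : Finset V) :
    ∑ σ : V → ℤˣ, spinProd S σ * ∏ e ∈ G.edgeFinset, (1 + x * edgeSpin σ e) =
      2 ^ Fintype.card V * oddSum G x S := by
  have h1 : ∀ σ : V → ℤˣ, spinProd S σ * ∏ e ∈ G.edgeFinset, (1 + x * edgeSpin σ e) =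
      ∑ A ∈ G.edgeFinset.powerset, x ^ A.card * spinProd (oddVertices A ∆ S) σ := by
    intro σ
    simp only [add_comm (1 : ℝ)]
    rw [Finset.prod_add, Finset.mul_sum]
    refine Finset.sum_congr rfl fun A hA => ?_
    rw [Finset.prod_mul_distrib, prod_edgeSpin G (Finset.mem_powerset.1 hA), spinProd_symmDiff]
    simp; ring
  simp only [h1]
  rw [Finset.sum_comm, oddSum, Finset.sum_filter, Finset.mul_sum]
  refine Finset.sum_congr rfl fun A _ => ?_
  rw [← Finset.mul_sum, sum_spinProd]
  by_cases h : oddVertices A = S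
  · simp [h, mul_comm]
  · simp [h]

theorem edge_factor_nonneg {x : ℝ} (h0 : 0 ≤ x) (h1 : x ≤ 1) (σ : V → ℤˣ) (e : Sym2 V) :
    0 ≤ 1 + x * edgeSpin σ e := by
  induction e using Sym2.ind with
  | _ u v =>
    rw [edgeSpin_eq, spinProd_singleton, spinProd_singleton]
    rcases Int.units_eq_one_or (σ u) with h | h <;> rcases Int.units_eq_one_or (σ v) with h' | h' <;>
      simp [h, h'] <;> linarith

/-- Back in the spin representation, both sides integrate a spin product against the same
nonnegative weight, and a spin product is at most `1`. This comparison gives the lower bound for the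
probability of `𝒞₀` as well as the congestion bound. -/
theorem oddSum_le {x : ℝ} (h0 : 0 ≤ x) (h1 : x ≤ 1) (S : Finset V) :
    oddSum G x S ≤ oddSum G x ∅ := by
  have h2 : (2 : ℝ) ^ Fintype.card V * oddSum G x S ≤ 2 ^ Fintype.card V * oddSum G x ∅ := by
    rw [← sum_spinProd_mul_prod, ← sum_spinProd_mul_prod]
    refine Finset.sum_le_sum fun σ _ => mul_le_mul_of_nonneg_right ?_
      (Finset.prod_nonneg fun e _ => edge_factor_nonneg h0 h1 σ e)
    calc spinProd S σ ≤ |spinProd S σ| := le_abs_self _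
      _ = spinProd ∅ σ := by rw [abs_spinProd]; simp [spinProd]
  exact le_of_mul_le_mul_left h2 (by positivity)

theorem oddSum_empty_pos {x : ℝ} (h0 : 0 ≤ x) : 0 < oddSum G x ∅ := by
  have : (1 : ℝ) ≤ oddSum G x ∅ := by
    have := Finset.single_le_sum (s := G.edgeFinset.powerset.filter (fun A => oddVertices A = ∅))
      (f := fun A => x ^ A.card) (fun _ _ => by positivity) (a := ∅)
      (by simp [oddVertices_empty])
    simpa [oddSum] using this
  linarith

/-- The partition function of the worm process, as a sum over the ends of the worm. -/
def wormPartition (x : ℝ) : ℝ := ∑ i : V, ∑ j : V, oddSum G x ({i} ∆ {j})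

theorem exp_mul_edgeSpin (β : ℝ) (σ : V → ℤˣ) (e : Sym2 V) :
    Real.exp (β * edgeSpin σ e) = Real.cosh β * (1 + Real.tanh β * edgeSpin σ e) := by
  have hc : Real.cosh β ≠ 0 := (Real.cosh_pos β).ne'
  have : edgeSpin σ e = 1 ∨ edgeSpin σ e = -1 := by
    induction e using Sym2.ind with
    | _ u v =>
      rw [edgeSpin_eq, spinProd_singleton, spinProd_singleton]
      rcases Int.units_eq_one_or (σ u) with h | h <;>
        rcases Int.units_eq_one_or (σ v) with h' | h' <;> simp [h, h']
  rw [Real.tanh_eq_sinh_div_cosh]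
  rcases this with h | h <;> rw [h] <;> field_simp
  · rw [Real.cosh_add_sinh]
  · rw [← sub_eq_add_neg, Real.cosh_sub_sinh]

theorem exp_hamiltonian (β : ℝ) (σ : V → ℤˣ) :
    Real.exp (-β * isingHamiltonian G σ) = Real.cosh β ^ G.edgeFinset.card *
      ∏ e ∈ G.edgeFinset, (1 + Real.tanh β * edgeSpin σ e) := by
  rw [isingHamiltonian, neg_mul_neg, Finset.mul_sum, Real.exp_sum]
  simp only [exp_mul_edgeSpin]
  rw [Finset.prod_mul_distrib, Finset.prod_const]

theorem sum_exp_mul_spinProd (β : ℝ) (S : Finset V) :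
    ∑ σ : V → ℤˣ, Real.exp (-β * isingHamiltonian G σ) * spinProd S σ =
      Real.cosh β ^ G.edgeFinset.card * 2 ^ Fintype.card V * oddSum G (Real.tanh β) S := by
  rw [mul_assoc, ← sum_spinProd_mul_prod, Finset.mul_sum]
  refine Finset.sum_congr rfl fun σ _ => ?_
  rw [exp_hamiltonian]; ring

theorem isingExp_spinProd {β : ℝ} (hβ : 0 ≤ Real.tanh β) (S : Finset V) :
    isingExp G β (spinProd S) = oddSum G (Real.tanh β) S / oddSum G (Real.tanh β) ∅ := by
  have hZ : isingPartition G β =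
      Real.cosh β ^ G.edgeFinset.card * 2 ^ Fintype.card V * oddSum G (Real.tanh β) ∅ := by
    rw [← sum_exp_mul_spinProd]; simp [isingPartition, spinProd]
  have hc : Real.cosh β ≠ 0 := (Real.cosh_pos β).ne'
  have h0 := (oddSum_empty_pos G hβ).ne'
  simp only [isingExp, isingProb, div_mul_eq_mul_div]
  rw [← Finset.sum_div, sum_exp_mul_spinProd, hZ]
  field_simp

/-- The global flip `σ ↦ -σ` preserves the energy and negates the magnetization. -/
theorem isingExp_magnetization (β : ℝ) : isingExp G β magnetization = 0 := by
  have h : isingExp G β magnetization = -isingExp G β magnetization := by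
    conv_lhs => rw [isingExp, ← Equiv.sum_comp (Equiv.neg (V → ℤˣ))]
    rw [isingExp, ← Finset.sum_neg_distrib]
    refine Finset.sum_congr rfl fun σ _ => ?_
    have h1 : isingHamiltonian G (-σ) = isingHamiltonian G σ := by
      rw [isingHamiltonian, isingHamiltonian]
      congr 1
      refine Finset.sum_congr rfl fun e _ => ?_
      induction e using Sym2.ind with
      | _ u v => simp [edgeSpin]
    simp [isingProb, h1, magnetization]
  linarith

/-- The square of the magnetization is the sum of all two-point products. With `{i} ∆ {j}` in place
of a pair, the diagonal terms are included as the even edge sets. -/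
theorem susceptibility_eq {β : ℝ} (hβ : 0 ≤ Real.tanh β) :
    susceptibility G β = wormPartition G (Real.tanh β) /
      (Fintype.card V * oddSum G (Real.tanh β) ∅) := by
  have h1 : isingExp G β (fun σ => (magnetization σ - isingExp G β magnetization) ^ 2) =
      ∑ i, ∑ j, isingExp G β (spinProd ({i} ∆ {j})) := by
    rw [isingExp_magnetization]
    simp only [isingExp]
    simp_rw [Finset.sum_comm (s := Finset.univ (α := V)) (t := Finset.univ (α := V → ℤˣ)),
      ← Finset.mul_sum]
    refine Finset.sum_congr rfl fun σ _ => ?_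
    congr 1
    simp only [spinProd_symmDiff, spinProd_singleton, magnetization, sub_zero, sq,
      Finset.sum_mul_sum]
  rw [susceptibility, h1]
  simp only [isingExp_spinProd G hβ, wormPartition, ← Finset.sum_div]
  ring

end OddVertices

/-! ### L² theory of lazy reversible chains and variance of occupation counts. -/

section ReversibleChain

variable {S : Type*} [Fintype S] [DecidableEq S]

/-- `P` is a stochastic matrix with holding probabilities at least `1/2`, reversible with respect to
the positive probability vector `π`. -/
structure LazyReversible (P : Matrix S S ℝ) (π : S → ℝ) : Prop where
  nonneg : ∀ a b, 0 ≤ P a b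
  row_sum : ∀ a, ∑ b, P a b = 1
  lazy : ∀ a, 1 / 2 ≤ P a a
  pos : ∀ a, 0 < π a
  sum_pi : ∑ a, π a = 1
  reversible : ∀ a b, π a * P a b = π b * P b a

/-- The Markov operator of the matrix `P`. -/
def avg (P : Matrix S S ℝ) (f : S → ℝ) (a : S) : ℝ := ∑ b, P a b * f b

/-- The inner product with weights `π`. -/
def wip (π f g : S → ℝ) : ℝ := ∑ a, π a * (f a * g a)

/-- The norm with weights `π`. -/
def wnorm (π f : S → ℝ) : ℝ := Real.sqrt (wip π f f)

/-- The spectral gap of `P` is at least `γ`, as a Poincaré inequality. -/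
def HasGap (P : Matrix S S ℝ) (π : S → ℝ) (γ : ℝ) : Prop :=
  ∀ f : S → ℝ, ∑ a, π a * f a = 0 → γ * wip π f f ≤ wip π f f - wip π f (avg P f)

variable {P : Matrix S S ℝ} {π : S → ℝ}

theorem avg_add (f g : S → ℝ) : avg P (f + g) = avg P f + avg P g := by
  ext a; simp [avg, mul_add, Finset.sum_add_distrib]

theorem avg_sub (f g : S → ℝ) : avg P (f - g) = avg P f - avg P g := by
  ext a; simp [avg, mul_sub, Finset.sum_sub_distrib]

theorem avg_iterate_add (k : ℕ) (f g : S → ℝ) :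
    (avg P)^[k] (f + g) = (avg P)^[k] f + (avg P)^[k] g := by
  induction k with
  | zero => rfl
  | succ k ih => simp only [Function.iterate_succ_apply', ih, avg_add]

theorem avg_iterate_sub (k : ℕ) (f g : S → ℝ) :
    (avg P)^[k] (f - g) = (avg P)^[k] f - (avg P)^[k] g := by
  induction k with
  | zero => rfl
  | succ k ih => simp only [Function.iterate_succ_apply', ih, avg_sub]

theorem avg_iterate_zero (k : ℕ) : (avg P)^[k] 0 = 0 := by
  induction k with
  | zero => rfl
  | succ k ih => rw [Function.iterate_succ_apply', ih]; ext a; simp [avg]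

theorem wip_sub_left (f g h : S → ℝ) : wip π (f - g) h = wip π f h - wip π g h := by
  simp only [wip, ← Finset.sum_sub_distrib]
  exact Finset.sum_congr rfl fun a _ => by simp; ring

namespace LazyReversible

variable (h : LazyReversible P π)
include h

theorem wip_self_nonneg (f : S → ℝ) : 0 ≤ wip π f f :=
  Finset.sum_nonneg fun a _ => mul_nonneg (h.pos a).le (mul_self_nonneg _)

theorem wip_le_norm_mul_norm (f g : S → ℝ) : wip π f g ≤ wnorm π f * wnorm π g := by
  have key := Finset.sum_mul_sq_le_sq_mul_sq Finset.univ
    (fun a => Real.sqrt (π a) * f a) (fun a => Real.sqrt (π a) * g a)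
  have hs : ∀ a, Real.sqrt (π a) * Real.sqrt (π a) = π a := fun a =>
    Real.mul_self_sqrt (h.pos a).le
  have e1 : ∀ f g : S → ℝ, ∑ a, Real.sqrt (π a) * f a * (Real.sqrt (π a) * g a) = wip π f g :=
    fun f g => Finset.sum_congr rfl fun a _ => by
      rw [← hs a, Real.mul_self_sqrt (h.pos a).le]
      linear_combination (f a * g a) * hs a
  have e2 : ∀ f : S → ℝ, ∑ a, (Real.sqrt (π a) * f a) ^ 2 = wip π f f := fun f => by
    rw [← e1]; exact Finset.sum_congr rfl fun a _ => by ring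
  rw [e1, e2, e2] at key
  rw [wnorm, wnorm, ← Real.sqrt_mul (h.wip_self_nonneg f)]
  exact Real.le_sqrt_of_sq_le key

theorem wip_avg_left (f g : S → ℝ) : wip π (avg P f) g = wip π f (avg P g) := by
  simp only [wip, avg, Finset.sum_mul, Finset.mul_sum]
  rw [Finset.sum_comm]
  refine Finset.sum_congr rfl fun a _ => Finset.sum_congr rfl fun b _ => ?_
  linear_combination (-(f a * g b)) * h.reversible a b

theorem wip_avg_iterate_left (k : ℕ) (f g : S → ℝ) :
    wip π ((avg P)^[k] f) g = wip π f ((avg P)^[k] g) := by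
  induction k generalizing f g with
  | zero => rfl
  | succ k ih => rw [Function.iterate_succ_apply', h.wip_avg_left, ih, Function.iterate_succ_apply]

theorem avg_one : avg P 1 = 1 := by
  ext a; simp [avg, h.row_sum]

theorem avg_iterate_one (k : ℕ) : (avg P)^[k] 1 = 1 := by
  induction k with
  | zero => rfl
  | succ k ih => rw [Function.iterate_succ_apply', ih, h.avg_one]

theorem sum_avg (f : S → ℝ) : ∑ a, π a * avg P f a = ∑ a, π a * f a := by
  have := h.wip_avg_left f 1
  rw [h.avg_one] at this
  simpa [wip] using this

theorem dirichlet_eq (f : S → ℝ) :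
    wip π f f - wip π f (avg P f) = 1 / 2 * ∑ a, ∑ b, π a * P a b * (f a - f b) ^ 2 := by
  have e1 : ∑ a, ∑ b, π a * P a b * f a ^ 2 = wip π f f := by
    simp only [wip, ← Finset.sum_mul, ← Finset.mul_sum, h.row_sum]
    exact Finset.sum_congr rfl fun a _ => by ring
  have e2 : ∑ a, ∑ b, π a * P a b * f b ^ 2 = wip π f f := by
    rw [← e1, Finset.sum_comm]
    refine Finset.sum_congr rfl fun a _ => Finset.sum_congr rfl fun b _ => ?_
    rw [h.reversible]
  have e3 : ∑ a, ∑ b, π a * P a b * (f a * f b) = wip π f (avg P f) := by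
    simp only [wip, avg, Finset.mul_sum]
    exact Finset.sum_congr rfl fun a _ => Finset.sum_congr rfl fun b _ => by ring
  have e4 : ∑ a, ∑ b, π a * P a b * (f a - f b) ^ 2 =
      ∑ a, ∑ b, π a * P a b * f a ^ 2 + ∑ a, ∑ b, π a * P a b * f b ^ 2 -
        2 * ∑ a, ∑ b, π a * P a b * (f a * f b) := by
    simp only [Finset.mul_sum, ← Finset.sum_add_distrib, ← Finset.sum_sub_distrib]
    exact Finset.sum_congr rfl fun a _ => Finset.sum_congr rfl fun b _ => by ring
  rw [e4, e1, e2, e3]; ring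

/-- A lazy chain has a positive Markov operator, so that `P² ≤ P`. -/
theorem wip_avg_avg_le (f : S → ℝ) : wip π (avg P f) (avg P f) ≤ wip π f (avg P f) := by
  have h1 : ∀ a, (2 * avg P f a - f a) ^ 2 ≤ 2 * avg P (fun b => f b ^ 2) a - f a ^ 2 := by
    intro a
    -- By laziness the rows of `2P - 1` are probability vectors, so Jensen applies to the square.
    -- Averaged over `π` this says that `2P - 1` is a contraction; expanding its norm gives the
    -- claim.
    set w : S → ℝ := fun b => 2 * P a b - if b = a then 1 else 0 with hw
    have hw0 : ∀ b ∈ Finset.univ, 0 ≤ w b := by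
      intro b _
      have := h.nonneg a b
      have := h.lazy a
      by_cases hb : b = a
      · subst hb; simp only [hw, if_true]; linarith
      · simp only [hw, if_neg hb]; linarith
    have hws : ∀ g : S → ℝ, ∑ b, w b * g b = 2 * avg P g a - g a := by
      intro g
      simp [hw, sub_mul, Finset.sum_sub_distrib, avg, Finset.mul_sum, mul_assoc]
    have hw1 : ∑ b, w b = 1 := by
      have := hws 1
      rw [h.avg_one] at this
      simp at this; linarith
    have hj := (Even.convexOn_pow (𝕜 := ℝ) (n := 2) (by decide)).map_sum_le hw0 hw1
      (p := f) (by simp)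
    simp only [smul_eq_mul] at hj
    rw [hws, hws (fun b => f b ^ 2)] at hj
    exact hj
  have h2 : ∑ a, π a * (2 * avg P f a - f a) ^ 2 ≤ ∑ a, π a * f a ^ 2 := by
    calc ∑ a, π a * (2 * avg P f a - f a) ^ 2
        ≤ ∑ a, π a * (2 * avg P (fun b => f b ^ 2) a - f a ^ 2) :=
          Finset.sum_le_sum fun a _ => mul_le_mul_of_nonneg_left (h1 a) (h.pos a).le
      _ = 2 * ∑ a, π a * avg P (fun b => f b ^ 2) a - ∑ a, π a * f a ^ 2 := by
          rw [Finset.mul_sum, ← Finset.sum_sub_distrib]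
          exact Finset.sum_congr rfl fun a _ => by ring
      _ = ∑ a, π a * f a ^ 2 := by rw [h.sum_avg]; ring
  have h3 : ∑ a, π a * (2 * avg P f a - f a) ^ 2 =
      4 * wip π (avg P f) (avg P f) - 4 * wip π f (avg P f) + ∑ a, π a * f a ^ 2 := by
    simp only [wip, Finset.mul_sum, ← Finset.sum_add_distrib, ← Finset.sum_sub_distrib]
    exact Finset.sum_congr rfl fun a _ => by ring
  linarith

variable {γ : ℝ} (hγ : HasGap P π γ) (h1 : γ ≤ 1)
include hγ h1

/-- One step costs a factor `1 - γ` in the squared norm: `‖Pg‖² ≤ ⟨g, Pg⟩ ≤ (1 - γ)‖g‖²`, the first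
inequality by laziness, the second by the gap. No diagonalization is needed. -/
theorem wip_iterate_le {f : S → ℝ} (hf : ∑ a, π a * f a = 0) (k : ℕ) :
    ∑ a, π a * (avg P)^[k] f a = 0 ∧
      wip π ((avg P)^[k] f) ((avg P)^[k] f) ≤ (1 - γ) ^ k * wip π f f := by
  induction k with
  | zero => simpa using hf
  | succ k ih =>
    rw [Function.iterate_succ_apply']
    refine ⟨by rw [h.sum_avg]; exact ih.1, ?_⟩
    have e1 := h.wip_avg_avg_le ((avg P)^[k] f)
    have e2 := hγ _ ih.1
    have e3 := mul_le_mul_of_nonneg_left ih.2 (sub_nonneg.2 h1)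
    rw [pow_succ]
    linarith

theorem wnorm_iterate_le {f : S → ℝ} (hf : ∑ a, π a * f a = 0) (k : ℕ) :
    wnorm π ((avg P)^[k] f) ≤ Real.sqrt (1 - γ) ^ k * wnorm π f := by
  have h0 : Real.sqrt ((1 - γ) ^ k) = Real.sqrt (1 - γ) ^ k := by
    rw [Real.sqrt_eq_iff_mul_self_eq (pow_nonneg (sub_nonneg.2 h1) k) (by positivity),
      ← mul_pow, Real.mul_self_sqrt (sub_nonneg.2 h1)]
  rw [wnorm, wnorm, ← h0, ← Real.sqrt_mul (pow_nonneg (sub_nonneg.2 h1) k)]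
  exact Real.sqrt_le_sqrt (h.wip_iterate_le hγ h1 hf k).2

/-- The left side is the correlation of `f(X_s)` and `f(X_{s+i})` for the chain started at `a₀`. The
stationary part is bounded by decay of `P^i f`. The error pairs the deviation of the density at time
`s`, of norm at most `η`, with `f · P^i f`, whose norm is at most that of `P^i f` because `|f| ≤ 1`.
Hence the error decays in `i` as well and carries a factor `‖f‖`. -/
theorem avg_iterate_mul_le {f : S → ℝ} (hf : ∑ a, π a * f a = 0) (hf1 : ∀ a, |f a| ≤ 1)
    (a₀ : S) {η : ℝ} (hη : 0 ≤ η) {s : ℕ} (hs : (1 - γ) ^ s / π a₀ ≤ η ^ 2) (i : ℕ) :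
    (avg P)^[s] (f * (avg P)^[i] f) a₀ ≤
      Real.sqrt (1 - γ) ^ i * (wip π f f + η * wnorm π f) := by
  -- The density of the point mass at `a₀` with respect to `π`; pairing with it evaluates at `a₀`.
  set d : S → ℝ := fun a => if a = a₀ then (π a₀)⁻¹ else 0 with hd
  have hp := h.pos a₀
  have hev : ∀ u : S → ℝ, wip π d u = u a₀ := by
    intro u
    simp [wip, hd]
    field_simp
  have hnf : 0 ≤ wnorm π f := Real.sqrt_nonneg _
  have hr : 0 ≤ Real.sqrt (1 - γ) ^ i := by positivity
  have hsq : wnorm π f * wnorm π f = wip π f f := Real.mul_self_sqrt (h.wip_self_nonneg f)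
  have hd0 : ∑ a, π a * (d - 1) a = 0 := by
    simp [hd, mul_sub, Finset.sum_sub_distrib, h.sum_pi, hp.ne']
  have e1 : (avg P)^[s] (f * (avg P)^[i] f) a₀ =
      wip π f ((avg P)^[i] f) + wip π ((avg P)^[s] (d - 1)) (f * (avg P)^[i] f) := by
    rw [avg_iterate_sub, h.avg_iterate_one, wip_sub_left, h.wip_avg_iterate_left, hev]
    simp [wip]
  have e2 : wip π f ((avg P)^[i] f) ≤ Real.sqrt (1 - γ) ^ i * wip π f f := by
    calc _ ≤ wnorm π f * wnorm π ((avg P)^[i] f) := h.wip_le_norm_mul_norm _ _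
      _ ≤ wnorm π f * (Real.sqrt (1 - γ) ^ i * wnorm π f) :=
        mul_le_mul_of_nonneg_left (h.wnorm_iterate_le hγ h1 hf i) hnf
      _ = _ := by rw [← hsq]; ring
  have e3 : wnorm π (f * (avg P)^[i] f) ≤ Real.sqrt (1 - γ) ^ i * wnorm π f := by
    refine le_trans (Real.sqrt_le_sqrt ?_) (h.wnorm_iterate_le hγ h1 hf i)
    refine Finset.sum_le_sum fun a _ => mul_le_mul_of_nonneg_left ?_ (h.pos a).le
    have : f a * f a ≤ 1 := by
      rw [← abs_mul_abs_self]; exact mul_le_one₀ (hf1 a) (abs_nonneg _) (hf1 a)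
    calc _ = (f a * f a) * ((avg P)^[i] f a * (avg P)^[i] f a) := by simp; ring
      _ ≤ 1 * _ := mul_le_mul_of_nonneg_right this (mul_self_nonneg _)
      _ = _ := one_mul _
  have e4 : wnorm π ((avg P)^[s] (d - 1)) ≤ η := by
    refine Real.sqrt_le_iff.2 ⟨hη, (h.wip_iterate_le hγ h1 hd0 s).2.trans (le_trans ?_ hs)⟩
    rw [div_eq_mul_inv]
    refine mul_le_mul_of_nonneg_left ?_ (pow_nonneg (sub_nonneg.2 h1) s)
    have e5 : wip π (d - 1) (d - 1) = wip π d d - 2 * wip π d 1 + ∑ a, π a := by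
      simp only [wip, Finset.mul_sum, ← Finset.sum_add_distrib, ← Finset.sum_sub_distrib]
      exact Finset.sum_congr rfl fun a _ => by simp; ring
    rw [e5, hev, hev, h.sum_pi]
    simp [hd]; linarith
  have e6 := h.wip_le_norm_mul_norm ((avg P)^[s] (d - 1)) (f * (avg P)^[i] f)
  have e7 : wnorm π ((avg P)^[s] (d - 1)) * wnorm π (f * (avg P)^[i] f) ≤
      η * (Real.sqrt (1 - γ) ^ i * wnorm π f) :=
    mul_le_mul e4 e3 (Real.sqrt_nonneg _) hη
  rw [e1]
  nlinarith

end LazyReversible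

/-- The expectation of `∑_{1 ≤ t ≤ k} f (X_t)`, as a function of the initial state. -/
def visitMean (P : Matrix S S ℝ) (f : S → ℝ) : ℕ → S → ℝ
  | 0 => 0
  | k + 1 => avg P (f + visitMean P f k)

/-- The second moment of `∑_{1 ≤ t ≤ k} f (X_t)`, as a function of the initial state. -/
def visitSq (P : Matrix S S ℝ) (f : S → ℝ) : ℕ → S → ℝ
  | 0 => 0
  | k + 1 => avg P ((f * f + (2 : ℝ) • (f * visitMean P f k)) + visitSq P f k)

theorem visitMean_eq_sum (P : Matrix S S ℝ) (f : S → ℝ) (k : ℕ) :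
    visitMean P f k = ∑ i ∈ Finset.range k, (avg P)^[i + 1] f := by
  induction k with
  | zero => rfl
  | succ k ih =>
    have hs : ∀ n : ℕ, avg P (∑ i ∈ Finset.range n, (avg P)^[i + 1] f) =
        ∑ i ∈ Finset.range n, (avg P)^[i + 2] f := by
      intro n
      induction n with
      | zero => ext; simp [avg]
      | succ n ihn => rw [Finset.sum_range_succ, avg_add, ihn, Finset.sum_range_succ,
          ← Function.iterate_succ_apply' (avg P)]
    rw [visitMean, avg_add, ih, hs, Finset.sum_range_succ', add_comm]
    rfl

/-- Each time `t > τ` contributes its own square and twice its correlations with later times. These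
form a geometric series, so every time contributes at most `4/γ` times the bound at lag zero. -/
theorem LazyReversible.visitSq_le {γ : ℝ} (h : LazyReversible P π) (hγ : HasGap P π γ)
    (h0 : 0 < γ) (h1 : γ ≤ 1) {f : S → ℝ} (hf : ∑ a, π a * f a = 0) (hf1 : ∀ a, |f a| ≤ 1)
    (a₀ : S) {η : ℝ} (hη : 0 ≤ η) {τ : ℕ} (hτ : (1 - γ) ^ τ / π a₀ ≤ η ^ 2) (N : ℕ) :
    (avg P)^[τ] (visitSq P f N) a₀ ≤ N * (4 / γ * (wip π f f + η * wnorm π f)) := by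
  set C := wip π f f + η * wnorm π f with hC
  have hC0 : 0 ≤ C := add_nonneg (h.wip_self_nonneg f) (mul_nonneg hη (Real.sqrt_nonneg _))
  set r := Real.sqrt (1 - γ) with hr
  have hr0 : 0 ≤ r := Real.sqrt_nonneg _
  -- This converts the ratio `√(1 - γ)` of the geometric series into the factor `4/γ`.
  have hr1 : r ≤ 1 - γ / 2 := by
    rw [hr, Real.sqrt_le_iff]; constructor <;> nlinarith
  have hpos : ∀ s, τ ≤ s → (1 - γ) ^ s / π a₀ ≤ η ^ 2 := fun s hs =>
    le_trans (div_le_div_of_nonneg_right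
      (pow_le_pow_of_le_one (sub_nonneg.2 h1) (by linarith) hs) (h.pos a₀).le) hτ
  have hterm : ∀ s, τ ≤ s → ∀ k : ℕ,
      (avg P)^[s] (f * f + (2 : ℝ) • (f * visitMean P f k)) a₀ ≤ 4 / γ * C := by
    intro s hs k
    have hlin : ∀ n : ℕ, (avg P)^[s] (f * ∑ i ∈ Finset.range n, (avg P)^[i + 1] f) a₀ ≤
        ∑ i ∈ Finset.range n, r ^ (i + 1) * C := by
      intro n
      induction n with
      | zero => simp [avg_iterate_zero]
      | succ n ih =>
        rw [Finset.sum_range_succ, mul_add, avg_iterate_add, Finset.sum_range_succ]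
        exact add_le_add ih (h.avg_iterate_mul_le hγ h1 hf hf1 a₀ hη (hpos s hs) (n + 1))
    have e0 := h.avg_iterate_mul_le hγ h1 hf hf1 a₀ hη (hpos s hs) 0
    have e1 := hlin k
    have e2 : (∑ i ∈ Finset.range k, r ^ (i + 1)) * (1 - r) ≤ r := by
      have : ∑ i ∈ Finset.range k, r ^ (i + 1) = r * ∑ i ∈ Finset.range k, r ^ i := by
        rw [Finset.mul_sum]; exact Finset.sum_congr rfl fun i _ => by ring
      rw [this, mul_assoc, geom_sum_mul_neg]
      have := pow_nonneg hr0 k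
      nlinarith
    have e3 : 1 + 2 * ∑ i ∈ Finset.range k, r ^ (i + 1) ≤ 4 / γ := by
      rw [le_div_iff₀ h0]
      have : 0 ≤ ∑ i ∈ Finset.range k, r ^ (i + 1) := Finset.sum_nonneg fun _ _ => by positivity
      nlinarith
    have e4 : (avg P)^[s] (f * f + (2 : ℝ) • (f * visitMean P f k)) a₀ =
        (avg P)^[s] (f * f) a₀ + 2 * (avg P)^[s] (f * visitMean P f k) a₀ := by
      rw [two_smul, avg_iterate_add, avg_iterate_add]; simp; ring
    rw [e4, visitMean_eq_sum]
    rw [← Finset.sum_mul] at e1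
    simp only [Function.iterate_zero, id, pow_zero, one_mul] at e0
    calc _ ≤ C + 2 * ((∑ i ∈ Finset.range k, r ^ (i + 1)) * C) := by linarith
      _ = (1 + 2 * ∑ i ∈ Finset.range k, r ^ (i + 1)) * C := by ring
      _ ≤ _ := mul_le_mul_of_nonneg_right e3 hC0
  -- The recursion for `visitSq` moves the starting time by one, so the induction runs over all
  -- times after the burn-in.
  have main : ∀ n t, τ ≤ t → (avg P)^[t] (visitSq P f n) a₀ ≤ n * (4 / γ * C) := by
    intro n
    induction n with
    | zero => intro t _; simp [visitSq, avg_iterate_zero]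
    | succ n ih =>
      intro t ht
      rw [visitSq, ← Function.iterate_succ_apply, avg_iterate_add]
      have e1 := hterm (t + 1) (by omega) n
      have e2 := ih (t + 1) (by omega)
      simp only [Pi.add_apply]
      push_cast
      linarith
  exact main N τ le_rfl

end ReversibleChain

/-! ### Transition probabilities, stationary weights and reversibility of the worm process. -/

section WormChain

variable {V : Type*} [Fintype V] [DecidableEq V]

theorem card_symmDiff_add {α : Type*} [DecidableEq α] (S T : Finset α) :
    (S ∆ T).card + 2 * (S ∩ T).card = S.card + T.card := by
  have e1 : (S ∆ T).card = (S \ T).card + (T \ S).card := by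
    rw [symmDiff_def, Finset.sup_eq_union, Finset.card_union_of_disjoint disjoint_sdiff_sdiff]
  have e2 := Finset.card_sdiff_add_card_inter S T
  have e3 := Finset.card_sdiff_add_card_inter T S
  rw [Finset.inter_comm T S] at e3
  omega

theorem singleton_symmDiff_singleton {u v : V} (h : u ≠ v) :
    ({u} : Finset V) ∆ {v} = {u, v} := by
  ext a; simp only [Finset.mem_symmDiff, Finset.mem_singleton, Finset.mem_insert]
  constructor
  · tauto
  · rintro (rfl | rfl)
    · exact Or.inl ⟨rfl, h⟩
    · exact Or.inr ⟨rfl, h.symm⟩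

theorem oddVertices_symmDiff_edge (A : Finset (Sym2 V)) {u v : V} (h : u ≠ v) :
    oddVertices (A ∆ {s(u, v)}) = oddVertices A ∆ {u, v} := by
  rw [oddVertices_symmDiff, oddVertices_singleton h, singleton_symmDiff_singleton h]

/-- Flipping `uv` toggles the parity of its two ends, so each end that was odd lowers the new count
by `2`. The additive form avoids truncated subtraction. -/
theorem card_oddVertices_symmDiff_edge (A : Finset (Sym2 V)) {u v : V} (h : u ≠ v) :
    (oddVertices (A ∆ {s(u, v)})).card +
      2 * ((if u ∈ oddVertices A then 1 else 0) + (if v ∈ oddVertices A then 1 else 0)) =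
      (oddVertices A).card + 2 := by
  have h1 := card_symmDiff_add (oddVertices A) {u, v}
  have h2 : (oddVertices A ∩ {u, v}).card =
      (if u ∈ oddVertices A then 1 else 0) + (if v ∈ oddVertices A then 1 else 0) := by
    by_cases hu : u ∈ oddVertices A <;> by_cases hv : v ∈ oddVertices A
    · rw [Finset.inter_insert_of_mem hu, Finset.inter_singleton_of_mem hv, Finset.card_pair h]
      simp [hu, hv]
    · rw [Finset.inter_insert_of_mem hu, Finset.inter_singleton_of_notMem hv]; simp [hu, hv]
    · rw [Finset.inter_insert_of_notMem hu, Finset.inter_singleton_of_mem hv]; simp [hu, hv]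
    · rw [Finset.inter_insert_of_notMem hu, Finset.inter_singleton_of_notMem hv]; simp [hu, hv]
  rw [Finset.card_pair h, h2] at h1
  rw [oddVertices_symmDiff_edge A h]
  exact h1

/-- The number of ordered pairs `(i, j)` with `∂A = {i} ∆ {j}`. -/
def wormMult (A : Finset (Sym2 V)) : ℝ :=
  ∑ i : V, ∑ j : V, if oddVertices A = {i} ∆ {j} then 1 else 0

theorem wormMult_of_card_zero {A : Finset (Sym2 V)} (h : (oddVertices A).card = 0) :
    wormMult A = Fintype.card V := by
  rw [Finset.card_eq_zero] at h
  have : ∀ i j : V, (∅ = ({i} : Finset V) ∆ {j}) ↔ i = j := by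
    intro i j
    rw [eq_comm, ← Finset.bot_eq_empty, symmDiff_eq_bot, Finset.singleton_inj]
  simp [wormMult, h, this]

theorem wormMult_of_card_two {A : Finset (Sym2 V)} (h : (oddVertices A).card = 2) :
    wormMult A = 2 := by
  obtain ⟨p, q, hpq, hA⟩ := Finset.card_eq_two.1 h
  have : ∀ i j : V, oddVertices A = ({i} : Finset V) ∆ {j} ↔
      (i = p ∧ j = q) ∨ (i = q ∧ j = p) := by
    intro i j
    rw [hA]
    by_cases hij : i = j
    · subst hij
      simp only [symmDiff_self, Finset.bot_eq_empty]
      constructor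
      · intro h'; simp at h'
      · rintro (⟨rfl, h'⟩ | ⟨rfl, h'⟩)
        · exact absurd h' hpq
        · exact absurd h'.symm hpq
    · rw [singleton_symmDiff_singleton hij, ← Finset.coe_inj]
      simp only [Finset.coe_insert, Finset.coe_singleton, Set.pair_eq_pair_iff]
      tauto
  have e : ∀ i j : V, (if oddVertices A = ({i} : Finset V) ∆ {j} then (1 : ℝ) else 0) =
      (if i = p then if j = q then 1 else 0 else 0) +
        (if i = q then if j = p then 1 else 0 else 0) := by
    intro i j
    rw [if_congr (this i j) rfl rfl]
    by_cases h1 : i = p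
    · subst h1; simp [hpq]
    · simp [h1, ite_and]
  simp only [wormMult, e, Finset.sum_add_distrib]
  simp; norm_num

variable (G : SimpleGraph V) [DecidableRel G.Adj]

theorem sum_wormState (f : Finset (Sym2 V) → ℝ) :
    ∑ A : WormState G, f A.1 = ∑ A ∈ G.edgeFinset.powerset.filter (fun A =>
      (oddVertices A).card = 0 ∨ (oddVertices A).card = 2), f A :=
  (Finset.sum_subtype (p := fun A => A ⊆ G.edgeFinset ∧
    ((oddVertices A).card = 0 ∨ (oddVertices A).card = 2)) _ (by intro A; simp) f).symm

/-- Edge sets outside the state space have multiplicity zero, so the sum extends to all edge sets.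
Unfolding the multiplicity and exchanging sums then sorts them by the ordered pair of ends. -/
theorem sum_wormMult_mul (f : Finset (Sym2 V) → ℝ) :
    ∑ A : WormState G, wormMult A.1 * f A.1 =
      ∑ i : V, ∑ j : V, ∑ A ∈ G.edgeFinset.powerset.filter
        (fun A => oddVertices A = {i} ∆ {j}), f A := by
  rw [sum_wormState G (fun A => wormMult A * f A)]
  have : ∑ A ∈ G.edgeFinset.powerset.filter (fun A =>
      (oddVertices A).card = 0 ∨ (oddVertices A).card = 2), wormMult A * f A =
      ∑ A ∈ G.edgeFinset.powerset, wormMult A * f A := by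
    refine Finset.sum_subset (Finset.filter_subset _ _) fun A hA hA' => ?_
    have hne : ¬ ((oddVertices A).card = 0 ∨ (oddVertices A).card = 2) := fun h' =>
      hA' (Finset.mem_filter.2 ⟨hA, h'⟩)
    have : wormMult A = 0 := by
      refine Finset.sum_eq_zero fun i _ => Finset.sum_eq_zero fun j _ => if_neg fun h' => hne ?_
      rw [h']
      by_cases hij : i = j
      · subst hij; simp
      · rw [singleton_symmDiff_singleton hij, Finset.card_pair hij]; simp
    rw [this, zero_mul]
  rw [this]
  simp only [wormMult, Finset.sum_mul, Finset.sum_filter, ite_mul, one_mul, zero_mul]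
  rw [Finset.sum_comm]
  refine Finset.sum_congr rfl fun i _ => ?_
  rw [Finset.sum_comm]

/-- The stationary distribution of the worm process. -/
def wormPi (x : ℝ) (A : WormState G) : ℝ := wormMult A.1 * x ^ A.1.card / wormPartition G x

theorem sum_wormMult_pow (x : ℝ) :
    ∑ A : WormState G, wormMult A.1 * x ^ A.1.card = wormPartition G x :=
  sum_wormMult_mul G (fun A => x ^ A.card)

theorem wormMult_pos [Nonempty V] (A : WormState G) : 0 < wormMult A.1 := by
  rcases A.2.2 with h | h
  · rw [wormMult_of_card_zero h]; exact_mod_cast Fintype.card_pos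
  · rw [wormMult_of_card_two h]; norm_num

theorem wormPartition_pos [Nonempty V] {x : ℝ} (hx : 0 < x) : 0 < wormPartition G x := by
  rw [← sum_wormMult_pow]
  exact Finset.sum_pos (fun A _ => mul_pos (wormMult_pos G A) (by positivity))
    ⟨WormState.zero G, Finset.mem_univ _⟩

/-- The probability that the step from `A` starts at the vertex `u`. -/
def wormSelect (A : Finset (Sym2 V)) (u : V) : ℝ :=
  if (oddVertices A).card = 0 then 1 / Fintype.card V else if u ∈ oddVertices A then 1 / 2 else 0

/-- The probability that the proposal to flip `uv`, made at `u`, is accepted. -/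
def wormAccept (x : ℝ) (A : Finset (Sym2 V)) (u v : V) : ℝ :=
  if (oddVertices A).card = 0 then if s(u, v) ∈ A then 1 else x
  else if v ∈ oddVertices A then if s(u, v) ∈ A then 1 else x
  else min ((G.degree u : ℝ) / (G.degree v : ℝ) * (if s(u, v) ∈ A then x⁻¹ else x)) 1

/-- The probability of flipping `uv` at `u`. -/
def wormMove (x : ℝ) (A : Finset (Sym2 V)) (u v : V) : ℝ :=
  wormSelect A u * (G.degree u : ℝ)⁻¹ * 2⁻¹ * wormAccept G x A u v

variable {G}

/-- A flip of `uv` can be proposed at either end. Between two states of `𝒞₂` exactly one end is odd,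
and the other has selection probability zero. This splitting is what the program simulates. -/
theorem wormEntry_eq (x : ℝ) (A : WormState G) {u v : V} (huv : u ≠ v)
    (hB : (oddVertices (A.1 ∆ {s(u, v)})).card = 0 ∨ (oddVertices (A.1 ∆ {s(u, v)})).card = 2) :
    wormEntry G x A.1 u v = wormMove G x A.1 u v + wormMove G x A.1 v u := by
  have hc := card_oddVertices_symmDiff_edge A.1 huv
  have hs : s(v, u) = s(u, v) := Sym2.eq_swap
  rcases A.2.2 with hA | hA
  · simp only [wormEntry, wormMove, wormSelect, wormAccept, hA, if_true, hs]
    rw [mul_comm 2 (Fintype.card V : ℝ), one_div, one_div, one_div, one_div, mul_inv]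
    ring
  · have hA0 : ¬ (oddVertices A.1).card = 0 := by omega
    rw [hA] at hc
    by_cases hu : u ∈ oddVertices A.1 <;> by_cases hv : v ∈ oddVertices A.1
    · simp only [hu, hv, if_true] at hc
      have h0 : (oddVertices (A.1 ∆ {s(u, v)})).card = 0 := by omega
      simp only [wormEntry, wormMove, wormSelect, wormAccept, hA0, if_true, if_false, hs, h0, hu,
        hv]
      ring
    · simp only [hu, hv, if_true, if_false] at hc
      have h0 : ¬ (oddVertices (A.1 ∆ {s(u, v)})).card = 0 := by omega
      simp only [wormEntry, wormMove, wormSelect, wormAccept, hA0, if_true, if_false, hs, h0, hu,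
        hv, one_div, mul_inv]
      ring
    · simp only [hu, hv, if_true, if_false] at hc
      have h0 : ¬ (oddVertices (A.1 ∆ {s(u, v)})).card = 0 := by omega
      simp only [wormEntry, wormMove, wormSelect, wormAccept, hA0, if_true, if_false, hs, h0, hu,
        hv, one_div, mul_inv]
      ring
    · simp only [hu, hv, if_false] at hc
      omega

theorem wormOffDiag_eq (x : ℝ) (A B : WormState G) :
    wormOffDiag G x A B = ∑ u : V, ∑ v : V,
      if G.Adj u v ∧ B.1 = A.1 ∆ {s(u, v)} then wormMove G x A.1 u v else 0 := by
  have h1 : ∀ u v : V,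
      (if G.Adj u v ∧ B.1 = A.1 ∆ {s(u, v)} then wormEntry G x A.1 u v else 0) =
      (if G.Adj u v ∧ B.1 = A.1 ∆ {s(u, v)} then wormMove G x A.1 u v else 0) +
      (if G.Adj v u ∧ B.1 = A.1 ∆ {s(v, u)} then wormMove G x A.1 v u else 0) := by
    intro u v
    have hs : s(v, u) = s(u, v) := Sym2.eq_swap
    by_cases h : G.Adj u v ∧ B.1 = A.1 ∆ {s(u, v)}
    · have h' : G.Adj v u ∧ B.1 = A.1 ∆ {s(v, u)} := ⟨h.1.symm, by rw [hs]; exact h.2⟩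
      rw [if_pos h, if_pos h, if_pos h', wormEntry_eq x A h.1.ne (h.2 ▸ B.2.2)]
    · have h' : ¬ (G.Adj v u ∧ B.1 = A.1 ∆ {s(v, u)}) := fun h'' =>
        h ⟨h''.1.symm, by rw [← hs]; exact h''.2⟩
      rw [if_neg h, if_neg h, if_neg h', add_zero]
  simp only [wormOffDiag, h1, Finset.sum_add_distrib]
  rw [Finset.sum_comm (f := fun u v =>
    if G.Adj v u ∧ B.1 = A.1 ∆ {s(v, u)} then wormMove G x A.1 v u else 0)]
  ring

theorem wormSelect_nonneg (A : Finset (Sym2 V)) (u : V) : 0 ≤ wormSelect A u := by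
  unfold wormSelect; split_ifs <;> positivity

theorem sum_wormSelect [Nonempty V] (A : WormState G) : ∑ u, wormSelect A.1 u = 1 := by
  have hV : (Fintype.card V : ℝ) ≠ 0 := by exact_mod_cast Fintype.card_ne_zero
  rcases A.2.2 with h | h
  · simp [wormSelect, h, hV]
  · have h0 : ¬ (oddVertices A.1).card = 0 := by omega
    simp only [wormSelect, h0, if_false]
    rw [← Finset.sum_filter, Finset.filter_mem_eq_inter, Finset.univ_inter, Finset.sum_const, h]
    norm_num

theorem wormAccept_nonneg {x : ℝ} (hx : 0 ≤ x) (A : Finset (Sym2 V)) (u v : V) :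
    0 ≤ wormAccept G x A u v := by
  have : 0 ≤ (G.degree u : ℝ) / (G.degree v : ℝ) * (if s(u, v) ∈ A then x⁻¹ else x) := by
    split_ifs <;> positivity
  unfold wormAccept; split_ifs <;> positivity

theorem wormAccept_le_one {x : ℝ} (hx : x ≤ 1) (A : Finset (Sym2 V)) (u v : V) :
    wormAccept G x A u v ≤ 1 := by
  unfold wormAccept; split_ifs <;> first | exact le_rfl | exact hx | exact min_le_right _ _

theorem wormMove_nonneg {x : ℝ} (hx : 0 ≤ x) (A : Finset (Sym2 V)) (u v : V) :
    0 ≤ wormMove G x A u v :=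
  mul_nonneg (mul_nonneg (mul_nonneg (wormSelect_nonneg A u) (by positivity)) (by norm_num))
    (wormAccept_nonneg hx A u v)

theorem wormOffDiag_nonneg {x : ℝ} (hx : 0 ≤ x) (A B : WormState G) :
    0 ≤ wormOffDiag G x A B := by
  rw [wormOffDiag_eq]
  refine Finset.sum_nonneg fun u _ => Finset.sum_nonneg fun v _ => ?_
  split_ifs
  · exact wormMove_nonneg hx _ _ _
  · exact le_rfl

/-- Every move carries the factor `1/2`. The remaining factors are the probabilities of selecting
`u`, of choosing a neighbour `v`, and of accepting, and a pair `(u, v)` leads to at most one state.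
-/
theorem sum_wormOffDiag_le [Nonempty V] {x : ℝ} (h0 : 0 ≤ x) (h1 : x ≤ 1) (A : WormState G) :
    ∑ B, wormOffDiag G x A B ≤ 1 / 2 := by
  simp only [wormOffDiag_eq]
  rw [Finset.sum_comm]
  calc ∑ u, ∑ B : WormState G, ∑ v,
        (if G.Adj u v ∧ B.1 = A.1 ∆ {s(u, v)} then wormMove G x A.1 u v else 0)
      ≤ ∑ u, wormSelect A.1 u * 2⁻¹ := Finset.sum_le_sum fun u _ => ?_
    _ = 1 / 2 := by rw [← Finset.sum_mul, sum_wormSelect]; norm_num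
  rw [Finset.sum_comm]
  have hv : ∀ v, ∑ B : WormState G,
      (if G.Adj u v ∧ B.1 = A.1 ∆ {s(u, v)} then wormMove G x A.1 u v else 0) ≤
      if G.Adj u v then wormSelect A.1 u * (G.degree u : ℝ)⁻¹ * 2⁻¹ else 0 := by
    intro v
    by_cases hadj : G.Adj u v
    · simp only [hadj, true_and, if_true]
      have hmove : wormMove G x A.1 u v ≤ wormSelect A.1 u * (G.degree u : ℝ)⁻¹ * 2⁻¹ :=
        mul_le_of_le_one_right (mul_nonneg (mul_nonneg (wormSelect_nonneg _ _) (by positivity))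
          (by norm_num)) (wormAccept_le_one h1 _ _ _)
      refine le_trans ?_ hmove
      by_cases hB : ∃ B : WormState G, B.1 = A.1 ∆ {s(u, v)}
      · obtain ⟨B, hB⟩ := hB
        rw [Finset.sum_eq_single B]
        · rw [if_pos hB]
        · intro C _ hC
          exact if_neg fun h' => hC (Subtype.ext (h'.trans hB.symm))
        · simp
      · rw [Finset.sum_eq_zero fun B _ => if_neg fun h' => hB ⟨B, h'⟩]
        exact wormMove_nonneg h0 _ _ _
    · simp [hadj]
  refine (Finset.sum_le_sum fun v _ => hv v).trans ?_
  rw [← Finset.sum_filter, Finset.sum_const, ← SimpleGraph.neighborFinset_eq_filter,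
    SimpleGraph.card_neighborFinset_eq_degree, nsmul_eq_mul]
  -- At an isolated vertex the inverse degree is zero by convention, and only the inequality remains
  -- true.
  by_cases hd : (G.degree u : ℝ) = 0
  · rw [hd]; simp; exact wormSelect_nonneg _ _
  · apply le_of_eq; field_simp

theorem symmDiff_singleton_of_mem {A : Finset (Sym2 V)} {e : Sym2 V} (h : e ∈ A) :
    (A ∆ {e}) = A.erase e := by
  ext a; by_cases ha : a = e
  · subst ha; simp [Finset.mem_symmDiff, h]
  · simp [Finset.mem_symmDiff, ha]

theorem symmDiff_singleton_of_notMem {A : Finset (Sym2 V)} {e : Sym2 V} (h : e ∉ A) :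
    (A ∆ {e}) = insert e A := by
  ext a; by_cases ha : a = e
  · subst ha; simp [Finset.mem_symmDiff, h]
  · simp [Finset.mem_symmDiff, ha]

theorem pow_card_symmDiff {x : ℝ} (hx : x ≠ 0) (A : Finset (Sym2 V)) (e : Sym2 V) :
    x ^ (A ∆ {e}).card = x ^ A.card * (if e ∈ A then x⁻¹ else x) := by
  split_ifs with h
  · rw [symmDiff_singleton_of_mem h, ← Finset.card_erase_add_one h, pow_succ]; field_simp
  · rw [symmDiff_singleton_of_notMem h, Finset.card_insert_of_notMem h, pow_succ]

theorem pow_card_insert (x : ℝ) (A : Finset (Sym2 V)) (e : Sym2 V) :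
    x ^ (insert e A).card = x ^ A.card * (if e ∈ A then 1 else x) := by
  split_ifs with h
  · rw [Finset.insert_eq_of_mem h, mul_one]
  · rw [Finset.card_insert_of_notMem h, pow_succ]

/-- The multiplicities `n` and `2` cancel the constants `1/(2n)` and `1/4` of the transition matrix.
What remains has Metropolis form: a function of `A ∪ {uv}`, or a minimum of two terms, one for each
end of the transition. -/
theorem wormFlow_eq [Nonempty V] {x : ℝ} (hx : 0 < x) (A : WormState G) {u v : V}
    (huv : G.Adj u v) :
    wormMult A.1 * x ^ A.1.card * wormEntry G x A.1 u v =
      if (oddVertices A.1).card = 0 ∨ (oddVertices (A.1 ∆ {s(u, v)})).card = 0 then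
        1 / 2 * x ^ (insert s(u, v) A.1).card * ((G.degree u : ℝ)⁻¹ + (G.degree v : ℝ)⁻¹)
      else if u ∈ oddVertices A.1 then
        1 / 2 * min (x ^ (A.1 ∆ {s(u, v)}).card * (G.degree v : ℝ)⁻¹)
          (x ^ A.1.card * (G.degree u : ℝ)⁻¹)
      else
        1 / 2 * min (x ^ (A.1 ∆ {s(u, v)}).card * (G.degree u : ℝ)⁻¹)
          (x ^ A.1.card * (G.degree v : ℝ)⁻¹) := by
  have hV : (Fintype.card V : ℝ) ≠ 0 := by exact_mod_cast Fintype.card_ne_zero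
  have hdu : 0 < (G.degree u : ℝ) := by
    exact_mod_cast (G.degree_pos_iff_exists_adj u).2 ⟨v, huv⟩
  have hdv : 0 < (G.degree v : ℝ) := by
    exact_mod_cast (G.degree_pos_iff_exists_adj v).2 ⟨u, huv.symm⟩
  have key : ∀ a b t y : ℝ, 0 < a → 0 < b → 0 < y →
      2 * y * (min (a / b * t) 1 * (1 / (4 * a))) = 1 / 2 * min (y * t * b⁻¹) (y * a⁻¹) := by
    intro a b t y ha hb hy
    have : min (y * t * b⁻¹) (y * a⁻¹) = y * a⁻¹ * min (a / b * t) 1 := by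
      rw [mul_min_of_nonneg _ _ (by positivity)]
      congr 1
      · field_simp
      · ring
    rw [this, one_div, mul_inv]; ring
  rcases A.2.2 with hA | hA
  · rw [wormMult_of_card_zero hA, if_pos (Or.inl hA), pow_card_insert]
    simp only [wormEntry, hA, if_true]
    field_simp
  · have hA0 : ¬ (oddVertices A.1).card = 0 := by omega
    rw [wormMult_of_card_two hA]
    by_cases h0 : (oddVertices (A.1 ∆ {s(u, v)})).card = 0
    · rw [if_pos (Or.inr h0), pow_card_insert]
      simp only [wormEntry, hA0, h0, if_true, if_false]
      ring
    · rw [if_neg (not_or.2 ⟨hA0, h0⟩), pow_card_symmDiff hx.ne']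
      simp only [wormEntry, hA0, h0, if_false]
      by_cases hu : u ∈ oddVertices A.1
      · simp only [hu, if_true]
        exact key _ _ _ _ hdu hdv (by positivity)
      · simp only [hu, if_false]
        exact key _ _ _ _ hdv hdu (by positivity)

/-- Within `𝒞₂` the vertex `u` is odd in exactly one of `A` and `B`, so passing from `A` to `B`
changes the branch and swaps the arguments of the minimum. -/
theorem wormFlow_symm [Nonempty V] {x : ℝ} (hx : 0 < x) (A B : WormState G) {u v : V}
    (huv : G.Adj u v) (hB : B.1 = A.1 ∆ {s(u, v)}) :
    wormMult A.1 * x ^ A.1.card * wormEntry G x A.1 u v =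
      wormMult B.1 * x ^ B.1.card * wormEntry G x B.1 u v := by
  have hA : A.1 = B.1 ∆ {s(u, v)} := by rw [hB, symmDiff_symmDiff_cancel_right]
  have hins : insert s(u, v) A.1 = insert s(u, v) B.1 := by
    rw [hB]; ext a; by_cases ha : a = s(u, v) <;> simp [Finset.mem_symmDiff, ha]
  rw [wormFlow_eq hx A huv, wormFlow_eq hx B huv, ← hA, ← hB, hins]
  by_cases h : (oddVertices A.1).card = 0 ∨ (oddVertices B.1).card = 0
  · rw [if_pos h, if_pos h.symm]
  · have h2 : ¬ ((oddVertices B.1).card = 0 ∨ (oddVertices A.1).card = 0) := fun h' => h h'.symm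
    rw [if_neg h, if_neg h2]
    rw [not_or] at h
    have hu : u ∈ oddVertices B.1 ↔ u ∉ oddVertices A.1 := by
      rw [hB, oddVertices_symmDiff_edge _ huv.ne]; simp [Finset.mem_symmDiff]
    by_cases hu' : u ∈ oddVertices A.1
    · rw [if_pos hu', if_neg (by rw [hu]; exact not_not.2 hu'), min_comm]
    · rw [if_neg hu', if_pos (hu.2 hu'), min_comm]

/-- Both `A` and `A ∆ {uv}` lie in `A ∪ {uv}`, so with `x ≤ 1` one bound serves every branch. It has
the same form whichever end of the transition is taken as `A`, which lets the path argument ignore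
the type of the transition. -/
theorem wormFlow_lower [Nonempty V] {x : ℝ} (hx : 0 < x) (hx1 : x ≤ 1) (A : WormState G) {u v : V}
    (huv : G.Adj u v) :
    x ^ (insert s(u, v) A.1).card / (2 * G.maxDegree) ≤
      wormMult A.1 * x ^ A.1.card * wormEntry G x A.1 u v := by
  have hdu : 0 < (G.degree u : ℝ) := by
    exact_mod_cast (G.degree_pos_iff_exists_adj u).2 ⟨v, huv⟩
  have hdv : 0 < (G.degree v : ℝ) := by
    exact_mod_cast (G.degree_pos_iff_exists_adj v).2 ⟨u, huv.symm⟩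
  have hu : (G.maxDegree : ℝ)⁻¹ ≤ (G.degree u : ℝ)⁻¹ :=
    inv_anti₀ hdu (by exact_mod_cast G.degree_le_maxDegree u)
  have hv : (G.maxDegree : ℝ)⁻¹ ≤ (G.degree v : ℝ)⁻¹ :=
    inv_anti₀ hdv (by exact_mod_cast G.degree_le_maxDegree v)
  have hD : 0 ≤ (G.maxDegree : ℝ)⁻¹ := by positivity
  have hp1 : x ^ (insert s(u, v) A.1).card ≤ x ^ A.1.card :=
    pow_le_pow_of_le_one hx.le hx1 (Finset.card_le_card (Finset.subset_insert _ _))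
  have hp2 : x ^ (insert s(u, v) A.1).card ≤ x ^ (A.1 ∆ {s(u, v)}).card := by
    refine pow_le_pow_of_le_one hx.le hx1 (Finset.card_le_card fun a ha => ?_)
    rw [Finset.mem_symmDiff] at ha
    rw [Finset.mem_insert]
    rcases ha with ha | ha
    · exact Or.inr ha.1
    · exact Or.inl (Finset.mem_singleton.1 ha.1)
  have hp0 : 0 < x ^ (insert s(u, v) A.1).card := by positivity
  have e : x ^ (insert s(u, v) A.1).card / (2 * G.maxDegree) =
      1 / 2 * (x ^ (insert s(u, v) A.1).card * (G.maxDegree : ℝ)⁻¹) := by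
    rw [div_eq_mul_inv, mul_inv]; ring
  rw [wormFlow_eq hx A huv, e]
  split_ifs
  · rw [mul_assoc]
    gcongr
    linarith
  · refine mul_le_mul_of_nonneg_left (le_min ?_ ?_) (by norm_num) <;> gcongr
  · refine mul_le_mul_of_nonneg_left (le_min ?_ ?_) (by norm_num) <;> gcongr

theorem wormEntry_le_offDiag {x : ℝ} (hx : 0 ≤ x) (A B : WormState G) {u v : V}
    (huv : G.Adj u v) (hB : B.1 = A.1 ∆ {s(u, v)}) :
    wormEntry G x A.1 u v ≤ wormOffDiag G x A B := by
  rw [wormEntry_eq x A huv.ne (hB ▸ B.2.2), wormOffDiag_eq,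
    ← Fintype.sum_prod_type' (f := fun u v =>
      if G.Adj u v ∧ B.1 = A.1 ∆ {s(u, v)} then wormMove G x A.1 u v else 0)]
  have hne : (u, v) ≠ (v, u) := fun h => huv.ne (Prod.ext_iff.1 h).1
  have h1 := Finset.sum_le_sum_of_subset_of_nonneg (Finset.subset_univ {(u, v), (v, u)})
    (f := fun p : V × V =>
      if G.Adj p.1 p.2 ∧ B.1 = A.1 ∆ {s(p.1, p.2)} then wormMove G x A.1 p.1 p.2 else 0)
    (fun p _ _ => by
      split_ifs
      · exact wormMove_nonneg hx _ _ _
      · exact le_rfl)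
  rw [Finset.sum_pair hne] at h1
  have hs : s(v, u) = s(u, v) := Sym2.eq_swap
  simp only [huv, huv.symm, hs, ← hB, and_self, if_true] at h1
  exact h1

theorem wormMatrix_self (x : ℝ) (A : WormState G) :
    wormMatrix G x A A = 1 - ∑ C ∈ Finset.univ.erase A, wormOffDiag G x A C := by
  simp [wormMatrix]

theorem wormMatrix_of_ne (x : ℝ) {A B : WormState G} (h : A ≠ B) :
    wormMatrix G x A B = wormOffDiag G x A B := by
  simp [wormMatrix, h]

theorem lazyReversible_wormMatrix [Nonempty V] {x : ℝ} (hx : 0 < x) (hx1 : x ≤ 1) :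
    LazyReversible (wormMatrix G x) (wormPi G x) := by
  have hZ := wormPartition_pos G hx
  have hlazy : ∀ A : WormState G, 1 / 2 ≤ wormMatrix G x A A := by
    intro A
    have h1 := sum_wormOffDiag_le hx.le hx1 A
    have h2 := Finset.sum_le_sum_of_subset_of_nonneg (Finset.erase_subset A Finset.univ)
      (f := fun C => wormOffDiag G x A C) (fun C _ _ => wormOffDiag_nonneg hx.le A C)
    rw [wormMatrix_self]
    linarith
  refine ⟨fun A B => ?_, fun A => ?_, hlazy, fun A => ?_, ?_, fun A B => ?_⟩
  · by_cases h : A = B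
    · subst h; linarith [hlazy A]
    · rw [wormMatrix_of_ne x h]; exact wormOffDiag_nonneg hx.le A B
  · rw [← Finset.add_sum_erase _ _ (Finset.mem_univ A), wormMatrix_self,
      Finset.sum_congr rfl fun B hB => wormMatrix_of_ne x (Finset.ne_of_mem_erase hB).symm]
    ring
  · exact div_pos (mul_pos (wormMult_pos G A) (by positivity)) hZ
  · simp only [wormPi]
    rw [← Finset.sum_div, sum_wormMult_pow, div_self hZ.ne']
  · by_cases h : A = B
    · rw [h]
    · rw [wormMatrix_of_ne x h, wormMatrix_of_ne x (Ne.symm h), wormPi, wormPi,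
        div_mul_eq_mul_div, div_mul_eq_mul_div]
      congr 1
      simp only [wormOffDiag, Finset.mul_sum]
      refine Finset.sum_congr rfl fun u _ => Finset.sum_congr rfl fun v _ => ?_
      by_cases h' : G.Adj u v ∧ B.1 = A.1 ∆ {s(u, v)}
      · have h'' : G.Adj u v ∧ A.1 = B.1 ∆ {s(u, v)} :=
          ⟨h'.1, by rw [h'.2, symmDiff_symmDiff_cancel_right]⟩
        rw [if_pos h', if_pos h'']
        linear_combination (1 / 2) * wormFlow_symm hx A B h'.1 h'.2
      · have h'' : ¬ (G.Adj u v ∧ A.1 = B.1 ∆ {s(u, v)}) := fun h'' =>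
          h' ⟨h''.1, by rw [h''.2, symmDiff_symmDiff_cancel_right]⟩
        rw [if_neg h', if_neg h'']; simp

end WormChain

/-! ### Canonical paths and the Poincaré inequality. -/

section Poincare

variable {V : Type*} [Fintype V] [DecidableEq V]

/-- From an even set any edge may go: its ends become the two odd vertices. Otherwise an odd vertex
has an edge in `D`; removing it makes that vertex even and toggles the other end. -/
theorem exists_erase_edge (G : SimpleGraph V) [DecidableRel G.Adj] {D : Finset (Sym2 V)}
    (hD : D ⊆ G.edgeFinset) (hne : D.Nonempty)
    (hodd : (oddVertices D).card = 0 ∨ (oddVertices D).card = 2) :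
    ∃ e ∈ D, (oddVertices (D.erase e)).card = 0 ∨ (oddVertices (D.erase e)).card = 2 := by
  have hadj : ∀ u v, s(u, v) ∈ D → u ≠ v := fun u v h =>
    (by simpa using hD h : G.Adj u v).ne
  rcases hodd with h | h
  · obtain ⟨e, he⟩ := hne
    refine ⟨e, he, ?_⟩
    induction e using Sym2.ind with
    | _ u v =>
      have hc := card_oddVertices_symmDiff_edge D (hadj u v he)
      rw [symmDiff_singleton_of_mem he] at hc
      rw [Finset.card_eq_zero] at h
      simp [h] at hc
      exact Or.inr hc
  · obtain ⟨p, hp⟩ : (oddVertices D).Nonempty := Finset.card_pos.1 (by omega)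
    have hpos : 0 < subDegree D p := (mem_oddVertices.1 hp).pos
    obtain ⟨w, hw⟩ := Finset.card_pos.1 hpos
    have he : s(w, p) ∈ D := (Finset.mem_filter.1 hw).2
    refine ⟨_, he, ?_⟩
    have hc := card_oddVertices_symmDiff_edge D (hadj w p he)
    rw [symmDiff_singleton_of_mem he, h] at hc
    by_cases hw' : w ∈ oddVertices D <;> simp only [hw', hp, if_true, if_false] at hc <;> omega

/-- The edges of a state can be removed one by one without leaving the state space: `R e` is what
is left before the removal of `e`. -/
theorem exists_unwinding (G : SimpleGraph V) [DecidableRel G.Adj] (D : Finset (Sym2 V))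
    (hD : D ⊆ G.edgeFinset) (hodd : (oddVertices D).card = 0 ∨ (oddVertices D).card = 2) :
    ∃ R : Sym2 V → Finset (Sym2 V),
      (∀ e ∈ D, e ∈ R e ∧ R e ⊆ D ∧
        ((oddVertices (R e)).card = 0 ∨ (oddVertices (R e)).card = 2) ∧
        ((oddVertices ((R e).erase e)).card = 0 ∨ (oddVertices ((R e).erase e)).card = 2)) ∧
      ∀ h : Finset (Sym2 V) → ℝ, h D - h ∅ = ∑ e ∈ D, (h (R e) - h ((R e).erase e)) := by
  induction hn : D.card generalizing D with
  | zero =>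
    rw [Finset.card_eq_zero] at hn
    subst hn
    exact ⟨fun _ => ∅, by simp, by simp⟩
  | succ n ih =>
    obtain ⟨e, he, hodd'⟩ := exists_erase_edge G hD (Finset.card_pos.1 (by omega)) hodd
    obtain ⟨R, hR, hsum⟩ := ih (D.erase e) ((Finset.erase_subset e D).trans hD) hodd'
      (by rw [Finset.card_erase_of_mem he]; omega)
    have hRe : ∀ a ∈ D.erase e, Function.update R e D a = R a := fun a ha =>
      Function.update_of_ne (Finset.ne_of_mem_erase ha) _ _
    refine ⟨Function.update R e D, fun a ha => ?_, fun h => ?_⟩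
    · by_cases hae : a = e
      · subst hae
        rw [Function.update_self]
        exact ⟨he, subset_rfl, hodd, hodd'⟩
      · have ha' := Finset.mem_erase.2 ⟨hae, ha⟩
        rw [hRe a ha']
        obtain ⟨h1, h2, h3⟩ := hR a ha'
        exact ⟨h1, h2.trans (Finset.erase_subset _ _), h3⟩
    · rw [← Finset.add_sum_erase _ _ he, Function.update_self]
      rw [Finset.sum_congr rfl fun a ha => by rw [hRe a ha], ← hsum]
      ring

/-- The second set is `F ∆ (D \ R)`, and `F` meets `R` and `D \ R` in two disjoint parts that make
up `F ∩ D`. -/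
theorem card_symmDiff_add_card_symmDiff {α : Type*} [DecidableEq α] (F : Finset α)
    {R D : Finset α} (hR : R ⊆ D) :
    (F ∆ R).card + (D ∆ (F ∆ R)).card = F.card + (F ∆ D).card := by
  have e : D ∆ (F ∆ R) = F ∆ (D \ R) := by
    ext a
    have := @hR a
    simp only [Finset.mem_symmDiff, Finset.mem_sdiff]
    tauto
  rw [e]
  have h1 := card_symmDiff_add F R
  have h2 := card_symmDiff_add F (D \ R)
  have h3 := card_symmDiff_add F D
  have h4 : (F ∩ R).card + (F ∩ (D \ R)).card = (F ∩ D).card := by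
    rw [← Finset.card_union_of_disjoint, ← Finset.inter_union_distrib_left,
      Finset.union_sdiff_of_subset hR]
    exact Finset.disjoint_of_subset_left Finset.inter_subset_right
      (Finset.disjoint_of_subset_right Finset.inter_subset_right Finset.disjoint_sdiff)
  have h5 := Finset.card_sdiff_add_card_eq_card hR
  omega

theorem symmDiff_erase {α : Type*} [DecidableEq α] (F : Finset α) {R : Finset α} {e : α}
    (he : e ∈ R) : F ∆ (R.erase e) = (F ∆ R) ∆ {e} := by
  ext a
  by_cases ha : a = e
  · subst ha; simp [Finset.mem_symmDiff, he]
  · simp [Finset.mem_symmDiff, ha]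

/-- Adding `e` to `F ∆ R` either changes nothing or amounts to replacing `R` by `R.erase e`, so the
cardinality identity applies. With `A = F ∆ R`, the weight of the pair becomes that of the
transition at `A` times a factor in which `F` enters through `A` only. -/
theorem pow_mul_pow_symmDiff (x : ℝ) {α : Type*} [DecidableEq α] (F : Finset α)
    {R D : Finset α} {e : α} (hR : R ⊆ D) (he : e ∈ R) :
    x ^ F.card * x ^ (F ∆ D).card =
      x ^ (insert e (F ∆ R)).card * x ^ (D ∆ (insert e (F ∆ R))).card := by
  have : ∃ R' ⊆ D, insert e (F ∆ R) = F ∆ R' := by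
    by_cases h : e ∈ F ∆ R
    · exact ⟨R, hR, Finset.insert_eq_of_mem h⟩
    · refine ⟨R.erase e, (Finset.erase_subset e R).trans hR, ?_⟩
      rw [symmDiff_erase F he]
      ext a; by_cases ha : a = e
      · subst ha; simp [Finset.mem_symmDiff, h]
      · simp [Finset.mem_symmDiff, ha]
  obtain ⟨R', hR', h⟩ := this
  rw [h, ← pow_add, ← pow_add, card_symmDiff_add_card_symmDiff F hR']

variable (G : SimpleGraph V) [DecidableRel G.Adj]

/-- The congestion bound. For each of the `n²` pairs of ends, `A ↦ A ∆ B` is a bijection onto the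
edge sets with another prescribed boundary, and `oddSum_le` compares their sum with the even one. -/
theorem sum_wormMult_mul_pow_symmDiff_le {x : ℝ} (h0 : 0 ≤ x) (h1 : x ≤ 1) {B : Finset (Sym2 V)}
    (hB : B ⊆ G.edgeFinset) :
    ∑ D : WormState G, wormMult D.1 * x ^ (D.1 ∆ B).card ≤
      (Fintype.card V : ℝ) ^ 2 * oddSum G x ∅ := by
  rw [sum_wormMult_mul G (fun D => x ^ (D ∆ B).card)]
  have : ∀ i j : V, ∑ A ∈ G.edgeFinset.powerset.filter (fun A => oddVertices A = {i} ∆ {j}),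
      x ^ (A ∆ B).card ≤ oddSum G x ∅ := by
    intro i j
    refine le_trans (le_of_eq ?_) (oddSum_le G h0 h1 (({i} ∆ {j}) ∆ oddVertices B))
    have hsub : ∀ A ⊆ G.edgeFinset, A ∆ B ⊆ G.edgeFinset := fun A hA a ha => by
      rcases Finset.mem_symmDiff.1 ha with h | h
      · exact hA h.1
      · exact hB h.1
    refine Finset.sum_nbij' (fun A => A ∆ B) (fun A => A ∆ B) ?_ ?_ ?_ ?_ ?_
    · intro A hA
      rw [Finset.mem_filter, Finset.mem_powerset] at hA ⊢
      exact ⟨hsub A hA.1, by rw [oddVertices_symmDiff, hA.2]⟩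
    · intro A hA
      rw [Finset.mem_filter, Finset.mem_powerset] at hA ⊢
      exact ⟨hsub A hA.1, by rw [oddVertices_symmDiff, hA.2, symmDiff_symmDiff_cancel_right]⟩
    · intro A _; exact symmDiff_symmDiff_cancel_right _ _
    · intro A _; exact symmDiff_symmDiff_cancel_right _ _
    · intro A _; rfl
  calc _ ≤ ∑ i : V, ∑ j : V, oddSum G x ∅ :=
        Finset.sum_le_sum fun i _ => Finset.sum_le_sum fun j _ => this i j
    _ = _ := by simp; ring

variable {G}

/-- The symmetric difference of an even state with a state. -/
def WormState.comb (F D : WormState G) (hF : (oddVertices F.1).card = 0) : WormState G :=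
  ⟨F.1 ∆ D.1, fun a ha => by
      rcases Finset.mem_symmDiff.1 ha with h | h
      · exact F.2.1 h.1
      · exact D.2.1 h.1, by
    rw [oddVertices_symmDiff, Finset.card_eq_zero.1 hF, ← Finset.bot_eq_empty, bot_symmDiff]
    exact D.2.2⟩

theorem oddVertices_symmDiff_of_even {F : Finset (Sym2 V)} (hF : (oddVertices F).card = 0)
    (D : Finset (Sym2 V)) : oddVertices (F ∆ D) = oddVertices D := by
  rw [oddVertices_symmDiff, Finset.card_eq_zero.1 hF, ← Finset.bot_eq_empty, bot_symmDiff]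

/-- The extension of a function on the states to all edge sets. -/
def extendState (f : WormState G → ℝ) (A : Finset (Sym2 V)) : ℝ :=
  open Classical in
  if h : A ⊆ G.edgeFinset ∧ ((oddVertices A).card = 0 ∨ (oddVertices A).card = 2) then f ⟨A, h⟩
  else 0

theorem extendState_coe (f : WormState G → ℝ) (A : WormState G) : extendState f A.1 = f A :=
  dif_pos A.2

/-- The contribution of the transition that flips `e` in `A` to the Dirichlet form, up to a
factor. -/
def edgeEnergy (x : ℝ) (f : WormState G → ℝ) (A : Finset (Sym2 V)) (e : Sym2 V) : ℝ :=
  if (oddVertices (A ∆ {e})).card = 0 ∨ (oddVertices (A ∆ {e})).card = 2 then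
    x ^ (insert e A).card * (extendState f A - extendState f (A ∆ {e})) ^ 2 else 0

theorem edgeEnergy_nonneg {x : ℝ} (hx : 0 ≤ x) (f : WormState G → ℝ) (A : Finset (Sym2 V))
    (e : Sym2 V) : 0 ≤ edgeEnergy x f A e := by
  unfold edgeEnergy; split_ifs <;> positivity

/-- Different edges lead to different states, so each flip is charged to its own transition through
`wormFlow_lower`. -/
theorem sum_edgeEnergy_le [Nonempty V] {x : ℝ} (hx : 0 < x) (hx1 : x ≤ 1)
    (hΔ : 0 < G.maxDegree) (f : WormState G → ℝ)
    (A : WormState G) :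
    ∑ e ∈ G.edgeFinset, edgeEnergy x f A.1 e ≤ 2 * G.maxDegree *
      ∑ B, wormMult A.1 * x ^ A.1.card * wormMatrix G x A B * (f A - f B) ^ 2 := by
  have hP := lazyReversible_wormMatrix (G := G) hx hx1
  have hD : (0 : ℝ) < 2 * G.maxDegree := by positivity
  set g : WormState G → ℝ := fun B =>
    2 * G.maxDegree * (wormMult A.1 * x ^ A.1.card * wormMatrix G x A B * (f A - f B) ^ 2) with hg
  have hg0 : ∀ B, 0 ≤ g B := fun B => mul_nonneg hD.le (mul_nonneg (mul_nonneg
    (mul_nonneg (wormMult_pos G A).le (by positivity)) (hP.nonneg A B)) (sq_nonneg _))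
  have h1 : ∀ e ∈ G.edgeFinset, edgeEnergy x f A.1 e ≤
      ∑ B : WormState G, if B.1 = A.1 ∆ {e} then g B else 0 := by
    intro e he
    have hs0 : 0 ≤ ∑ B : WormState G, if B.1 = A.1 ∆ {e} then g B else 0 :=
      Finset.sum_nonneg fun B _ => by split_ifs <;> first | exact hg0 B | exact le_rfl
    unfold edgeEnergy
    split_ifs with hodd
    · let B : WormState G := ⟨A.1 ∆ {e}, fun a ha => by
        rcases Finset.mem_symmDiff.1 ha with h | h
        · exact A.2.1 h.1
        · rw [Finset.mem_singleton.1 h.1]; exact he, hodd⟩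
      have hB : B.1 = A.1 ∆ {e} := rfl
      refine le_trans ?_ (Finset.single_le_sum (f := fun B : WormState G =>
        if B.1 = A.1 ∆ {e} then g B else 0) (fun B _ => by
          split_ifs <;> first | exact hg0 B | exact le_rfl) (Finset.mem_univ B))
      simp only [if_pos hB, hg]
      rw [← hB, extendState_coe, extendState_coe, ← mul_assoc]
      refine mul_le_mul_of_nonneg_right ?_ (sq_nonneg _)
      have hne : A ≠ B := by
        intro h
        have : A.1 = A.1 ∆ {e} := (congrArg Subtype.val h).trans hB
        have h' := congrArg (e ∈ ·) this
        by_cases hm : e ∈ A.1 <;> simp [Finset.mem_symmDiff, hm] at h'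
      rw [wormMatrix_of_ne x hne]
      induction e using Sym2.ind with
      | _ u v =>
        have huv : G.Adj u v := by simpa using he
        have e1 := wormFlow_lower hx hx1 A huv
        have e2 := wormEntry_le_offDiag hx.le A B huv hB
        rw [div_le_iff₀ hD] at e1
        refine e1.trans ?_
        rw [mul_comm]
        refine mul_le_mul_of_nonneg_left (mul_le_mul_of_nonneg_left e2 ?_) hD.le
        exact mul_nonneg (wormMult_pos G A).le (by positivity)
    · exact hs0
  refine (Finset.sum_le_sum h1).trans ?_
  rw [Finset.sum_comm, Finset.mul_sum]
  refine Finset.sum_le_sum fun B _ => ?_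
  change _ ≤ g B
  by_cases hB : ∃ e ∈ G.edgeFinset, B.1 = A.1 ∆ {e}
  · obtain ⟨e, he, hB⟩ := hB
    rw [Finset.sum_eq_single e]
    · rw [if_pos hB]
    · intro e' _ hne
      refine if_neg fun h => hne ?_
      rw [hB] at h
      exact (Finset.singleton_injective (symmDiff_right_injective _ h)).symm
    · exact fun h => absurd he h
  · rw [Finset.sum_eq_zero fun e he => if_neg fun h => hB ⟨e, he, h⟩]
    exact hg0 B

/-- The same unwinding of `D`, translated by `F`, serves every even `F`. Telescoping along it and
Cauchy-Schwarz cost the path length, at most `m`. For each `e` the map `F ↦ F ∆ R e` is injective,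
so the sum over `F` is at most a sum over all states `A`. -/
theorem path_sum_le {x : ℝ} (hx : 0 < x) (f : WormState G → ℝ) (D : WormState G) :
    ∑ F ∈ Finset.univ.filter (fun F : WormState G => (oddVertices F.1).card = 0),
        x ^ F.1.card * x ^ (F.1 ∆ D.1).card *
          (extendState f (F.1 ∆ D.1) - extendState f F.1) ^ 2 ≤
      G.edgeFinset.card * ∑ A : WormState G, ∑ e ∈ G.edgeFinset,
        x ^ (D.1 ∆ (insert e A.1)).card * edgeEnergy x f A.1 e := by
  obtain ⟨R, hR, hsum⟩ := exists_unwinding G D.1 D.2.1 D.2.2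
  set C0 := Finset.univ.filter (fun F : WormState G => (oddVertices F.1).card = 0) with hC0
  have h1 : ∀ F ∈ C0, x ^ F.1.card * x ^ (F.1 ∆ D.1).card *
      (extendState f (F.1 ∆ D.1) - extendState f F.1) ^ 2 ≤
      G.edgeFinset.card * ∑ e ∈ D.1, x ^ (D.1 ∆ (insert e (F.1 ∆ R e))).card *
        edgeEnergy x f (F.1 ∆ R e) e := by
    intro F hF
    have hF0 : (oddVertices F.1).card = 0 := (Finset.mem_filter.1 hF).2
    have e1 := hsum (fun A => extendState f (F.1 ∆ A))
    simp only [← Finset.bot_eq_empty, symmDiff_bot] at e1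
    rw [e1]
    have e2 := sq_sum_le_card_mul_sum_sq (s := D.1)
      (f := fun e => extendState f (F.1 ∆ R e) - extendState f (F.1 ∆ (R e).erase e))
    have e3 : (D.1.card : ℝ) ≤ G.edgeFinset.card := by
      exact_mod_cast Finset.card_le_card D.2.1
    have e4 : 0 ≤ ∑ e ∈ D.1, (extendState f (F.1 ∆ R e) -
        extendState f (F.1 ∆ (R e).erase e)) ^ 2 := Finset.sum_nonneg fun _ _ => sq_nonneg _
    calc _ ≤ x ^ F.1.card * x ^ (F.1 ∆ D.1).card * (G.edgeFinset.card *
          ∑ e ∈ D.1, (extendState f (F.1 ∆ R e) - extendState f (F.1 ∆ (R e).erase e)) ^ 2) :=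
        mul_le_mul_of_nonneg_left (e2.trans (mul_le_mul_of_nonneg_right e3 e4)) (by positivity)
      _ = _ := by
        rw [mul_left_comm, Finset.mul_sum]
        congr 1
        refine Finset.sum_congr rfl fun e he => ?_
        obtain ⟨h2, h3, _, h5⟩ := hR e he
        have h6 := symmDiff_erase F.1 h2
        rw [edgeEnergy, if_pos, pow_mul_pow_symmDiff x F.1 h3 h2, h6]
        · ring
        · rw [← h6, oddVertices_symmDiff_of_even hF0]; exact h5
  refine (Finset.sum_le_sum h1).trans ?_
  rw [← Finset.mul_sum]
  refine mul_le_mul_of_nonneg_left ?_ (by positivity)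
  rw [Finset.sum_comm, Finset.sum_comm (s := Finset.univ)]
  have h0 : ∀ (A : WormState G) (e : Sym2 V),
      0 ≤ x ^ (D.1 ∆ (insert e A.1)).card * edgeEnergy x f A.1 e := fun A e =>
    mul_nonneg (by positivity) (edgeEnergy_nonneg hx.le f A.1 e)
  refine le_trans ?_ (Finset.sum_le_sum_of_subset_of_nonneg D.2.1
    (fun e _ _ => Finset.sum_nonneg fun A _ => h0 A e))
  refine Finset.sum_le_sum fun e he => ?_
  obtain ⟨h2, h3, h4, _⟩ := hR e he
  have hRe : R e ⊆ G.edgeFinset ∧ ((oddVertices (R e)).card = 0 ∨ (oddVertices (R e)).card = 2) :=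
    ⟨h3.trans D.2.1, h4⟩
  let r : WormState G := ⟨R e, hRe⟩
  -- Only the values on even states matter; the other branch merely makes the function total.
  let φ : WormState G → WormState G := fun F =>
    if hF : (oddVertices F.1).card = 0 then F.comb r hF else F
  have hφ : ∀ F ∈ C0, (φ F).1 = F.1 ∆ R e := fun F hF => by
    simp only [φ, dif_pos (Finset.mem_filter.1 hF).2]; rfl
  have hinj : Set.InjOn φ C0 := fun F hF F' hF' h => by
    have := congrArg Subtype.val h
    rw [hφ F hF, hφ F' hF'] at this
    exact Subtype.ext (symmDiff_left_injective _ this)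
  calc ∑ F ∈ C0, x ^ (D.1 ∆ (insert e (F.1 ∆ R e))).card * edgeEnergy x f (F.1 ∆ R e) e
      = ∑ F ∈ C0, x ^ (D.1 ∆ (insert e (φ F).1)).card * edgeEnergy x f (φ F).1 e :=
        Finset.sum_congr rfl fun F hF => by rw [hφ F hF]
    _ = ∑ A ∈ C0.image φ, x ^ (D.1 ∆ (insert e A.1)).card * edgeEnergy x f A.1 e :=
        (Finset.sum_image (f := fun A : WormState G =>
          x ^ (D.1 ∆ (insert e A.1)).card * edgeEnergy x f A.1 e) hinj).symm
    _ ≤ _ := Finset.sum_le_sum_of_subset_of_nonneg (Finset.subset_univ _) fun A _ _ => h0 A e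

theorem sum_even_pow (x : ℝ) :
    ∑ F ∈ Finset.univ.filter (fun F : WormState G => (oddVertices F.1).card = 0), x ^ F.1.card =
      oddSum G x ∅ := by
  rw [Finset.sum_filter, sum_wormState G (fun A => if (oddVertices A).card = 0 then x ^ A.card else 0),
    ← Finset.sum_filter, oddSum, Finset.filter_filter]
  refine Finset.sum_congr (Finset.filter_congr fun A _ => ?_) fun _ _ => rfl
  rw [Finset.card_eq_zero]; tauto

/-- The Poincaré inequality for the worm process. -/
theorem hasGap_wormMatrix [Nonempty V] {x : ℝ} (hx : 0 < x) (hx1 : x ≤ 1)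
    (hΔ : 0 < G.maxDegree) (hm : 0 < G.edgeFinset.card) :
    HasGap (wormMatrix G x) (wormPi G x)
      (1 / (4 * G.maxDegree * G.edgeFinset.card * (Fintype.card V : ℝ) ^ 2)) := by
  intro f hf
  have hP := lazyReversible_wormMatrix (G := G) hx hx1
  have hZ := wormPartition_pos G hx
  have hZ0 := oddSum_empty_pos G hx.le
  set n : ℝ := ((Fintype.card V : ℕ) : ℝ) with hn
  have hn0 : 0 < n := by rw [hn]; exact_mod_cast Fintype.card_pos
  set Z := wormPartition G x
  set Z0 := oddSum G x ∅
  have hπ : ∀ A : WormState G, wormPi G x A = wormMult A.1 * x ^ A.1.card / Z := fun _ => rfl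
  set C0 := Finset.univ.filter (fun F : WormState G => (oddVertices F.1).card = 0) with hC0
  set Ef := wip (wormPi G x) f f - wip (wormPi G x) f (avg (wormMatrix G x) f) with hEf
  have hE := hP.dirichlet_eq f
  rw [← hEf] at hE
  have hE' : ∑ A : WormState G, ∑ B : WormState G,
      wormMult A.1 * x ^ A.1.card * wormMatrix G x A B * (f A - f B) ^ 2 = 2 * Z * Ef := by
    rw [hE]
    simp only [hπ, Finset.mul_sum]
    refine Finset.sum_congr rfl fun A _ => Finset.sum_congr rfl fun B _ => ?_
    field_simp
  -- For `f` of mean zero, the second moment about any constant dominates the variance. Averaging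
  -- the choices `c = f F` over even `F` removes the need for paths between two states of `𝒞₂`.
  have h1 : ∀ c : ℝ, Z * wip (wormPi G x) f f ≤
      ∑ I : WormState G, wormMult I.1 * x ^ I.1.card * (f I - c) ^ 2 := by
    intro c
    have e1 : ∑ I, wormPi G x I * (f I - c) ^ 2 =
        wip (wormPi G x) f f - 2 * c * ∑ I, wormPi G x I * f I + c ^ 2 * ∑ I, wormPi G x I := by
      simp only [wip, Finset.mul_sum, ← Finset.sum_add_distrib, ← Finset.sum_sub_distrib]
      exact Finset.sum_congr rfl fun a _ => by ring
    rw [hf, hP.sum_pi] at e1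
    have e2 : ∑ I : WormState G, wormMult I.1 * x ^ I.1.card * (f I - c) ^ 2 =
        Z * ∑ I, wormPi G x I * (f I - c) ^ 2 := by
      simp only [hπ, Finset.mul_sum]
      refine Finset.sum_congr rfl fun A _ => ?_
      field_simp
    rw [e2, e1]
    refine mul_le_mul_of_nonneg_left ?_ hZ.le
    nlinarith [sq_nonneg c]
  have h2 : Z0 * (Z * wip (wormPi G x) f f) ≤
      ∑ F ∈ C0, x ^ F.1.card *
        ∑ I : WormState G, wormMult I.1 * x ^ I.1.card * (f I - f F) ^ 2 := by
    have e1 : ∑ F ∈ C0, x ^ F.1.card = Z0 := sum_even_pow x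
    rw [← e1, Finset.sum_mul]
    exact Finset.sum_le_sum fun F _ => mul_le_mul_of_nonneg_left (h1 (f F)) (by positivity)
  -- The substitution `I = F ∆ D` is an involution of the state space, and it preserves `∂` and
  -- hence the multiplicity because `F` is even.
  have h3 : ∀ F ∈ C0, x ^ F.1.card *
      ∑ I : WormState G, wormMult I.1 * x ^ I.1.card * (f I - f F) ^ 2 =
      ∑ D : WormState G, wormMult D.1 * (x ^ F.1.card * x ^ (F.1 ∆ D.1).card *
          (extendState f (F.1 ∆ D.1) - extendState f F.1) ^ 2) := by
    intro F hF
    have hF0 : (oddVertices F.1).card = 0 := (Finset.mem_filter.1 hF).2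
    have hinv : ∀ D : WormState G, F.comb (F.comb D hF0) hF0 = D := fun D =>
      Subtype.ext (symmDiff_symmDiff_cancel_left _ _)
    rw [Finset.mul_sum]
    refine Finset.sum_nbij' (fun I => F.comb I hF0) (fun D => F.comb D hF0)
      (fun _ _ => Finset.mem_univ _) (fun _ _ => Finset.mem_univ _) (fun D _ => hinv D)
      (fun D _ => hinv D) fun I _ => ?_
    have e1 : F.1 ∆ (F.comb I hF0).1 = I.1 := symmDiff_symmDiff_cancel_left _ _
    have e2 : wormMult (F.comb I hF0).1 = wormMult I.1 := by
      have : oddVertices (F.comb I hF0).1 = oddVertices I.1 := oddVertices_symmDiff_of_even hF0 _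
      simp only [wormMult, this]
    rw [e1, e2, extendState_coe, extendState_coe]
    ring
  rw [Finset.sum_congr rfl h3, Finset.sum_comm] at h2
  have h4 : ∑ D : WormState G, ∑ F ∈ C0, wormMult D.1 * (x ^ F.1.card * x ^ (F.1 ∆ D.1).card *
        (extendState f (F.1 ∆ D.1) - extendState f F.1) ^ 2) ≤
      G.edgeFinset.card * ∑ A : WormState G, ∑ e ∈ G.edgeFinset,
        (∑ D : WormState G, wormMult D.1 * x ^ (D.1 ∆ (insert e A.1)).card) *
          edgeEnergy x f A.1 e := by
    calc _ ≤ ∑ D : WormState G, wormMult D.1 * (G.edgeFinset.card * ∑ A : WormState G,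
          ∑ e ∈ G.edgeFinset, x ^ (D.1 ∆ (insert e A.1)).card * edgeEnergy x f A.1 e) := by
          refine Finset.sum_le_sum fun D _ => ?_
          rw [← Finset.mul_sum]
          exact mul_le_mul_of_nonneg_left (path_sum_le hx f D) (wormMult_pos G D).le
      _ = _ := by
          simp only [Finset.sum_mul, Finset.mul_sum]
          rw [Finset.sum_comm]
          refine Finset.sum_congr rfl fun A _ => ?_
          rw [Finset.sum_comm]
          refine Finset.sum_congr rfl fun e _ => Finset.sum_congr rfl fun D _ => ?_
          ring
  have h5 : ∑ A : WormState G, ∑ e ∈ G.edgeFinset,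
        (∑ D : WormState G, wormMult D.1 * x ^ (D.1 ∆ (insert e A.1)).card) *
          edgeEnergy x f A.1 e ≤ n ^ 2 * Z0 * (2 * G.maxDegree * (2 * Z * Ef)) := by
    rw [← hE', Finset.mul_sum, Finset.mul_sum]
    refine Finset.sum_le_sum fun A _ => ?_
    refine le_trans ?_ (mul_le_mul_of_nonneg_left (sum_edgeEnergy_le hx hx1 hΔ f A)
      (by positivity))
    rw [Finset.mul_sum]
    refine Finset.sum_le_sum fun e he => mul_le_mul_of_nonneg_right ?_
      (edgeEnergy_nonneg hx.le f A.1 e)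
    exact sum_wormMult_mul_pow_symmDiff_le G hx.le hx1 (Finset.insert_subset he A.2.1)
  have hm' : (0 : ℝ) < G.edgeFinset.card := by exact_mod_cast hm
  have hΔ' : (0 : ℝ) < G.maxDegree := by exact_mod_cast hΔ
  have h6 := h2.trans (h4.trans (mul_le_mul_of_nonneg_left h5 hm'.le))
  rw [div_mul_eq_mul_div, one_mul, div_le_iff₀ (by positivity)]
  have h7 : Z0 * Z * wip (wormPi G x) f f ≤
      Z0 * Z * (Ef * (4 * G.maxDegree * G.edgeFinset.card * n ^ 2)) := by
    calc _ = _ := by ring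
      _ ≤ _ := h6
      _ = _ := by ring
  exact le_of_mul_le_mul_left h7 (by positivity)

end Poincare

/-! ### Laws of the chain and of the visit counter. -/

section ChainLaw

open scoped ENNReal

/-- The law after `n` further steps with the kernel `k`. -/
def bindIter {α : Type*} (k : α → PMF α) (n : ℕ) (ν : PMF α) : PMF α := (fun ν => ν.bind k)^[n] ν

theorem bindIter_zero {α : Type*} (k : α → PMF α) (ν : PMF α) : bindIter k 0 ν = ν := rfl

theorem bindIter_succ {α : Type*} (k : α → PMF α) (n : ℕ) (ν : PMF α) :
    bindIter k (n + 1) ν = bindIter k n (ν.bind k) := rfl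

theorem bindIter_succ' {α : Type*} (k : α → PMF α) (n : ℕ) (ν : PMF α) :
    bindIter k (n + 1) ν = (bindIter k n ν).bind k := Function.iterate_succ_apply' _ _ _

theorem bindIter_eq_bind {α : Type*} (k : α → PMF α) (n : ℕ) (ν : PMF α) :
    bindIter k n ν = ν.bind fun a => bindIter k n (PMF.pure a) := by
  induction n with
  | zero => simp [bindIter_zero]
  | succ n ih => simp only [bindIter_succ']; rw [ih, PMF.bind_bind]

theorem bindIter_succ_pure {α : Type*} (k : α → PMF α) (n : ℕ) (a : α) :
    bindIter k (n + 1) (PMF.pure a) = (k a).bind fun b => bindIter k n (PMF.pure b) := by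
  rw [bindIter_succ, PMF.pure_bind, bindIter_eq_bind]

/-- The expectation of a nonnegative function. -/
def pexp {α : Type*} (p : PMF α) (f : α → ℝ≥0∞) : ℝ≥0∞ := ∑' a, p a * f a

theorem pexp_pure {α : Type*} (a : α) (f : α → ℝ≥0∞) : pexp (PMF.pure a) f = f a := by
  rw [pexp, tsum_eq_single a]
  · simp
  · intro b hb; simp [PMF.pure_apply_of_ne _ _ hb]

theorem pexp_bind {α β : Type*} (p : PMF α) (k : α → PMF β) (f : β → ℝ≥0∞) :
    pexp (p.bind k) f = pexp p fun a => pexp (k a) f := by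
  simp only [pexp, PMF.bind_apply, ← ENNReal.tsum_mul_right, ← ENNReal.tsum_mul_left]
  rw [ENNReal.tsum_comm]
  exact tsum_congr fun a => tsum_congr fun b => by ring

theorem pexp_map {α β : Type*} (p : PMF α) (g : α → β) (f : β → ℝ≥0∞) :
    pexp (p.map g) f = pexp p (f ∘ g) := by
  rw [PMF.map, pexp_bind]
  simp only [Function.comp_def, pexp_pure]

/-- Markov's inequality: `f` dominates the indicator of the complement of `s`. -/
theorem toOuterMeasure_compl_le {α : Type*} (p : PMF α) (s : Set α) (f : α → ℝ≥0∞)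
    (hf : ∀ a ∉ s, 1 ≤ f a) : 1 - pexp p f ≤ p.toOuterMeasure s := by
  rw [tsub_le_iff_right, ← p.tsum_coe, PMF.toOuterMeasure_apply, pexp, ← ENNReal.tsum_add]
  refine ENNReal.tsum_le_tsum fun a => ?_
  by_cases h : a ∈ s
  · simp [h]
  · simp only [Set.indicator_of_notMem h, zero_add]
    exact le_mul_of_one_le_right' (hf a h)

/-- The kernel of a chain together with a counter. -/
def countStep {S : Type*} (k : S → PMF S) (g : S → ℕ) (q : S × ℕ) : PMF (S × ℕ) :=
  (k q.1).map fun b => (b, q.2 + g b)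

/-- The law of the state and of the counter after a burn-in of `τ` steps and `N` counted steps. -/
def countLaw {S : Type*} (k : S → PMF S) (g : S → ℕ) (a₀ : S) (τ N : ℕ) : PMF (S × ℕ) :=
  bindIter (countStep k g) N ((bindIter k τ (PMF.pure a₀)).map fun a => (a, 0))

variable {S : Type*} [Fintype S] [DecidableEq S] {P : Matrix S S ℝ} {π : S → ℝ}

/-- The kernel given by the rows of the matrix `P`. -/
def LazyReversible.step (h : LazyReversible P π) (a : S) : PMF S :=
  PMF.ofFintype (fun b => ENNReal.ofReal (P a b)) (by
    rw [← ENNReal.ofReal_sum_of_nonneg fun b _ => h.nonneg a b, h.row_sum, ENNReal.ofReal_one])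

namespace LazyReversible

variable (h : LazyReversible P π)

theorem step_apply (a b : S) : h.step a b = ENNReal.ofReal (P a b) := rfl

theorem pexp_step (a : S) {u : S → ℝ} (hu : ∀ b, 0 ≤ u b) :
    pexp (h.step a) (fun b => ENNReal.ofReal (u b)) = ENNReal.ofReal (avg P u a) := by
  rw [pexp, tsum_fintype, avg, ENNReal.ofReal_sum_of_nonneg fun b _ =>
    mul_nonneg (h.nonneg a b) (hu b)]
  exact Finset.sum_congr rfl fun b _ => by rw [h.step_apply, ENNReal.ofReal_mul (h.nonneg a b)]

include h in
theorem avg_nonneg {u : S → ℝ} (hu : ∀ b, 0 ≤ u b) (a : S) : 0 ≤ avg P u a :=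
  Finset.sum_nonneg fun b _ => mul_nonneg (h.nonneg a b) (hu b)

theorem pexp_bindIter_step (n : ℕ) (a : S) {u : S → ℝ} (hu : ∀ b, 0 ≤ u b) :
    pexp (bindIter h.step n (PMF.pure a)) (fun b => ENNReal.ofReal (u b)) =
      ENNReal.ofReal ((avg P)^[n] u a) := by
  induction n generalizing u with
  | zero => rw [bindIter_zero, pexp_pure]; rfl
  | succ n ih =>
    rw [bindIter_succ', pexp_bind]
    simp only [h.pexp_step _ hu]
    rw [ih (h.avg_nonneg hu), Function.iterate_succ_apply]

/-- The second moment of `y + ∑_{1 ≤ t ≤ k} f (X_t)`, as a function of the initial state. -/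
def shiftSq (P : Matrix S S ℝ) (f : S → ℝ) (k : ℕ) (a : S) (y : ℝ) : ℝ :=
  y ^ 2 + 2 * y * visitMean P f k a + visitSq P f k a

include h in
theorem shiftSq_succ (f : S → ℝ) (k : ℕ) (a : S) (y : ℝ) :
    shiftSq P f (k + 1) a y = avg P (fun b => shiftSq P f k b (y + f b)) a := by
  have h1 : avg P (fun b => shiftSq P f k b (y + f b)) a =
      y ^ 2 * ∑ b, P a b + 2 * y * avg P (f + visitMean P f k) a +
        avg P ((f * f + (2 : ℝ) • (f * visitMean P f k)) + visitSq P f k) a := by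
    simp only [avg, Finset.mul_sum, ← Finset.sum_add_distrib, shiftSq]
    exact Finset.sum_congr rfl fun b _ => by simp; ring
  rw [h1, h.row_sum, shiftSq, visitMean, visitSq]; ring

-- By induction it is an iterated average of squares. Nonnegativity is needed because expectations
-- are taken through `ENNReal.ofReal`.
include h in
theorem shiftSq_nonneg (f : S → ℝ) (k : ℕ) (a : S) (y : ℝ) : 0 ≤ shiftSq P f k a y := by
  induction k generalizing a y with
  | zero => simp [shiftSq, visitMean, visitSq]; positivity
  | succ k ih => rw [h.shiftSq_succ]; exact h.avg_nonneg (fun b => ih b _) a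

/-- The counter grows by `g`, the centred sum by `g - c₀`. The summand `n * c₀` in the offset is the
centring still outstanding for the remaining `n` steps. -/
theorem pexp_count_sq (g : S → ℕ) (c₀ s : ℝ) (n : ℕ) (q : S × ℕ) :
    pexp (bindIter (countStep h.step g) n (PMF.pure q))
        (fun r => ENNReal.ofReal (((r.2 : ℝ) - s) ^ 2)) =
      ENNReal.ofReal (shiftSq P (fun b => (g b : ℝ) - c₀) n q.1 ((q.2 : ℝ) - s + n * c₀)) := by
  induction n generalizing q with
  | zero => rw [bindIter_zero, pexp_pure]; simp [shiftSq, visitMean, visitSq]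
  | succ n ih =>
    rw [bindIter_succ_pure, pexp_bind, countStep, pexp_map, h.shiftSq_succ,
      ← h.pexp_step q.1 (fun b => h.shiftSq_nonneg _ n b _)]
    congr 1
    ext b
    simp only [Function.comp]
    rw [ih]
    congr 2
    push_cast
    ring

theorem pexp_countLaw_sq (g : S → ℕ) (c₀ : ℝ) (a₀ : S) (τ N : ℕ) :
    pexp (countLaw h.step g a₀ τ N) (fun r => ENNReal.ofReal (((r.2 : ℝ) - N * c₀) ^ 2)) =
      ENNReal.ofReal ((avg P)^[τ] (visitSq P (fun b => (g b : ℝ) - c₀) N) a₀) := by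
  have e : ∀ a, visitSq P (fun b => (g b : ℝ) - c₀) N a =
      shiftSq P (fun b => (g b : ℝ) - c₀) N a 0 := fun a => by simp [shiftSq]
  rw [← h.pexp_bindIter_step τ a₀ (fun b => by rw [e]; exact h.shiftSq_nonneg _ N b 0), countLaw,
    bindIter_eq_bind, pexp_bind, pexp_map]
  congr 1
  ext a
  simp only [Function.comp]
  rw [h.pexp_count_sq g c₀, e]
  congr 2
  simp

end LazyReversible

end ChainLaw

/-! ### Burn-in, Chebyshev's inequality and the choice of the sample size. -/

section Accuracy

variable {V : Type*} [Fintype V] [DecidableEq V] {G : SimpleGraph V} [DecidableRel G.Adj]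

theorem tanh_mem_of_pos {β : ℝ} (hβ : 0 < β) : 0 < Real.tanh β ∧ Real.tanh β ≤ 1 := by
  rw [Real.tanh_eq_sinh_div_cosh]
  refine ⟨div_pos (Real.sinh_pos_iff.2 hβ) (Real.cosh_pos β), ?_⟩
  rw [div_le_one (Real.cosh_pos β)]
  exact (Real.sinh_lt_cosh β).le

theorem HasGap.mono {S : Type*} [Fintype S] {P : Matrix S S ℝ} {π : S → ℝ} {γ γ' : ℝ}
    (h : HasGap P π γ) (hle : γ' ≤ γ) (hπ : ∀ a, 0 ≤ π a) : HasGap P π γ' := fun f hf =>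
  (mul_le_mul_of_nonneg_right hle (Finset.sum_nonneg fun a _ =>
    mul_nonneg (hπ a) (mul_self_nonneg _))).trans (h f hf)

/-- The basic size relations for a connected graph with at least one edge. -/
theorem graph_sizes (hG : G.Connected) (hm : 1 ≤ G.edgeFinset.card) :
    2 ≤ Fintype.card V ∧ Fintype.card V ≤ G.edgeFinset.card + 1 ∧ 1 ≤ G.maxDegree := by
  have h1 := hG.card_vert_le_card_edgeSet_add_one
  rw [Nat.card_eq_fintype_card, Nat.card_eq_fintype_card, ← SimpleGraph.edgeFinset_card] at h1
  obtain ⟨e, he⟩ := Finset.card_pos.1 hm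
  induction e using Sym2.ind with
  | _ u v =>
    have huv : G.Adj u v := by simpa using he
    refine ⟨?_, h1, ?_⟩
    · have := Finset.card_le_univ ({u, v} : Finset V)
      rwa [Finset.card_pair huv.ne] at this
    · exact ((G.degree_pos_iff_exists_adj u).2 ⟨v, huv⟩).trans_le (G.degree_le_maxDegree u)

/-- The indicator of the states without odd vertices. -/
def evenInd (A : WormState G) : ℕ := if (oddVertices A.1).card = 0 then 1 else 0

theorem wormPartition_le {x : ℝ} (h0 : 0 ≤ x) (h1 : x ≤ 1) :
    wormPartition G x ≤ (Fintype.card V : ℝ) ^ 2 * oddSum G x ∅ := by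
  calc _ ≤ ∑ i : V, ∑ j : V, oddSum G x ∅ :=
        Finset.sum_le_sum fun i _ => Finset.sum_le_sum fun j _ => oddSum_le G h0 h1 _
    _ = _ := by simp; ring

theorem oddSum_le_two_pow {x : ℝ} (h0 : 0 ≤ x) (h1 : x ≤ 1) :
    oddSum G x ∅ ≤ 2 ^ G.edgeFinset.card := by
  calc oddSum G x ∅ ≤ ∑ A ∈ G.edgeFinset.powerset, x ^ A.card :=
        Finset.sum_le_sum_of_subset_of_nonneg (Finset.filter_subset _ _)
          fun A _ _ => by positivity
    _ ≤ ∑ A ∈ G.edgeFinset.powerset, (1 : ℝ) :=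
        Finset.sum_le_sum fun A _ => pow_le_one₀ h0 h1
    _ = _ := by simp

theorem sum_wormPi_even (x : ℝ) :
    ∑ A : WormState G, wormPi G x A * evenInd A =
      Fintype.card V * oddSum G x ∅ / wormPartition G x := by
  rw [← sum_even_pow (G := G), Finset.sum_filter, Finset.mul_sum, Finset.sum_div]
  refine Finset.sum_congr rfl fun A _ => ?_
  unfold wormPi evenInd
  split_ifs with h
  · rw [wormMult_of_card_zero h]; simp
  · simp

theorem wormPi_zero (x : ℝ) :
    wormPi G x (WormState.zero G) = Fintype.card V / wormPartition G x := by
  have h : (WormState.zero G).1 = ∅ := rfl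
  rw [wormPi, h, wormMult_of_card_zero (by rw [oddVertices_empty, Finset.card_empty]),
    Finset.card_empty, pow_zero, mul_one]

/-- With `t = 2^m`, the burn-in gives `(1 - γ)^τ ≤ t⁻⁴`, while `1/p ≤ nt` and `n ≤ t`. The product
is at most `1/n`, a lower bound for the probability being estimated. -/
theorem burn_in_bound {γ p₀ p δ n m : ℝ} {k : ℕ} (hγ1 : γ ≤ 1) (hn : 0 < n)
    (hm : m = k) (hnm : n ≤ 2 ^ k) (hδ : 0 < δ) (hδ1 : δ ≤ 1) (hm1 : 1 ≤ m) (hp : 0 < p)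
    (hp₀ : 1 / n ≤ p₀) (hpn : 1 / p ≤ n * 2 ^ k) {τ : ℕ}
    (hτ : 4 * (Real.log 2 + Real.log (2 * δ⁻¹) / m) * m ≤ γ * τ) :
    (1 - γ) ^ τ / p ≤ p₀ := by
  have h2 : 0 < Real.log 2 := Real.log_pos (by norm_num)
  have hlog : 0 ≤ Real.log (2 * δ⁻¹) := Real.log_nonneg (by
    have := one_le_inv_iff₀.2 ⟨hδ, hδ1⟩; linarith)
  -- The term with `δ` is only used to be nonnegative: the required distance from equilibrium does
  -- not depend on `δ`.
  have e1 : 4 * m * Real.log 2 ≤ γ * τ := by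
    refine le_trans ?_ hτ
    have : 0 ≤ Real.log (2 * δ⁻¹) / m := by positivity
    nlinarith
  have e2 : (1 - γ) ^ τ ≤ Real.exp (-(γ * τ)) := by
    have : 1 - γ ≤ Real.exp (-γ) := by linarith [Real.add_one_le_exp (-γ)]
    calc _ ≤ Real.exp (-γ) ^ τ := pow_le_pow_left₀ (by linarith) this τ
      _ = _ := by rw [← Real.exp_nat_mul]; ring_nf
  have e3 : Real.exp (-(γ * τ)) ≤ ((2 : ℝ) ^ k)⁻¹ ^ 4 := by
    have : ((2 : ℝ) ^ k)⁻¹ ^ 4 = Real.exp (-(4 * m * Real.log 2)) := by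
      rw [Real.exp_neg, inv_pow, ← pow_mul, hm]
      congr 1
      rw [← Real.exp_log (show (0 : ℝ) < 2 by norm_num), ← Real.exp_nat_mul, Real.exp_log (by norm_num)]
      push_cast; ring_nf
    rw [this]
    exact Real.exp_le_exp.2 (by linarith)
  set t : ℝ := 2 ^ k with ht
  have ht1 : 1 ≤ t := one_le_pow₀ (by norm_num)
  have ht0 : 0 < t := by linarith
  refine le_trans ?_ hp₀
  calc (1 - γ) ^ τ / p = (1 - γ) ^ τ * (1 / p) := by ring
    _ ≤ t⁻¹ ^ 4 * (n * t) := mul_le_mul (e2.trans e3) hpn (by positivity) (by positivity)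
    _ ≤ 1 / n := by
      rw [le_div_iff₀ hn]
      have : n ^ 2 ≤ t ^ 2 := pow_le_pow_left₀ hn.le hnm 2
      calc t⁻¹ ^ 4 * (n * t) * n = n ^ 2 * t⁻¹ ^ 3 := by field_simp
        _ ≤ t ^ 2 * t⁻¹ ^ 3 := mul_le_mul_of_nonneg_right this (by positivity)
        _ = t⁻¹ := by field_simp
        _ ≤ 1 := inv_le_one_of_one_le₀ ht1

/-- The tolerance `pε/(1+ε)` is exactly what `1/s ≤ (1+ε)/p` requires. The other side holds since
`(1+2ε)(1-ε) ≤ 1+ε`. -/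
theorem estimates_inv {ε p s : ℝ} (hε : 0 < ε) (hε1 : ε ≤ 1) (hp : 0 < p)
    (h : |s - p| < p * ε / (1 + ε)) : 0 < s ∧ EstimatesWithRelError ε (1 / s) (1 / p) := by
  rw [abs_lt] at h
  have h1 : 0 < 1 + ε := by linarith
  have hlow : p < s * (1 + ε) := by
    have : p * ε / (1 + ε) * (1 + ε) = p * ε := by field_simp
    nlinarith [h.1]
  have hup : s * (1 + ε) < p * (1 + 2 * ε) := by
    have : p * ε / (1 + ε) * (1 + ε) = p * ε := by field_simp
    nlinarith [h.2]
  have hs : 0 < s := by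
    by_contra hs
    nlinarith
  refine ⟨hs, ?_⟩
  have hup' : s * (1 - ε) ≤ p := by
    have e1 : s * (1 + ε) * (1 - ε) ≤ p * (1 + 2 * ε) * (1 - ε) :=
      mul_le_mul_of_nonneg_right hup.le (by linarith)
    nlinarith
  rw [EstimatesWithRelError, abs_le]
  have e1 : 1 / s - 1 / p = (p - s) / (s * p) := by field_simp
  have e2 : ε * (1 / p) = ε * s / (s * p) := by field_simp
  rw [e1, e2, ← neg_div]
  constructor
  · exact div_le_div_of_nonneg_right (by nlinarith) (by positivity)
  · exact div_le_div_of_nonneg_right (by nlinarith) (by positivity)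

-- Chebyshev's inequality for the counter about `N p₀`, where `p₀ = 1/χ` is the stationary
-- probability of the even states. A second moment of order `p₀`, rather than of order one, together
-- with `p₀ ≥ 1/n`, leads to the power `n⁵` in the sample size.
set_option maxHeartbeats 800000 in
theorem countLaw_accuracy {β ε δ : ℝ} (hI : ValidInstance G β ε δ)
    (hP : LazyReversible (wormMatrix G (Real.tanh β)) (wormPi G (Real.tanh β))) :
    ENNReal.ofReal (1 - δ) ≤ (countLaw hP.step evenInd (WormState.zero G) (burnIn G δ)
      (sampleSize G ε δ)).toOuterMeasure {q | 0 < 1 / (sampleSize G ε δ : ℝ) * (q.2 : ℝ) ∧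
        EstimatesWithRelError ε (1 / (1 / (sampleSize G ε δ : ℝ) * (q.2 : ℝ)))
          (susceptibility G β)} := by
  obtain ⟨hG, hm, hβ, hε, hε1, hδ, hδ1⟩ := hI
  obtain ⟨hn2, hnm, hΔ⟩ := graph_sizes hG hm
  have : Nonempty V := Fintype.card_pos_iff.1 (by omega)
  obtain ⟨hx, hx1⟩ := tanh_mem_of_pos hβ
  have hgap := hasGap_wormMatrix hx hx1 hΔ hm
  set x := Real.tanh β with hxdef
  have hZ := wormPartition_pos G hx
  have hZ0 := oddSum_empty_pos G hx.le
  have hτ := Nat.le_ceil (4 * (Real.log 2 + Real.log (2 * δ⁻¹) / (G.edgeFinset.card : ℝ)) *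
    (G.maxDegree : ℝ) * (G.edgeFinset.card : ℝ) ^ 2 * (Fintype.card V : ℝ) ^ 4)
  have hN := Nat.le_ceil (16 * (ε ^ 2)⁻¹ * (1 + ε) ^ 2 * δ⁻¹ * (G.maxDegree : ℝ) *
    (G.edgeFinset.card : ℝ) * (Fintype.card V : ℝ) ^ 5)
  change _ ≤ ((burnIn G δ : ℕ) : ℝ) at hτ
  change _ ≤ ((sampleSize G ε δ : ℕ) : ℝ) at hN
  rw [susceptibility_eq G hx.le]
  set τ := burnIn G δ
  set N := sampleSize G ε δ
  set n : ℝ := ((Fintype.card V : ℕ) : ℝ) with hn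
  set m : ℝ := ((G.edgeFinset.card : ℕ) : ℝ) with hmdef
  set Δ : ℝ := ((G.maxDegree : ℕ) : ℝ) with hΔdef
  have hn2' : (2 : ℝ) ≤ n := by rw [hn]; exact_mod_cast hn2
  have hn0 : 0 < n := by linarith
  have hm1 : (1 : ℝ) ≤ m := by rw [hmdef]; exact_mod_cast hm
  have hΔ1 : (1 : ℝ) ≤ Δ := by rw [hΔdef]; exact_mod_cast hΔ
  set K : ℝ := Δ * m * n ^ 4 with hK
  have hn4 : 4 * n ^ 2 ≤ n ^ 4 := by nlinarith [sq_nonneg n, mul_self_nonneg (n - 2)]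
  have hK1 : 1 ≤ K := by
    have h1 : (1 : ℝ) ≤ n ^ 4 := one_le_pow₀ (by linarith)
    have h2 : (1 : ℝ) ≤ Δ * m := by nlinarith
    rw [hK]; nlinarith
  have hK0 : 0 < K := by linarith
  -- The gap already proved is stronger. Since `n ≥ 2` it may be weakened to the value that matches
  -- the given `τ` and `N`.
  have hgap' : HasGap (wormMatrix G x) (wormPi G x) (1 / K) := by
    refine hgap.mono (one_div_le_one_div_of_le (by positivity) ?_) fun a => (hP.pos a).le
    calc _ = Δ * m * (4 * n ^ 2) := by ring
      _ ≤ _ := mul_le_mul_of_nonneg_left hn4 (by positivity)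
  set p₀ : ℝ := n * oddSum G x ∅ / wormPartition G x with hp₀
  have hp₀0 : 0 < p₀ := by positivity
  have hp₀n : 1 / n ≤ p₀ := by
    rw [hp₀, div_le_div_iff₀ hn0 hZ]
    have := wormPartition_le (G := G) hx.le hx1
    linarith
  have hχ : wormPartition G x / (n * oddSum G x ∅) = 1 / p₀ := by rw [hp₀, one_div_div]
  rw [hχ]
  set f : WormState G → ℝ := fun A => (evenInd A : ℝ) - p₀ with hf
  have hsum : ∑ A : WormState G, wormPi G x A * evenInd A = p₀ := sum_wormPi_even x
  have hf0 : ∑ A, wormPi G x A * f A = 0 := by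
    simp only [hf, mul_sub, Finset.sum_sub_distrib, ← Finset.sum_mul, hP.sum_pi, hsum]; ring
  have hsq : ∀ A : WormState G, (evenInd A : ℝ) * evenInd A = evenInd A := fun A => by
    unfold evenInd; split_ifs <;> simp
  have hff : wip (wormPi G x) f f = p₀ - p₀ ^ 2 := by
    have : wip (wormPi G x) f f = ∑ A, wormPi G x A * evenInd A -
        2 * p₀ * ∑ A, wormPi G x A * evenInd A + p₀ ^ 2 * ∑ A, wormPi G x A := by
      simp only [wip, Finset.mul_sum, ← Finset.sum_add_distrib, ← Finset.sum_sub_distrib]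
      exact Finset.sum_congr rfl fun A _ => by
        simp only [hf]; linear_combination wormPi G x A * hsq A
    rw [this, hsum, hP.sum_pi]; ring
  have hp₀1 : p₀ ≤ 1 := by
    have := hP.wip_self_nonneg f
    rw [hff, sq] at this
    exact le_of_mul_le_mul_left (by linarith) hp₀0
  have hf1 : ∀ A, |f A| ≤ 1 := fun A => by
    simp only [hf]; unfold evenInd
    rw [abs_le]
    split_ifs <;> push_cast <;> constructor <;> linarith
  have hzero : wormPi G x (WormState.zero G) = n / wormPartition G x := wormPi_zero x
  -- Distance `√p₀` suffices: multiplied by `‖f‖ ≤ √p₀`, it makes the initial bias at most `p₀`, the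
  -- order of the variance.
  have hburn : (1 - 1 / K) ^ τ / wormPi G x (WormState.zero G) ≤ Real.sqrt p₀ ^ 2 := by
    rw [Real.sq_sqrt hp₀0.le]
    refine burn_in_bound (k := G.edgeFinset.card) (m := m) (n := n) (δ := δ) ?_
      hn0 rfl ?_ hδ hδ1 hm1 (hP.pos _) hp₀n ?_ ?_
    · rw [div_le_one hK0]; exact hK1
    · rw [hn]
      have : Fintype.card V ≤ 2 ^ G.edgeFinset.card :=
        hnm.trans (Nat.lt_two_pow_self (n := G.edgeFinset.card))
      exact_mod_cast this
    · rw [hzero, one_div_div, div_le_iff₀ hn0]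
      have e1 := wormPartition_le (G := G) hx.le hx1
      have e2 := oddSum_le_two_pow (G := G) hx.le hx1
      calc _ ≤ n ^ 2 * oddSum G x ∅ := e1
        _ ≤ n ^ 2 * 2 ^ G.edgeFinset.card := mul_le_mul_of_nonneg_left e2 (by positivity)
        _ = _ := by ring
    · rw [div_mul_eq_mul_div, one_mul, le_div_iff₀ hK0]
      refine le_trans (le_of_eq ?_) hτ
      rw [hK]; ring
  have hmom := hP.visitSq_le hgap' (by positivity) (by rw [div_le_one hK0]; exact hK1) hf0 hf1
    (WormState.zero G) (Real.sqrt_nonneg p₀) hburn N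
  have hmom' : (avg (wormMatrix G x))^[τ] (visitSq (wormMatrix G x) f N) (WormState.zero G) ≤
      8 * K * N * p₀ := by
    refine hmom.trans ?_
    have e1 : wnorm (wormPi G x) f ≤ Real.sqrt p₀ := by
      refine Real.sqrt_le_sqrt ?_; rw [hff]; linarith [sq_nonneg p₀]
    have e2 : Real.sqrt p₀ * wnorm (wormPi G x) f ≤ p₀ := by
      calc _ ≤ Real.sqrt p₀ * Real.sqrt p₀ :=
            mul_le_mul_of_nonneg_left e1 (Real.sqrt_nonneg _)
        _ = p₀ := Real.mul_self_sqrt hp₀0.le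
    have e3 : wip (wormPi G x) f f + Real.sqrt p₀ * wnorm (wormPi G x) f ≤ 2 * p₀ := by
      rw [hff]; linarith [sq_nonneg p₀]
    calc _ ≤ (N : ℝ) * (4 / (1 / K) * (2 * p₀)) := by gcongr
      _ = _ := by field_simp; ring
  have hNpos : 0 < (N : ℝ) := lt_of_lt_of_le (by positivity) hN
  set t : ℝ := N * (p₀ * ε / (1 + ε)) with ht
  have ht0 : 0 < t := by positivity
  have hcheb := toOuterMeasure_compl_le
    (countLaw hP.step evenInd (WormState.zero G) τ N)
    {q : WormState G × ℕ | 0 < 1 / (N : ℝ) * (q.2 : ℝ) ∧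
        EstimatesWithRelError ε (1 / (1 / (N : ℝ) * (q.2 : ℝ))) (1 / p₀)}
    (fun r => ENNReal.ofReal (1 / t ^ 2) * ENNReal.ofReal (((r.2 : ℝ) - N * p₀) ^ 2)) (by
      intro q hq
      rw [← ENNReal.ofReal_mul (by positivity), ← ENNReal.ofReal_one]
      refine ENNReal.ofReal_le_ofReal ?_
      rw [div_mul_eq_mul_div, one_mul, one_le_div (by positivity)]
      by_contra hlt
      refine hq (estimates_inv hε hε1 hp₀0 ?_)
      have h1 : |(q.2 : ℝ) - N * p₀| < t := by
        rw [← abs_of_pos ht0]; exact sq_lt_sq.1 (not_le.1 hlt)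
      have h2 : 1 / (N : ℝ) * (q.2 : ℝ) - p₀ = ((q.2 : ℝ) - N * p₀) / N := by field_simp
      rw [h2, abs_div, abs_of_pos hNpos, div_lt_iff₀ hNpos]
      calc _ < t := h1
        _ = _ := by rw [ht]; ring)
  refine le_trans ?_ hcheb
  have hmul : ∀ (p : PMF (WormState G × ℕ)) (c : ENNReal) (u : WormState G × ℕ → ENNReal),
      pexp p (fun r => c * u r) = c * pexp p u := fun p c u => by
    simp only [pexp, ← ENNReal.tsum_mul_left]
    exact tsum_congr fun a => by ring
  rw [hmul, hP.pexp_countLaw_sq evenInd p₀, ← ENNReal.ofReal_mul (by positivity),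
    ENNReal.ofReal_sub _ hδ.le, ENNReal.ofReal_one]
  refine tsub_le_tsub_left (ENNReal.ofReal_le_ofReal ?_) _
  calc 1 / t ^ 2 * (avg (wormMatrix G x))^[τ] (visitSq (wormMatrix G x) f N) (WormState.zero G)
      ≤ 1 / t ^ 2 * (8 * K * N * p₀) := mul_le_mul_of_nonneg_left hmom' (by positivity)
    _ = 8 * K * (1 + ε) ^ 2 / (N * p₀ * ε ^ 2) := by rw [ht]; field_simp
    _ ≤ δ := by
      rw [div_le_iff₀ (by positivity)]
      have h1 : 1 ≤ p₀ * n := by rwa [div_le_iff₀ hn0] at hp₀n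
      have h2 : 16 * (1 + ε) ^ 2 * (K * n) ≤ N * (δ * ε ^ 2) := by
        rw [← div_le_iff₀ (by positivity)]
        refine le_trans (le_of_eq ?_) hN
        rw [hK]; field_simp
      calc 8 * K * (1 + ε) ^ 2 ≤ 8 * K * (1 + ε) ^ 2 * (p₀ * n) :=
            le_mul_of_one_le_right (by positivity) h1
        _ ≤ p₀ * (16 * (1 + ε) ^ 2 * (K * n)) := by
            have : 0 ≤ 8 * K * (1 + ε) ^ 2 * (p₀ * n) := by positivity
            linarith
        _ ≤ p₀ * (N * (δ * ε ^ 2)) := mul_le_mul_of_nonneg_left h2 hp₀0.le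
        _ = _ := by ring

/-- The running time in steps of the worm process. -/
theorem sampleSize_add_burnIn_le {β ε δ : ℝ} (hI : ValidInstance G β ε δ) :
    ((sampleSize G ε δ + burnIn G δ : ℕ) : ℝ) ≤ 200 * timeScale G ε δ := by
  obtain ⟨hG, hm, hβ, hε, hε1, hδ, hδ1⟩ := hI
  obtain ⟨hn2, hnm, hΔ⟩ := graph_sizes hG hm
  have hnm' : ((Fintype.card V : ℕ) : ℝ) ≤ (G.edgeFinset.card : ℝ) + 1 := by exact_mod_cast hnm
  rw [sampleSize, burnIn, timeScale]
  set n : ℝ := ((Fintype.card V : ℕ) : ℝ) with hn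
  set m : ℝ := ((G.edgeFinset.card : ℕ) : ℝ) with hmdef
  set Δ : ℝ := ((G.maxDegree : ℕ) : ℝ) with hΔdef
  have hn2' : (2 : ℝ) ≤ n := by rw [hn]; exact_mod_cast hn2
  have hn0 : 0 < n := by linarith
  have hm1 : (1 : ℝ) ≤ m := by rw [hmdef]; exact_mod_cast hm
  have hΔ1 : (1 : ℝ) ≤ Δ := by rw [hΔdef]; exact_mod_cast hΔ
  have hδi : 1 ≤ δ⁻¹ := one_le_inv_iff₀.2 ⟨hδ, hδ1⟩
  have hεi : 1 ≤ (ε ^ 2)⁻¹ := one_le_inv_iff₀.2 ⟨by positivity, pow_le_one₀ hε.le hε1⟩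
  set T : ℝ := δ⁻¹ * (ε ^ 2)⁻¹ * Δ * m ^ 2 * n ^ 4 with hT
  have hT1 : 1 ≤ T := by
    have h1 : (1 : ℝ) ≤ n ^ 4 := one_le_pow₀ (by linarith)
    have h2 : (1 : ℝ) ≤ m ^ 2 := one_le_pow₀ hm1
    calc (1 : ℝ) = 1 * 1 * 1 * 1 * 1 := by norm_num
      _ ≤ _ := by rw [hT]; gcongr
  have hNle : 16 * (ε ^ 2)⁻¹ * (1 + ε) ^ 2 * δ⁻¹ * Δ * m * n ^ 5 ≤ 128 * T := by
    have h1 : (1 + ε) ^ 2 ≤ 4 := by nlinarith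
    -- Connectedness gives `n ≤ m + 1`; this trades one factor `n` for a factor `m`.
    have h2 : n ≤ 2 * m := by linarith
    calc _ = 16 * (1 + ε) ^ 2 * n * (δ⁻¹ * (ε ^ 2)⁻¹ * Δ * m * n ^ 4) := by ring
      _ ≤ 16 * 4 * (2 * m) * (δ⁻¹ * (ε ^ 2)⁻¹ * Δ * m * n ^ 4) := by gcongr
      _ = _ := by rw [hT]; ring
  have h2 : 0 < Real.log 2 := Real.log_pos (by norm_num)
  have h2' : Real.log 2 ≤ 1 := by linarith [Real.log_le_sub_one_of_pos (show (0:ℝ) < 2 by norm_num)]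
  have hlog : 0 ≤ Real.log (2 * δ⁻¹) := Real.log_nonneg (by linarith)
  have hlog' : Real.log (2 * δ⁻¹) ≤ 2 * δ⁻¹ :=
    (Real.log_le_sub_one_of_pos (by positivity)).trans (by linarith)
  have hτle : 4 * (Real.log 2 + Real.log (2 * δ⁻¹) / m) * Δ * m ^ 2 * n ^ 4 ≤ 12 * T := by
    have h3 : Real.log (2 * δ⁻¹) / m ≤ 2 * δ⁻¹ := (div_le_self hlog hm1).trans hlog'
    calc _ ≤ 4 * (3 * δ⁻¹) * Δ * m ^ 2 * n ^ 4 := by gcongr; linarith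
      _ = 12 * (δ⁻¹ * 1 * Δ * m ^ 2 * n ^ 4) := by ring
      _ ≤ _ := by rw [hT]; gcongr
  have e1 := Nat.ceil_lt_add_one (show 0 ≤ 16 * (ε ^ 2)⁻¹ * (1 + ε) ^ 2 * δ⁻¹ * Δ * m * n ^ 5 by
    positivity)
  have e2 := Nat.ceil_lt_add_one (show 0 ≤ 4 * (Real.log 2 + Real.log (2 * δ⁻¹) / m) * Δ * m ^ 2 *
    n ^ 4 by positivity)
  push_cast
  linarith

end Accuracy

/-! ### From the axioms of a Markov chain to the explicit law of its path. -/

section PathLaw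

open MeasureTheory

variable {S : Type*}

/-- The last state and the list of the previous states, latest first. -/
def pathOf {Ω : Type*} (X : ℕ → Ω → S) : ℕ → Ω → S × List S
  | 0, ω => (X 0 ω, [])
  | t + 1, ω => (X (t + 1) ω, (pathOf X t ω).1 :: (pathOf X t ω).2)

/-- The law of the path of the chain with kernel `k`. -/
def pathLaw (k : S → PMF S) (a₀ : S) : ℕ → PMF (S × List S)
  | 0 => PMF.pure (a₀, [])
  | t + 1 => (pathLaw k a₀ t).bind fun q => (k q.1).map fun b => (b, q.1 :: q.2)

/-- Two sample spaces are allowed so that a deterministic trajectory can be treated as a process on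
`Unit`. -/
theorem pathOf_eq_iff {Ω Ω' : Type*} (X : ℕ → Ω → S) (Y : ℕ → Ω' → S) (ω : Ω) (ω' : Ω') (T : ℕ) :
    pathOf X T ω = pathOf Y T ω' ↔ ∀ t ≤ T, X t ω = Y t ω' := by
  induction T with
  | zero => simp [pathOf]
  | succ T ih =>
    simp only [pathOf, Prod.mk.injEq, List.cons.injEq]
    rw [← Prod.ext_iff, ih]
    constructor
    · rintro ⟨h1, h2⟩ t ht
      rcases Nat.le_succ_iff.1 ht with h | h
      · exact h2 t h
      · rw [h]; exact h1
    · exact fun h => ⟨h _ le_rfl, fun t ht => h t (by omega)⟩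

theorem exists_pathOf_eq (T : ℕ) (q : S × List S) (hq : q.2.length = T) :
    ∃ a : ℕ → S, q = pathOf (fun t (_ : Unit) => a t) T () := by
  induction T generalizing q with
  | zero =>
    obtain ⟨b, l⟩ := q
    exact ⟨fun _ => b, Prod.ext rfl (List.length_eq_zero_iff.1 hq)⟩
  | succ T ih =>
    obtain ⟨b, l⟩ := q
    cases l with
    | nil => simp at hq
    | cons c l =>
      obtain ⟨a, ha⟩ := ih (c, l) (by simpa using hq)
      refine ⟨Function.update a (T + 1) b, ?_⟩
      have : pathOf (fun t (_ : Unit) => Function.update a (T + 1) b t) T () =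
          pathOf (fun t (_ : Unit) => a t) T () := by
        rw [pathOf_eq_iff]
        intro t ht
        exact Function.update_of_ne (by omega) _ _
      simp only [pathOf, this, ← ha, Function.update_self]

theorem length_pathOf {Ω : Type*} (X : ℕ → Ω → S) (T : ℕ) (ω : Ω) :
    (pathOf X T ω).2.length = T := by
  induction T with
  | zero => rfl
  | succ T ih => simp [pathOf, ih]

theorem length_of_mem_support_pathLaw (k : S → PMF S) (a₀ : S) (T : ℕ) (q : S × List S)
    (hq : q ∈ (pathLaw k a₀ T).support) : q.2.length = T := by
  induction T generalizing q with
  | zero =>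
    rw [pathLaw, PMF.mem_support_pure_iff] at hq
    simp [hq]
  | succ T ih =>
    rw [pathLaw, PMF.mem_support_bind_iff] at hq
    obtain ⟨r, hr, hq⟩ := hq
    rw [PMF.mem_support_map_iff] at hq
    obtain ⟨b, _, rfl⟩ := hq
    simp [ih r hr]

theorem pathLaw_succ_apply (k : S → PMF S) (a₀ : S) (T : ℕ) (b : S) (q : S × List S) :
    pathLaw k a₀ (T + 1) (b, q.1 :: q.2) = pathLaw k a₀ T q * k q.1 b := by
  classical
  rw [pathLaw, PMF.bind_apply, tsum_eq_single q]
  · rw [PMF.map_apply, tsum_eq_single b]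
    · simp
    · intro c hc; simp [Ne.symm hc]
  · intro r hr
    rw [PMF.map_apply, ENNReal.tsum_eq_zero.2, mul_zero]
    intro c
    refine if_neg fun h => hr ?_
    simp only [Prod.mk.injEq, List.cons.injEq] at h
    exact (Prod.ext h.2.1 h.2.2).symm

theorem map_fst_pathLaw (k : S → PMF S) (a₀ : S) (T : ℕ) :
    (pathLaw k a₀ T).map Prod.fst = bindIter k T (PMF.pure a₀) := by
  induction T with
  | zero => simp [pathLaw, PMF.pure_map, bindIter_zero]
  | succ T ih =>
    rw [pathLaw, PMF.map_bind, bindIter_succ', ← ih, PMF.bind_map]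
    congr 1
    ext1 q
    rw [PMF.map_comp]
    exact PMF.map_id _

/-- Paths list the latest state first, so the first `N` entries are the states visited after the
burn-in. -/
theorem map_count_pathLaw (k : S → PMF S) (g : S → ℕ) (a₀ : S) (τ N : ℕ) :
    (pathLaw k a₀ (τ + N)).map (fun q => (q.1, (((q.1 :: q.2).take N).map g).sum)) =
      countLaw k g a₀ τ N := by
  induction N with
  | zero =>
    rw [countLaw, bindIter_zero, ← map_fst_pathLaw, PMF.map_comp]
    rfl
  | succ N ih =>
    rw [← add_assoc, pathLaw, PMF.map_bind, countLaw, bindIter_succ', ← countLaw, ← ih,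
      PMF.bind_map]
    congr 1
    ext1 q
    rw [PMF.map_comp]
    simp only [Function.comp_def, countStep]
    congr 1
    ext1 b
    simp [add_comm]

theorem sum_take_pathOf {Ω : Type*} (X : ℕ → Ω → S) (g : S → ℕ) (τ N : ℕ) (ω : Ω) :
    ((((pathOf X (τ + N) ω).1 :: (pathOf X (τ + N) ω).2).take N).map g).sum =
      ∑ t ∈ Finset.Icc (τ + 1) (τ + N), g (X t ω) := by
  induction N with
  | zero => simp
  | succ N ih =>
    rw [← add_assoc, pathOf, List.take_succ_cons, List.map_cons, List.sum_cons, ih,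
      Finset.sum_Icc_succ_top (by omega), add_comm]

theorem fst_pathOf {Ω : Type*} (X : ℕ → Ω → S) (T : ℕ) (ω : Ω) : (pathOf X T ω).1 = X T ω := by
  cases T <;> rfl

theorem measure_mem_eq_tsum {Ω α : Type*} [MeasurableSpace Ω] [Countable α] (μ : Measure Ω)
    (Y : Ω → α) (hY : ∀ a, MeasurableSet {ω | Y ω = a}) (p : PMF α)
    (hp : ∀ a, μ {ω | Y ω = a} = p a) (B : Set α) : μ {ω | Y ω ∈ B} = p.toOuterMeasure B := by
  let _ : MeasurableSpace α := ⊤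
  have hYm : Measurable Y := measurable_to_countable' hY
  have hB : MeasurableSet B := trivial
  have h1 : μ {ω | Y ω ∈ B} = μ.map Y B := (Measure.map_apply hYm hB).symm
  rw [h1, ← Measure.tsum_indicator_apply_singleton _ B hB, PMF.toOuterMeasure_apply]
  refine tsum_congr fun a => ?_
  by_cases ha : a ∈ B
  · rw [Set.indicator_of_mem ha, Set.indicator_of_mem ha,
      Measure.map_apply hYm (measurableSet_singleton a), ← hp a]
    rfl
  · rw [Set.indicator_of_notMem ha, Set.indicator_of_notMem ha]

variable [Fintype S] [DecidableEq S] {P : Matrix S S ℝ} {π : S → ℝ}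

theorem LazyReversible.pathLaw_pathOf (h : LazyReversible P π) (a₀ : S) (T : ℕ) (a : ℕ → S) :
    pathLaw h.step a₀ T (pathOf (fun t (_ : Unit) => a t) T ()) =
      ENNReal.ofReal (if a 0 = a₀ then ∏ t ∈ Finset.range T, P (a t) (a (t + 1)) else 0) := by
  induction T with
  | zero =>
    rw [pathLaw, pathOf, PMF.pure_apply]
    by_cases h0 : a 0 = a₀ <;> simp [h0]
  | succ T ih =>
    rw [pathOf, pathLaw_succ_apply, ih, fst_pathOf, h.step_apply, ← ENNReal.ofReal_mul]
    · congr 1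
      split_ifs
      · rw [Finset.prod_range_succ]
      · rw [zero_mul]
    · split_ifs
      · exact Finset.prod_nonneg fun t _ => h.nonneg _ _
      · exact le_rfl

/-- The event depends on the path up to time `τ + N`, which has countably many possible values. On
lists of the right length both laws are the product of transition probabilities; on all others both
vanish. -/
theorem IsMarkovChain.measure_count {Ω : Type*} [MeasurableSpace Ω] {μ : Measure Ω}
    {X : ℕ → Ω → S} {a₀ : S} (hX : IsMarkovChain P a₀ μ X) (h : LazyReversible P π)
    (g : S → ℕ) (τ N : ℕ) (B : Set (S × ℕ)) :
    μ {ω | (X (τ + N) ω, ∑ t ∈ Finset.Icc (τ + 1) (τ + N), g (X t ω)) ∈ B} =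
      (countLaw h.step g a₀ τ N).toOuterMeasure B := by
  have hset : ∀ (T : ℕ) (a : ℕ → S),
      {ω | pathOf X T ω = pathOf (fun t (_ : Unit) => a t) T ()} = {ω | ∀ t ≤ T, X t ω = a t} :=
    fun T a => Set.ext fun ω => pathOf_eq_iff X (fun t (_ : Unit) => a t) ω () T
  have hempty : ∀ (T : ℕ) (q : S × List S), q.2.length ≠ T → {ω | pathOf X T ω = q} = ∅ :=
    fun T q hq => Set.eq_empty_iff_forall_notMem.2 fun ω hω =>
      hq (by rw [← (show pathOf X T ω = q from hω)]; exact length_pathOf X T ω)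
  rw [← map_count_pathLaw, PMF.toOuterMeasure_map_apply,
    ← measure_mem_eq_tsum μ (pathOf X (τ + N))]
  · congr 1
    ext ω
    simp only [Set.mem_ofPred_eq, Set.mem_preimage, ← sum_take_pathOf, fst_pathOf]
  · intro q
    by_cases hq : q.2.length = τ + N
    · obtain ⟨a, rfl⟩ := exists_pathOf_eq _ q hq
      rw [hset]
      have : {ω | ∀ t ≤ τ + N, X t ω = a t} = ⋂ t ∈ Finset.range (τ + N + 1), {ω | X t ω = a t} := by
        ext ω; simp
      rw [this]
      exact Finset.measurableSet_biInter _ fun t _ => hX.measurable t (a t)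
    · rw [hempty _ _ hq]; exact MeasurableSet.empty
  · intro q
    by_cases hq : q.2.length = τ + N
    · obtain ⟨a, rfl⟩ := exists_pathOf_eq _ q hq
      rw [hset, hX.law, h.pathLaw_pathOf]
    · rw [hempty _ _ hq, measure_empty]
      by_contra hne
      exact hq (length_of_mem_support_pathLaw _ _ _ _ ((PMF.mem_support_iff _ _).2 (Ne.symm hne)))

end PathLaw

/-! ### Accuracy of the worm estimator on an arbitrary probability space. -/

section WormLaw

open MeasureTheory

variable {V : Type*} [Fintype V] [DecidableEq V] {G : SimpleGraph V} [DecidableRel G.Adj]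

theorem wormSampleMean_eq {Ω : Type*} (τ N : ℕ) (X : ℕ → Ω → WormState G) (ω : Ω) :
    wormSampleMean G τ N X ω =
      1 / (N : ℝ) * ((∑ t ∈ Finset.Icc (τ + 1) (τ + N), evenInd (X t ω) : ℕ) : ℝ) := by
  rw [wormSampleMean]
  congr 1
  push_cast
  refine Finset.sum_congr rfl fun t _ => ?_
  unfold evenInd
  split_ifs <;> simp

theorem IsWormProcess.accuracy {β ε δ : ℝ} (hI : ValidInstance G β ε δ)
    {Ω : Type*} [MeasurableSpace Ω] {μ : Measure Ω} {X : ℕ → Ω → WormState G}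
    (hX : IsWormProcess G (Real.tanh β) μ X) :
    ENNReal.ofReal (1 - δ) ≤
      μ {ω | 0 < wormSampleMean G (burnIn G δ) (sampleSize G ε δ) X ω ∧
        EstimatesWithRelError ε
          (1 / wormSampleMean G (burnIn G δ) (sampleSize G ε δ) X ω)
          (susceptibility G β)} := by
  have : Nonempty V := hI.1.nonempty
  obtain ⟨hx, hx1⟩ := tanh_mem_of_pos hI.2.2.1
  have hP := lazyReversible_wormMatrix (G := G) hx hx1
  refine (countLaw_accuracy hI hP).trans (le_of_eq ?_)
  rw [← IsMarkovChain.measure_count hX hP]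
  simp only [wormSampleMean_eq, Set.mem_ofPred_eq]

end WormLaw

/-! ### Couplings of discrete laws that respect a relation. -/

section Coupling

/-- There is a coupling of `μ` and `ν` that is concentrated on the relation `R`. -/
def Sim {α β : Type*} (R : α → β → Prop) (μ : PMF α) (ν : PMF β) : Prop :=
  ∃ κ : PMF (α × β), κ.map Prod.fst = μ ∧ κ.map Prod.snd = ν ∧ ∀ q ∈ κ.support, R q.1 q.2

namespace Sim

variable {α β α' β' : Type*} {R : α → β → Prop} {R' : α' → β' → Prop} {μ : PMF α} {ν : PMF β}

theorem pure {a : α} {b : β} (h : R a b) : Sim R (PMF.pure a) (PMF.pure b) :=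
  ⟨PMF.pure (a, b), PMF.pure_map _ _, PMF.pure_map _ _, by
    intro q hq; rw [PMF.mem_support_pure_iff] at hq; subst hq; exact h⟩

theorem map_map {ι : Type*} (p : PMF ι) (f : ι → α) (g : ι → β)
    (h : ∀ i ∈ p.support, R (f i) (g i)) : Sim R (p.map f) (p.map g) :=
  ⟨p.map fun i => (f i, g i), PMF.map_comp _ _ _, PMF.map_comp _ _ _, by
    intro q hq
    obtain ⟨i, hi, rfl⟩ := (PMF.mem_support_map_iff _ _ _).1 hq
    exact h i hi⟩

theorem refl (p : PMF α) : Sim (fun a b => a = b) p p := by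
  have := map_map (R := fun a b : α => a = b) p id id fun _ _ => rfl
  rwa [PMF.map_id] at this

/-- Couplings of the continuations exist for related pairs only, so they are glued along the support
of the first coupling. -/
theorem bind (h : Sim R μ ν) {f : α → PMF α'} {g : β → PMF β'}
    (hfg : ∀ a b, R a b → Sim R' (f a) (g b)) : Sim R' (μ.bind f) (ν.bind g) := by
  classical
  obtain ⟨κ, rfl, rfl, hR⟩ := h
  choose κ' h1 h2 h3 using hfg
  refine ⟨κ.bindOnSupport fun q hq => κ' q.1 q.2 (hR q hq), ?_, ?_, ?_⟩
  · rw [PMF.bind_map]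
    ext c
    rw [PMF.map, PMF.bind_apply, PMF.bind_apply]
    simp only [PMF.bindOnSupport_apply, ← ENNReal.tsum_mul_right]
    rw [ENNReal.tsum_comm]
    refine tsum_congr fun q => ?_
    by_cases hq : κ q = 0
    · simp [hq]
    · have := h1 q.1 q.2 (hR q hq)
      simp only [hq, mul_assoc, ENNReal.tsum_mul_left, Function.comp, dite_false]
      rw [← this, PMF.map, PMF.bind_apply]
      rfl
  · rw [PMF.bind_map]
    ext c
    rw [PMF.map, PMF.bind_apply, PMF.bind_apply]
    simp only [PMF.bindOnSupport_apply, ← ENNReal.tsum_mul_right]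
    rw [ENNReal.tsum_comm]
    refine tsum_congr fun q => ?_
    by_cases hq : κ q = 0
    · simp [hq]
    · have := h2 q.1 q.2 (hR q hq)
      simp only [hq, mul_assoc, ENNReal.tsum_mul_left, Function.comp, dite_false]
      rw [← this, PMF.map, PMF.bind_apply]
      rfl
  · intro r hr
    obtain ⟨q, hq, hr⟩ := (PMF.mem_support_bindOnSupport_iff _ _).1 hr
    exact h3 q.1 q.2 _ r hr

theorem exists_of_mem (h : Sim R μ ν) {a : α} (ha : a ∈ μ.support) : ∃ b, R a b := by
  obtain ⟨κ, rfl, rfl, hR⟩ := h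
  obtain ⟨q, hq, rfl⟩ := (PMF.mem_support_map_iff _ _ _).1 ha
  exact ⟨q.2, hR q hq⟩

theorem and_left (h : Sim R μ ν) {T : α → Prop} (hT : ∀ a ∈ μ.support, T a) :
    Sim (fun a b => R a b ∧ T a) μ ν := by
  obtain ⟨κ, rfl, rfl, hR⟩ := h
  exact ⟨κ, rfl, rfl, fun q hq => ⟨hR q hq, hT _ ((PMF.mem_support_map_iff _ _ _).2 ⟨q, hq, rfl⟩)⟩⟩

theorem map_eq {γ : Type*} (h : Sim R μ ν) (f : α → γ) (g : β → γ) (hR : ∀ a b, R a b → f a = g b) :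
    μ.map f = ν.map g := by
  obtain ⟨κ, rfl, rfl, h3⟩ := h
  rw [PMF.map_comp, PMF.map_comp]
  ext c
  classical
  rw [PMF.map_apply, PMF.map_apply]
  refine tsum_congr fun q => ?_
  by_cases hq : κ q = 0
  · simp [hq]
  · simp only [Function.comp, hR _ _ (h3 q hq)]

theorem bindIter {R : ℕ → α → β → Prop} {μ : PMF α} {ν : PMF β} (h : Sim (R 0) μ ν)
    {f : α → PMF α} {g : β → PMF β} (hfg : ∀ i a b, R i a b → Sim (R (i + 1)) (f a) (g b))
    (n : ℕ) : Sim (R n) (_root_.bindIter f n μ) (_root_.bindIter g n ν) := by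
  induction n with
  | zero => exact h
  | succ n ih => rw [bindIter_succ', bindIter_succ']; exact ih.bind (hfg n)

end Sim

end Coupling

/-! ### Deterministic semantics and running time of loop-free programs. -/

section Machine

/-- The effect of an instruction without random choices. -/
def Instr.det : Instr → Memory → Memory
  | .const r k, s => (s.setNat r k).tick 1
  | .add r a b, s => (s.setNat r (s.nat a + s.nat b)).tick 1
  | .sub r a b, s => (s.setNat r (s.nat a - s.nat b)).tick 1
  | .load r i j, s => (s.setNat r (s.arr (s.nat i) (s.nat j))).tick 1
  | .store i j a, s => (s.setArr (s.nat i) (s.nat j) (s.nat a)).tick 1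
  | .cast p a, s => (s.setReal p (s.nat a : ℝ)).tick 1
  | .ceil r p, s => (s.setNat r ⌈s.real p⌉₊).tick (1 + ⌈s.real p⌉₊)
  | .radd p a b, s => (s.setReal p (s.real a + s.real b)).tick 1
  | .rsub p a b, s => (s.setReal p (s.real a - s.real b)).tick 1
  | .rmul p a b, s => (s.setReal p (s.real a * s.real b)).tick 1
  | .rdiv p a b, s => (s.setReal p (s.real a / s.real b)).tick 1
  | .rexp p a, s => (s.setReal p (Real.exp (s.real a))).tick 1
  | .rlog p a, s => (s.setReal p (Real.log (s.real a))).tick 1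
  | .uniform _ _, s => s
  | .flip _ _, s => s

/-- Instructions without random choices. -/
def Instr.isDet : Instr → Bool
  | .uniform _ _ => false
  | .flip _ _ => false
  | _ => true

/-- The effect of a program without random choices. -/
def Program.det : Program → Memory → Memory
  | .instr i, s => i.det s
  | .seq c d, s => d.det (c.det s)
  | .ifz r c d, s => if s.nat r = 0 then c.det (s.tick 1) else d.det (s.tick 1)
  | .loop r c, s => (fun s' => c.det (s'.tick 1))^[s.nat r] (s.tick 1)

/-- Programs without random choices. -/
def Program.isDet : Program → Bool
  | .instr i => i.isDet
  | .seq c d => c.isDet && d.isDet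
  | .ifz _ c d => c.isDet && d.isDet
  | .loop _ c => c.isDet

theorem Program.exec_eq_pure (c : Program) (hc : c.isDet = true) (s : Memory) :
    c.exec s = PMF.pure (c.det s) := by
  induction c generalizing s with
  | instr i => cases i <;> first | rfl | simp [Program.isDet, Instr.isDet] at hc
  | seq c d ihc ihd =>
    simp only [Program.isDet, Bool.and_eq_true] at hc
    change (c.exec s).bind d.exec = _
    rw [ihc hc.1, PMF.pure_bind, ihd hc.2, Program.det]
  | ifz r c d ihc ihd =>
    simp only [Program.isDet, Bool.and_eq_true] at hc
    simp only [Program.exec, Program.det]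
    split_ifs
    · exact ihc hc.1 _
    · exact ihd hc.2 _
  | loop r c ih =>
    simp only [Program.isDet] at hc
    simp only [Program.exec, Program.det]
    generalize s.nat r = k
    induction k with
    | zero => rfl
    | succ k ihk => rw [Function.iterate_succ_apply', ihk, PMF.pure_bind, ih hc,
        Function.iterate_succ_apply']

theorem Program.exec_seq (c d : Program) (s : Memory) :
    (Program.seq c d).exec s = (c.exec s).bind d.exec := rfl

theorem Program.exec_seq_det (c d : Program) (hc : c.isDet = true) (s : Memory) :
    (Program.seq c d).exec s = d.exec (c.det s) := by
  rw [exec_seq, exec_eq_pure c hc, PMF.pure_bind]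

theorem Program.exec_loop (r : ℕ) (c : Program) (s : Memory) :
    (Program.loop r c).exec s =
      bindIter (fun s' => c.exec (s'.tick 1)) (s.nat r) (PMF.pure (s.tick 1)) := rfl

/-- Programs without loops and without rounding. -/
def Program.straight : Program → Bool
  | .instr (.ceil _ _) => false
  | .instr _ => true
  | .seq c d => c.straight && d.straight
  | .ifz _ c d => c.straight && d.straight
  | .loop _ _ => false

/-- A bound for the running time of programs without loops and without rounding. -/
def Program.cost : Program → ℕ
  | .instr _ => 1
  | .seq c d => c.cost + d.cost
  | .ifz _ c d => 1 + max c.cost d.cost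
  | .loop _ _ => 0

theorem Program.time_le (c : Program) (hc : c.straight = true) (s s' : Memory)
    (hs : s' ∈ (c.exec s).support) : s'.time ≤ s.time + c.cost := by
  induction c generalizing s s' with
  | instr i =>
    cases i with
    | ceil r p => simp [Program.straight] at hc
    | uniform r a =>
      simp only [Program.exec, Instr.exec, PMF.mem_support_map_iff] at hs
      obtain ⟨k, _, rfl⟩ := hs
      exact le_rfl
    | flip r a =>
      simp only [Program.exec, Instr.exec, PMF.mem_support_map_iff] at hs
      obtain ⟨k, _, rfl⟩ := hs
      exact le_rfl
    | _ =>
      simp only [Program.exec, Instr.exec, PMF.mem_support_pure_iff] at hs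
      rw [hs]; exact le_rfl
  | seq c d ihc ihd =>
    simp only [Program.straight, Bool.and_eq_true] at hc
    rw [exec_seq, PMF.mem_support_bind_iff] at hs
    obtain ⟨t, ht, hs⟩ := hs
    have h1 := ihc hc.1 s t ht
    have h2 := ihd hc.2 t s' hs
    simp only [Program.cost]
    omega
  | ifz r c d ihc ihd =>
    simp only [Program.straight, Bool.and_eq_true] at hc
    simp only [Program.exec] at hs
    simp only [Program.cost]
    have ht : (s.tick 1).time = s.time + 1 := rfl
    split_ifs at hs
    · have h1 := ihc hc.1 _ s' hs
      omega
    · have h1 := ihd hc.2 _ s' hs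
      omega
  | loop r c ih => simp [Program.straight] at hc

end Machine

/-! ### Coins and uniform choices. -/

section RandomChoices

open scoped ENNReal

theorem coin_bind_apply {α : Type*} (p : ℝ) (f : ℕ → PMF α) (a : α) :
    (coin p).bind f a =
      (1 - min (ENNReal.ofReal p) 1) * f 0 a + min (ENNReal.ofReal p) 1 * f 1 a := by
  rw [coin, PMF.bind_map, PMF.bind_apply, tsum_bool]
  simp [PMF.ofFintype_apply]

/-- The truncation built into the coin performs the minimum of the Metropolis rule, so the program
need not compare real numbers. -/
theorem coin_min_one (p : ℝ) : coin (min p 1) = coin p := by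
  have : min (ENNReal.ofReal (min p 1)) 1 = min (ENNReal.ofReal p) 1 := by
    rw [ENNReal.ofReal_min, ENNReal.ofReal_one, min_assoc, min_self]
  unfold coin
  simp only [this]

theorem mem_support_coin {p : ℝ} {k : ℕ} (hk : k ∈ (coin p).support) : k = 0 ∨ k = 1 := by
  rw [coin, PMF.mem_support_map_iff] at hk
  obtain ⟨b, _, rfl⟩ := hk
  cases b <;> simp

theorem uniformBelow_of_pos {k : ℕ} (hk : 0 < k) :
    uniformBelow k = PMF.uniformOfFinset (Finset.range k)
      (Finset.nonempty_range_iff.2 hk.ne') := dif_pos hk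

theorem mem_support_uniformBelow {k i : ℕ} (hk : 0 < k) (hi : i ∈ (uniformBelow k).support) :
    i < k := by
  rw [uniformBelow_of_pos hk, PMF.mem_support_uniformOfFinset_iff] at hi
  exact Finset.mem_range.1 hi

theorem map_uniformBelow {α : Type*} {k : ℕ} {s : Finset α} (hs : s.Nonempty) (f : ℕ → α)
    (hf : Set.BijOn f (Finset.range k) s) :
    (uniformBelow k).map f = PMF.uniformOfFinset s hs := by
  classical
  have hcard : s.card = k := by
    have : (Finset.range k).image f = s := by
      rw [← Finset.coe_inj, Finset.coe_image]; exact hf.image_eq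
    rw [← this, Finset.card_image_of_injOn hf.injOn, Finset.card_range]
  have hk : 0 < k := hcard ▸ hs.card_pos
  ext a
  rw [uniformBelow_of_pos hk, PMF.map_apply, PMF.uniformOfFinset_apply]
  split_ifs with ha
  · obtain ⟨i, hi, rfl⟩ := hf.surjOn ha
    rw [tsum_eq_single i]
    · rw [if_pos rfl, PMF.uniformOfFinset_apply, if_pos (Finset.mem_coe.1 hi), Finset.card_range,
        hcard]
    · intro j hj
      rw [PMF.uniformOfFinset_apply]
      split_ifs with h1 h2
      · exact absurd (hf.injOn h2 hi h1.symm) hj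
      · rfl
      · rfl
  · refine ENNReal.tsum_eq_zero.2 fun i => ?_
    rw [PMF.uniformOfFinset_apply]
    split_ifs with h1 h2
    · exact absurd (h1 ▸ hf.mapsTo h2) ha
    · rfl
    · rfl

/-- Total mass one determines the last value. This spares the comparison of holding probabilities,
which collect every rejected move. -/
theorem PMF.ext_of_ne {α : Type*} [Fintype α] [DecidableEq α] {p q : PMF α} (a : α)
    (h : ∀ b, b ≠ a → p b = q b) : p = q := by
  have key : ∀ r : PMF α, r a = 1 - ∑ b ∈ Finset.univ.erase a, r b := fun r => by
    have h1 : r a + ∑ b ∈ Finset.univ.erase a, r b = 1 := by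
      have h0 := r.tsum_coe
      rwa [tsum_fintype, ← Finset.add_sum_erase _ _ (Finset.mem_univ a)] at h0
    have h2 : ∑ b ∈ Finset.univ.erase a, r b ≠ ∞ :=
      ENNReal.sum_ne_top.2 fun b _ => r.apply_ne_top b
    rw [← h1, ENNReal.add_sub_cancel_right h2]
  ext b
  by_cases hb : b = a
  · subst hb
    rw [key p, key q, Finset.sum_congr rfl fun c hc => h c (Finset.ne_of_mem_erase hc)]
  · exact h b hb

end RandomChoices

/-! ### A transition of the worm process as a sequence of random choices. -/

section WormMoves

variable {V : Type*} [Fintype V] [DecidableEq V] {G : SimpleGraph V} [DecidableRel G.Adj]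

/-- The random choice of the vertex at which a move is proposed. -/
def selectLaw [Nonempty V] (a : WormState G) : PMF V :=
  PMF.ofFintype (fun u => ENNReal.ofReal (wormSelect a.1 u)) (by
    rw [← ENNReal.ofReal_sum_of_nonneg fun u _ => wormSelect_nonneg a.1 u, sum_wormSelect,
      ENNReal.ofReal_one])

/-- A uniformly random neighbour. -/
def neighborLaw (hdeg : ∀ u, 0 < G.degree u) (u : V) : PMF V :=
  PMF.uniformOfFinset (G.neighborFinset u) (Finset.card_pos.1 (hdeg u))

/-- The state after flipping `uv`, if this is a state. -/
def flipState (a : WormState G) (u v : V) : WormState G :=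
  if h : a.1 ∆ {s(u, v)} ⊆ G.edgeFinset ∧ ((oddVertices (a.1 ∆ {s(u, v)})).card = 0 ∨
    (oddVertices (a.1 ∆ {s(u, v)})).card = 2) then ⟨a.1 ∆ {s(u, v)}, h⟩ else a

theorem flipState_of_mem {a : WormState G} {u v : V}
    (h : a.1 ∆ {s(u, v)} ⊆ G.edgeFinset ∧ ((oddVertices (a.1 ∆ {s(u, v)})).card = 0 ∨
      (oddVertices (a.1 ∆ {s(u, v)})).card = 2)) : flipState a u v = ⟨a.1 ∆ {s(u, v)}, h⟩ :=
  dif_pos h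

theorem flipState_of_not_mem {a : WormState G} {u v : V}
    (h : ¬ (a.1 ∆ {s(u, v)} ⊆ G.edgeFinset ∧ ((oddVertices (a.1 ∆ {s(u, v)})).card = 0 ∨
      (oddVertices (a.1 ∆ {s(u, v)})).card = 2))) : flipState a u v = a :=
  dif_neg h

/-- The step of the worm process as a sequence of random choices. -/
def moveLaw [Nonempty V] (hdeg : ∀ u, 0 < G.degree u) (x : ℝ) (a : WormState G) :
    PMF (WormState G) :=
  (coin (1 / 2)).bind fun b => if b = 0 then PMF.pure a else
    (selectLaw a).bind fun u => (neighborLaw hdeg u).bind fun v =>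
      (coin (wormAccept G x a.1 u v)).bind fun c =>
        if c = 0 then PMF.pure a else PMF.pure (flipState a u v)

/-- Away from the diagonal only accepted moves count, and the probabilities of the four choices
multiply to `wormMove`. -/
theorem moveLaw_eq_step [Nonempty V] (hdeg : ∀ u, 0 < G.degree u) {x : ℝ} (hx : 0 < x)
    (hx1 : x ≤ 1) (hP : LazyReversible (wormMatrix G x) (wormPi G x)) (a : WormState G) :
    moveLaw hdeg x a = hP.step a := by
  refine PMF.ext_of_ne a fun b hb => ?_
  have hpure : PMF.pure a b = 0 := PMF.pure_apply_of_ne _ _ hb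
  rw [hP.step_apply, wormMatrix_of_ne x hb.symm, wormOffDiag_eq, moveLaw, coin_bind_apply,
    if_pos rfl, if_neg one_ne_zero, hpure, mul_zero, zero_add, PMF.bind_apply, tsum_fintype]
  rw [ENNReal.ofReal_sum_of_nonneg (fun u _ => Finset.sum_nonneg fun v _ => by
    split_ifs <;> first | exact wormMove_nonneg hx.le _ _ _ | exact le_rfl), Finset.mul_sum]
  refine Finset.sum_congr rfl fun u _ => ?_
  rw [PMF.bind_apply, tsum_fintype, ENNReal.ofReal_sum_of_nonneg (fun v _ => by
    split_ifs <;> first | exact wormMove_nonneg hx.le _ _ _ | exact le_rfl), Finset.mul_sum,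
    Finset.mul_sum]
  refine Finset.sum_congr rfl fun v _ => ?_
  rw [coin_bind_apply, if_pos rfl, if_neg one_ne_zero, hpure, mul_zero, zero_add,
    neighborLaw, PMF.uniformOfFinset_apply]
  by_cases hadj : G.Adj u v
  · rw [if_pos ((G.mem_neighborFinset u v).2 hadj), SimpleGraph.card_neighborFinset_eq_degree]
    by_cases hB : b.1 = a.1 ∆ {s(u, v)}
    · have hflip : flipState a u v = b := by
        have h : a.1 ∆ {s(u, v)} ⊆ G.edgeFinset ∧ ((oddVertices (a.1 ∆ {s(u, v)})).card = 0 ∨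
            (oddVertices (a.1 ∆ {s(u, v)})).card = 2) := hB ▸ b.2
        rw [flipState_of_mem h]
        exact Subtype.ext hB.symm
      have h1 : ENNReal.ofReal (1 / 2) ≤ 1 := by
        rw [← ENNReal.ofReal_one]; exact ENNReal.ofReal_le_ofReal (by norm_num)
      have h2 : ENNReal.ofReal (wormAccept G x a.1 u v) ≤ 1 := by
        rw [← ENNReal.ofReal_one]; exact ENNReal.ofReal_le_ofReal (wormAccept_le_one hx1 _ _ _)
      rw [if_pos ⟨hadj, hB⟩, hflip, PMF.pure_apply_self, mul_one, wormMove,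
        ENNReal.ofReal_mul (mul_nonneg (mul_nonneg (wormSelect_nonneg _ _) (by positivity))
          (by norm_num)),
        ENNReal.ofReal_mul (mul_nonneg (wormSelect_nonneg _ _) (by positivity)),
        ENNReal.ofReal_mul (wormSelect_nonneg _ _),
        ENNReal.ofReal_inv_of_pos (by exact_mod_cast hdeg u), ENNReal.ofReal_natCast,
        min_eq_left h1, min_eq_left h2, one_div]
      change _ * (ENNReal.ofReal (wormSelect a.1 u) * _) = _
      ring
    · rw [if_neg fun h => hB h.2, ENNReal.ofReal_zero]
      have : PMF.pure (flipState a u v) b = 0 := by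
        refine PMF.pure_apply_of_ne _ _ fun h => ?_
        by_cases h' : a.1 ∆ {s(u, v)} ⊆ G.edgeFinset ∧
            ((oddVertices (a.1 ∆ {s(u, v)})).card = 0 ∨ (oddVertices (a.1 ∆ {s(u, v)})).card = 2)
        · rw [flipState_of_mem h'] at h
          exact hB (congrArg Subtype.val h)
        · rw [flipState_of_not_mem h'] at h
          exact hb h
      rw [this]; simp
  · rw [if_neg fun h => hadj ((G.mem_neighborFinset u v).1 h), if_neg fun h => hadj h.1]
    simp

/-- At a vertex that can be selected, a flip never creates four odd vertices, so the program needs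
no test for leaving the state space. -/
theorem flipState_val {a : WormState G} {u v : V} (hadj : G.Adj u v)
    (h : (oddVertices a.1).card = 0 ∨ u ∈ oddVertices a.1) :
    (flipState a u v).1 = a.1 ∆ {s(u, v)} := by
  have hc := card_oddVertices_symmDiff_edge a.1 hadj.ne
  have hsub : a.1 ∆ {s(u, v)} ⊆ G.edgeFinset := fun e he => by
    rcases Finset.mem_symmDiff.1 he with h | h
    · exact a.2.1 h.1
    · rw [Finset.mem_singleton.1 h.1]; simpa using hadj
  have hodd : (oddVertices (a.1 ∆ {s(u, v)})).card = 0 ∨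
      (oddVertices (a.1 ∆ {s(u, v)})).card = 2 := by
    rcases h with h | h
    · have h' := Finset.card_eq_zero.1 h
      simp only [h', Finset.notMem_empty, if_false] at hc
      right; simpa using hc
    · have h2 : (oddVertices a.1).card = 2 := a.2.2.resolve_left fun h0 => by
        rw [Finset.card_eq_zero.1 h0] at h; simp at h
      rw [h2] at hc
      by_cases hv : v ∈ oddVertices a.1 <;> simp only [h, hv, if_true, if_false] at hc <;> omega
  rw [flipState_of_mem ⟨hsub, hodd⟩]

end WormMoves

/-! ### The program for one step: choice of the vertex and of its neighbour. -/

section Programs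

/-- A list of instructions as a program. -/
def block : List Instr → Program
  -- Writing to the scratch register `31` stands for doing nothing; it costs one unit of time, also
  -- at the end of every block.
  | [] => .instr (.const 31 0)
  | i :: l => .seq (.instr i) (block l)

/-- The choice of the vertex at which a move is proposed. -/
def selectProgram : Program :=
  .ifz 1 (.instr (.uniform 4 0))
    (.seq (.instr (.flip 8 4))
      (.ifz 8 (block [.add 4 2 14, .add 5 3 14]) (block [.add 4 3 14, .add 5 2 14])))

/-- The choice of the neighbour. -/
def neighborProgram : Program :=
  .seq (block [.load 7 4 14]) (.seq (.instr (.uniform 16 7))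
    (block [.add 16 16 13, .load 6 4 16, .load 17 6 14, .add 18 0 4, .load 9 18 6, .add 30 0 6]))

/-- The computation of the acceptance probability. -/
def acceptProgram : Program :=
  .seq (.ifz 9 (block [.rmul 6 3 14, .rmul 7 3 14]) (block [.rdiv 6 14 3, .rmul 7 14 14]))
    (.ifz 1 (block [.rmul 8 7 14])
      (.seq (block [.sub 19 6 5, .sub 20 5 6, .add 19 19 20])
        (.ifz 19 (block [.rmul 8 7 14]) (block [.cast 9 7, .cast 15 17, .rdiv 9 9 15, .rmul 8 9 6]))))

/-- The update of the memory after a flip. -/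
def updateProgram : Program :=
  .seq (block [.sub 9 13 9, .store 18 6 9, .store 30 4 9])
    (.ifz 1 (block [.const 1 1, .add 2 4 14, .add 3 6 14])
      (.ifz 19 (block [.const 1 0]) (block [.add 2 6 14, .add 3 5 14])))

/-- One step of the worm process. -/
def stepProgram : Program :=
  .seq (.instr (.flip 8 4)) (.ifz 8 (block [])
    (.seq selectProgram (.seq neighborProgram (.seq acceptProgram
      (.seq (.instr (.flip 8 8)) (.ifz 8 (block []) updateProgram))))))

variable {n : ℕ} {G : SimpleGraph (Fin n)} [DecidableRel G.Adj]

/-- The memory represents the state `a`; the counter holds `c`, and the sample size is `N`. -/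
structure Represents (x : ℝ) (N c : ℕ) (a : WormState G) (s : Memory) : Prop where
  card : s.nat 0 = n
  zero : s.nat 14 = 0
  one : s.nat 13 = 1
  count : s.nat 10 = c
  size : s.nat 12 = N
  weight : s.real 3 = x
  half : s.real 4 = 1 / 2
  unit : s.real 14 = 1
  degree : ∀ u : Fin n, s.arr u 0 = G.degree u
  neighbor : ∀ (u : Fin n) (j : ℕ) (hj : j < ((G.neighborFinset u).sort (· ≤ ·)).length),
    s.arr u (j + 1) = ((G.neighborFinset u).sort (· ≤ ·))[j]
  edge : ∀ u v : Fin n, s.arr (n + u) v = if s(u, v) ∈ a.1 then 1 else 0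
  ends : ((oddVertices a.1).card = 0 ∧ s.nat 1 = 0) ∨
    ∃ p q : Fin n, p ≠ q ∧ oddVertices a.1 = {p, q} ∧ s.nat 1 = 1 ∧ s.nat 2 = p ∧ s.nat 3 = q

theorem Represents.congr {x : ℝ} {N c : ℕ} {a : WormState G} {s s' : Memory}
    (h : Represents x N c a s) (h0 : s'.nat 0 = s.nat 0) (h1 : s'.nat 1 = s.nat 1)
    (h2 : s'.nat 2 = s.nat 2) (h3 : s'.nat 3 = s.nat 3) (h10 : s'.nat 10 = s.nat 10)
    (h12 : s'.nat 12 = s.nat 12) (h13 : s'.nat 13 = s.nat 13) (h14 : s'.nat 14 = s.nat 14)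
    (r3 : s'.real 3 = s.real 3) (r4 : s'.real 4 = s.real 4) (r14 : s'.real 14 = s.real 14)
    (harr : s'.arr = s.arr) : Represents x N c a s' where
  card := h0.trans h.card
  zero := h14.trans h.zero
  one := h13.trans h.one
  count := h10.trans h.count
  size := h12.trans h.size
  weight := r3.trans h.weight
  half := r4.trans h.half
  unit := r14.trans h.unit
  degree := by rw [harr]; exact h.degree
  neighbor := by rw [harr]; exact h.neighbor
  edge := by rw [harr]; exact h.edge
  ends := by rw [h1, h2, h3]; exact h.ends

/-- The memory after the choice of the vertex `u`. -/
structure Selected (x : ℝ) (N c : ℕ) (a : WormState G) (u : Fin n) (s : Memory) : Prop where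
  rep : Represents x N c a s
  vertex : s.nat 4 = u
  other : (oddVertices a.1).card = 0 ∨
    ∃ o : Fin n, o ≠ u ∧ oddVertices a.1 = {u, o} ∧ s.nat 5 = o

/-- The memory after the choice of the neighbour `v` of `u`. -/
structure Proposed (x : ℝ) (N c : ℕ) (a : WormState G) (u v : Fin n) (s : Memory) : Prop where
  sel : Selected x N c a u s
  adj : G.Adj u v
  vertex : s.nat 6 = v
  degree_left : s.nat 7 = G.degree u
  degree_right : s.nat 17 = G.degree v
  row_left : s.nat 18 = n + u
  row_right : s.nat 30 = n + v
  edge : s.nat 9 = if s(u, v) ∈ a.1 then 1 else 0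

/-- The memory after the computation of the acceptance probability. -/
structure Judged (x : ℝ) (N c : ℕ) (a : WormState G) (u v : Fin n) (s : Memory) : Prop where
  prop : Proposed x N c a u v s
  coin_eq : coin (s.real 8) = coin (wormAccept G x a.1 u v)
  closes : (oddVertices a.1).card = 0 ∨ (s.nat 19 = 0 ↔ v ∈ oddVertices a.1)

variable {x : ℝ} {N c : ℕ} {a : WormState G} {s : Memory}

theorem Represents.tick (h : Represents x N c a s) (k : ℕ) : Represents x N c a (s.tick k) :=
  h.congr rfl rfl rfl rfl rfl rfl rfl rfl rfl rfl rfl rfl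

theorem Represents.select [Nonempty (Fin n)] (h : Represents x N c a s) :
    Sim (fun s' u => Selected x N c a u s') (selectProgram.exec s) (selectLaw a) := by
  rcases h.ends with ⟨h0, h1⟩ | ⟨p, q, hpq, hodd, h1, h2, h3⟩
  · have hn : 0 < n := Fin.pos_iff_nonempty.2 inferInstance
    have e1 : selectProgram.exec s =
        (uniformBelow n).map fun k => ((s.tick 1).setNat 4 k).tick 1 := by
      simp only [selectProgram, Program.exec, h1, if_true, Instr.exec]
      rw [← h.card]; rfl
    have hbij : Set.BijOn (fun k => if hk : k < n then (⟨k, hk⟩ : Fin n) else ⟨0, hn⟩)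
        (Finset.range n) (Finset.univ : Finset (Fin n)) := by
      refine ⟨fun k _ => by simp, fun k hk l hl hkl => ?_, fun k _ => ⟨k, by simp, by simp⟩⟩
      simp only [Finset.coe_range, Set.mem_Iio] at hk hl
      simpa [hk, hl] using hkl
    have e2 : selectLaw a =
        (uniformBelow n).map fun k => if hk : k < n then (⟨k, hk⟩ : Fin n) else ⟨0, hn⟩ := by
      rw [map_uniformBelow Finset.univ_nonempty _ hbij]
      ext u
      rw [PMF.uniformOfFinset_apply, if_pos (Finset.mem_univ u)]
      change ENNReal.ofReal (wormSelect a.1 u) = _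
      rw [wormSelect, if_pos h0, one_div, ENNReal.ofReal_inv_of_pos (by simpa using hn),
        ENNReal.ofReal_natCast, Finset.card_univ]
    rw [e1, e2]
    refine Sim.map_map _ _ _ fun k hk => ?_
    have hk' := mem_support_uniformBelow hn hk
    refine ⟨h.congr rfl rfl rfl rfl rfl rfl rfl rfl rfl rfl rfl rfl, ?_, Or.inl h0⟩
    simp [Memory.setNat, Memory.tick, hk']
  · have e1 : selectProgram.exec s = (coin (1 / 2)).map fun k =>
        (if k = 0 then block [.add 4 2 14, .add 5 3 14] else block [.add 4 3 14, .add 5 2 14]).det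
          ((((s.tick 1).setNat 8 k).tick 1).tick 1) := by
      simp only [selectProgram, Program.exec, h1, one_ne_zero, if_false, Instr.exec]
      rw [PMF.bind_map, ← h.half, ← PMF.bind_pure_comp]
      congr 1
      ext1 k
      simp only [Function.comp]
      change ite (k = 0) _ _ = _
      split_ifs
      · exact Program.exec_eq_pure _ rfl _
      · exact Program.exec_eq_pure _ rfl _
    have e2 : selectLaw a = (coin (1 / 2)).map fun k => if k = 0 then p else q := by
      ext u
      rw [← PMF.bind_pure_comp, coin_bind_apply]
      change ENNReal.ofReal (wormSelect a.1 u) = _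
      have hcard : ¬ (oddVertices a.1).card = 0 := by rw [hodd, Finset.card_pair hpq]; norm_num
      have hhalf : (1 : ENNReal) - ENNReal.ofReal (1 / 2) = ENNReal.ofReal (1 / 2) := by
        rw [← ENNReal.ofReal_one, ← ENNReal.ofReal_sub _ (by norm_num)]; norm_num
      have hle : ENNReal.ofReal (1 / 2) ≤ 1 := by
        rw [← ENNReal.ofReal_one]; exact ENNReal.ofReal_le_ofReal (by norm_num)
      rw [wormSelect, if_neg hcard, min_eq_left hle, hhalf, hodd]
      simp only [Function.comp, if_true, one_ne_zero, if_false, PMF.pure_apply,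
        Finset.mem_insert, Finset.mem_singleton]
      by_cases hp : u = p
      · subst hp; simp [hpq]
      · by_cases hq : u = q
        · subst hq; simp [hp]
        · simp [hp, hq]
    rw [e1, e2]
    refine Sim.map_map _ _ _ fun k hk => ?_
    rcases mem_support_coin hk with rfl | rfl
    · refine ⟨h.congr rfl rfl rfl rfl rfl rfl rfl rfl rfl rfl rfl rfl, ?_, Or.inr
        ⟨q, hpq.symm, hodd, ?_⟩⟩
      · change s.nat 2 + s.nat 14 = p
        rw [h2, h.zero]; rfl
      · change s.nat 3 + s.nat 14 = q
        rw [h3, h.zero]; rfl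
    · refine ⟨h.congr rfl rfl rfl rfl rfl rfl rfl rfl rfl rfl rfl rfl, ?_, Or.inr
        ⟨p, hpq, ?_, ?_⟩⟩
      · change s.nat 3 + s.nat 14 = q
        rw [h3, h.zero]; rfl
      · simp only [one_ne_zero, if_false]
        rw [hodd, Finset.pair_comm]
      · change s.nat 2 + s.nat 14 = p
        rw [h2, h.zero]; rfl

theorem Selected.propose (hdeg : ∀ u, 0 < G.degree u) {u : Fin n} (h : Selected x N c a u s) :
    Sim (fun s' v => Proposed x N c a u v s') (neighborProgram.exec s) (neighborLaw hdeg u) := by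
  set L := (G.neighborFinset u).sort (· ≤ ·) with hL
  have hlen : L.length = G.degree u := by
    rw [hL, Finset.length_sort, SimpleGraph.card_neighborFinset_eq_degree]
  have hnd : L.Nodup := Finset.sort_nodup _ _
  have e1 : neighborProgram.exec s = (uniformBelow (G.degree u)).map fun k =>
      (block [.add 16 16 13, .load 6 4 16, .load 17 6 14, .add 18 0 4, .load 9 18 6,
        .add 30 0 6]).det ((((block [.load 7 4 14]).det s).setNat 16 k).tick 1) := by
    rw [neighborProgram, Program.exec_seq_det _ _ rfl, Program.exec_seq]
    simp only [Program.exec, Instr.exec]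
    have : ((block [.load 7 4 14]).det s).nat 7 = G.degree u := by
      change s.arr (s.nat 4) (s.nat 14) = _
      rw [h.vertex, h.rep.zero, h.rep.degree]
    rw [this, PMF.bind_map, ← PMF.bind_pure_comp]
    congr 1
    ext1 k
    exact Program.exec_eq_pure _ rfl _
  have hbij : Set.BijOn (fun k => if hk : k < L.length then L[k] else u)
      (Finset.range (G.degree u)) (G.neighborFinset u) := by
    rw [← hlen]
    refine ⟨fun k hk => ?_, fun k hk l hl hkl => ?_, fun v hv => ?_⟩
    · simp only [Finset.coe_range, Set.mem_Iio] at hk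
      simp only [hk, dif_pos]
      exact (Finset.mem_sort (· ≤ ·)).1 (List.getElem_mem hk)
    · simp only [Finset.coe_range, Set.mem_Iio] at hk hl
      simp only [hk, hl, dif_pos] at hkl
      exact (hnd.getElem_inj_iff).1 hkl
    · obtain ⟨k, hk, hkv⟩ := List.getElem_of_mem ((Finset.mem_sort (· ≤ ·)).2 hv)
      exact ⟨k, Finset.mem_coe.2 (Finset.mem_range.2 hk), (dif_pos hk).trans hkv⟩
  have e2 : neighborLaw hdeg u =
      (uniformBelow (G.degree u)).map fun k => if hk : k < L.length then L[k] else u :=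
    (map_uniformBelow _ _ hbij).symm
  rw [e1, e2]
  refine Sim.map_map _ _ _ fun k hk => ?_
  have hk' : k < L.length := hlen ▸ mem_support_uniformBelow (hdeg u) hk
  simp only [hk', dif_pos]
  set t := (block [.add 16 16 13, .load 6 4 16, .load 17 6 14, .add 18 0 4, .load 9 18 6,
        .add 30 0 6]).det ((((block [.load 7 4 14]).det s).setNat 16 k).tick 1) with ht
  have hr : Represents x N c a t :=
    h.rep.congr rfl rfl rfl rfl rfl rfl rfl rfl rfl rfl rfl rfl
  have t4 : t.nat 4 = u := h.vertex
  -- Position `0` of a row holds the degree, so the `k`-th neighbour is at position `k + 1`.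
  have t16 : t.nat 16 = k + 1 := by
    change k + s.nat 13 = k + 1
    rw [h.rep.one]
  have t6 : t.nat 6 = L[k] := by
    have : t.nat 6 = t.arr (t.nat 4) (t.nat 16) := rfl
    rw [this, t4, t16]
    exact hr.neighbor u k hk'
  have t18 : t.nat 18 = n + u := by
    have : t.nat 18 = t.nat 0 + t.nat 4 := rfl
    rw [this, t4, hr.card]
  refine ⟨⟨hr, t4, ?_⟩, ?_, t6, ?_, ?_, t18, ?_, ?_⟩
  · exact h.other
  · exact (G.mem_neighborFinset u _).1 ((Finset.mem_sort (· ≤ ·)).1 (List.getElem_mem hk'))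
  · have : t.nat 7 = t.arr (t.nat 4) (t.nat 14) := rfl
    rw [this, t4, hr.zero, hr.degree]
  · have : t.nat 17 = t.arr (t.nat 6) (t.nat 14) := rfl
    rw [this, t6, hr.zero, hr.degree]
  · have : t.nat 30 = t.nat 0 + t.nat 6 := rfl
    rw [this, t6, hr.card]
  · have : t.nat 9 = t.arr (t.nat 18) (t.nat 6) := rfl
    rw [this, t6, t18, hr.edge]

end Programs

/-! ### The program for one step: acceptance and update. -/

section StepProgram

variable {n : ℕ} {G : SimpleGraph (Fin n)} [DecidableRel G.Adj]
variable {x : ℝ} {N c : ℕ} {a : WormState G} {s : Memory} {u v : Fin n}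

theorem Proposed.congr (h : Proposed x N c a u v s) {s' : Memory}
    (hn : ∀ r, r ≠ 8 → r ≠ 19 → r ≠ 20 → r ≠ 31 → s'.nat r = s.nat r)
    (r3 : s'.real 3 = s.real 3) (r4 : s'.real 4 = s.real 4) (r14 : s'.real 14 = s.real 14)
    (harr : s'.arr = s.arr) : Proposed x N c a u v s' := by
  have h' : ∀ r, r ≠ 8 ∧ r ≠ 19 ∧ r ≠ 20 ∧ r ≠ 31 → s'.nat r = s.nat r := fun r hr =>
    hn r hr.1 hr.2.1 hr.2.2.1 hr.2.2.2
  refine ⟨⟨h.sel.rep.congr (h' 0 (by decide)) (h' 1 (by decide)) (h' 2 (by decide))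
    (h' 3 (by decide)) (h' 10 (by decide)) (h' 12 (by decide)) (h' 13 (by decide))
    (h' 14 (by decide)) r3 r4 r14 harr, ?_, ?_⟩, h.adj, ?_, ?_, ?_, ?_, ?_, ?_⟩
  · rw [h' 4 (by decide)]; exact h.sel.vertex
  · rw [h' 5 (by decide)]; exact h.sel.other
  · rw [h' 6 (by decide)]; exact h.vertex
  · rw [h' 7 (by decide)]; exact h.degree_left
  · rw [h' 17 (by decide)]; exact h.degree_right
  · rw [h' 18 (by decide)]; exact h.row_left
  · rw [h' 30 (by decide)]; exact h.row_right
  · rw [h' 9 (by decide)]; exact h.edge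

theorem Proposed.ratios (h : Proposed x N c a u v s) {t : Memory}
    (ht : t = (Program.ifz 9 (block [.rmul 6 3 14, .rmul 7 3 14])
        (block [.rdiv 6 14 3, .rmul 7 14 14])).det s) :
    Proposed x N c a u v t ∧ t.real 6 = (if s(u, v) ∈ a.1 then x⁻¹ else x) ∧
      t.real 7 = (if s(u, v) ∈ a.1 then 1 else x) := by
  have hr := h.sel.rep
  by_cases hm : s(u, v) ∈ a.1
  · have h9 : s.nat 9 ≠ 0 := by rw [h.edge, if_pos hm]; norm_num
    rw [Program.det, if_neg h9] at ht
    subst ht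
    refine ⟨h.congr (fun r _ _ _ h3 => Function.update_of_ne h3 _ _) rfl rfl rfl rfl, ?_, ?_⟩
    · change s.real 14 / s.real 3 = _
      rw [hr.unit, hr.weight, if_pos hm, one_div]
    · change s.real 14 * s.real 14 = _
      rw [hr.unit, if_pos hm, one_mul]
  · have h9 : s.nat 9 = 0 := by rw [h.edge, if_neg hm]
    rw [Program.det, if_pos h9] at ht
    subst ht
    refine ⟨h.congr (fun r _ _ _ h3 => Function.update_of_ne h3 _ _) rfl rfl rfl rfl, ?_, ?_⟩
    · change s.real 3 * s.real 14 = _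
      rw [hr.unit, hr.weight, if_neg hm, mul_one]
    · change s.real 3 * s.real 14 = _
      rw [hr.unit, hr.weight, if_neg hm, mul_one]

theorem Proposed.judge (h : Proposed x N c a u v s) :
    Judged x N c a u v (acceptProgram.det s) := by
  rw [acceptProgram, Program.det]
  obtain ⟨ht, t6, t7⟩ := h.ratios rfl
  set t := (Program.ifz 9 (block [.rmul 6 3 14, .rmul 7 3 14])
        (block [.rdiv 6 14 3, .rmul 7 14 14])).det s
  have hr := ht.sel.rep
  rw [Program.det]
  rcases hr.ends with ⟨h0, h1⟩ | ⟨p, q, hpq, hodd, h1, -, -⟩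
  · rw [if_pos h1]
    refine ⟨ht.congr (fun r _ _ _ h3 => Function.update_of_ne h3 _ _) rfl rfl rfl rfl, ?_,
      Or.inl h0⟩
    change coin (t.real 7 * t.real 14) = _
    rw [t7, hr.unit, mul_one, wormAccept, if_pos h0]
  · have hc : ¬ (oddVertices a.1).card = 0 := by rw [hodd, Finset.card_pair hpq]; norm_num
    obtain ⟨o, hou, hodd', h5⟩ := ht.sel.other.resolve_left hc
    rw [if_neg (by rw [h1]; norm_num), Program.det]
    set t' := (block [.sub 19 6 5, .sub 20 5 6, .add 19 19 20]).det (t.tick 1)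
    have ht' : Proposed x N c a u v t' := ht.congr (fun r _ h1 h2 h3 =>
      (Function.update_of_ne h3 _ _).trans ((Function.update_of_ne h1 _ _).trans
        ((Function.update_of_ne h2 _ _).trans (Function.update_of_ne h1 _ _)))) rfl rfl rfl rfl
    -- The two truncated differences add up to the distance of `v` and `o`, which makes equality
    -- testable against zero. As `v ≠ u`, the vertex `v` is odd exactly if it is the other end `o`.
    have h19 : t'.nat 19 = (v - o) + (o - v : ℕ) := by
      change (t.nat 6 - t.nat 5) + (t.nat 5 - t.nat 6) = _
      rw [ht.vertex, h5]
    have hvo : t'.nat 19 = 0 ↔ v ∈ oddVertices a.1 := by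
      rw [h19, hodd', Finset.mem_insert, Finset.mem_singleton, Fin.ext_iff, Fin.ext_iff]
      have := Fin.val_ne_of_ne h.adj.ne'
      omega
    rw [Program.det]
    by_cases h19' : t'.nat 19 = 0
    · rw [if_pos h19']
      refine ⟨ht'.congr (fun r _ _ _ h3 => Function.update_of_ne h3 _ _) rfl rfl rfl rfl, ?_,
        Or.inr hvo⟩
      change coin (t.real 7 * t.real 14) = _
      rw [t7, hr.unit, mul_one, wormAccept, if_neg hc, if_pos (hvo.1 h19')]
    · rw [if_neg h19']
      refine ⟨ht'.congr (fun r _ _ _ h3 => Function.update_of_ne h3 _ _) rfl rfl rfl rfl, ?_,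
        Or.inr hvo⟩
      change coin ((t.nat 7 : ℝ) / (t.nat 17 : ℝ) * t.real 6) = _
      rw [t6, ht.degree_left, ht.degree_right, wormAccept, if_neg hc,
        if_neg fun h' => h19' (hvo.2 h'), coin_min_one]

theorem Judged.update (h : Judged x N c a u v s) :
    Represents x N c (flipState a u v) (updateProgram.det s) := by
  have hp := h.prop
  have hr := hp.sel.rep
  have hadj := hp.adj
  have huv : (u : ℕ) ≠ v := Fin.val_ne_of_ne hadj.ne
  have hval : (flipState a u v).1 = a.1 ∆ {s(u, v)} := by
    refine flipState_val hadj (hp.sel.other.imp id ?_)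
    rintro ⟨o, -, ho, -⟩
    rw [ho]; exact Finset.mem_insert_self _ _
  set t := (block [.sub 9 13 9, .store 18 6 9, .store 30 4 9]).det s with ht
  -- The state is stored as a symmetric matrix in rows `n, …, 2n - 1`, so a flip takes two stores
  -- and leaves the adjacency lists alone.
  have harr : t.arr = Function.update (Function.update s.arr (n + u)
      (Function.update (s.arr (n + u)) v (1 - s.nat 9))) (n + v)
      (Function.update (s.arr (n + v)) u (1 - s.nat 9)) := by
    have e : t.arr = Function.update (Function.update s.arr (s.nat 18)
      (Function.update (s.arr (s.nat 18)) (s.nat 6) (s.nat 13 - s.nat 9))) (s.nat 30)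
      (Function.update (Function.update s.arr (s.nat 18)
      (Function.update (s.arr (s.nat 18)) (s.nat 6) (s.nat 13 - s.nat 9)) (s.nat 30))
        (s.nat 4) (s.nat 13 - s.nat 9)) := rfl
    rw [e, hp.row_left, hp.row_right, hr.one, hp.vertex, hp.sel.vertex,
      Function.update_of_ne (show n + (v : ℕ) ≠ n + u by omega)]
  have hlow : ∀ w : Fin n, t.arr w = s.arr w := fun w => by
    have := w.2
    rw [harr, Function.update_of_ne (by omega), Function.update_of_ne (by omega)]
  have hedge : ∀ w z : Fin n, t.arr (n + w) z =
      if s(w, z) ∈ (flipState a u v).1 then 1 else 0 := by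
    intro w z
    rw [hval]
    by_cases hs : s(w, z) = s(u, v)
    · have e1 : (s(w, z) ∈ a.1 ∆ {s(u, v)}) ↔ s(u, v) ∉ a.1 := by
        rw [hs]; simp [Finset.mem_symmDiff]
      have e2 : t.arr (n + w) z = 1 - s.nat 9 := by
        rw [harr]
        rcases Sym2.eq_iff.1 hs with ⟨rfl, rfl⟩ | ⟨rfl, rfl⟩
        · rw [Function.update_of_ne (by omega), Function.update_self, Function.update_self]
        · rw [Function.update_self, Function.update_self]
      rw [e2, hp.edge, if_congr e1 rfl rfl]
      by_cases hm : s(u, v) ∈ a.1 <;> simp [hm]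
    · have e1 : (s(w, z) ∈ a.1 ∆ {s(u, v)}) ↔ s(w, z) ∈ a.1 := by
        simp [Finset.mem_symmDiff, hs]
      rw [if_congr e1 rfl rfl, ← hr.edge w z, harr]
      have hs1 : ¬ ((w : ℕ) = u ∧ (z : ℕ) = v) := fun h' =>
        hs (by rw [Fin.ext h'.1, Fin.ext h'.2])
      have hs2 : ¬ ((w : ℕ) = v ∧ (z : ℕ) = u) := fun h' =>
        hs (by rw [Fin.ext h'.1, Fin.ext h'.2, Sym2.eq_swap])
      by_cases hwv : (w : ℕ) = v
      · rw [hwv, Function.update_self, Function.update_of_ne (fun h' => hs2 ⟨hwv, h'⟩)]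
      · rw [Function.update_of_ne (by omega)]
        by_cases hwu : (w : ℕ) = u
        · rw [hwu, Function.update_self, Function.update_of_ne (fun h' => hs1 ⟨hwu, h'⟩)]
        · rw [Function.update_of_ne (by omega)]
  have hodd' : oddVertices (flipState a u v).1 = oddVertices a.1 ∆ {u, v} := by
    rw [hval, oddVertices_symmDiff_edge _ hadj.ne]
  have build : ∀ t' : Memory, t'.nat 0 = s.nat 0 → t'.nat 10 = s.nat 10 → t'.nat 12 = s.nat 12 →
      t'.nat 13 = s.nat 13 → t'.nat 14 = s.nat 14 → t'.real = s.real → t'.arr = t.arr →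
      (((oddVertices (flipState a u v).1).card = 0 ∧ t'.nat 1 = 0) ∨
        ∃ p q : Fin n, p ≠ q ∧ oddVertices (flipState a u v).1 = {p, q} ∧ t'.nat 1 = 1 ∧
          t'.nat 2 = p ∧ t'.nat 3 = q) → Represents x N c (flipState a u v) t' := by
    intro t' h0 h10 h12 h13 h14 hreal harr' hends
    refine ⟨h0.trans hr.card, h14.trans hr.zero, h13.trans hr.one, h10.trans hr.count,
      h12.trans hr.size, ?_, ?_, ?_, ?_, ?_, ?_, hends⟩
    · rw [hreal]; exact hr.weight
    · rw [hreal]; exact hr.half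
    · rw [hreal]; exact hr.unit
    · intro w; rw [harr', hlow]; exact hr.degree w
    · intro w; rw [harr', hlow]; exact hr.neighbor w
    · rw [harr']; exact hedge
  rw [updateProgram, Program.det, ← ht, Program.det]
  have t1 : t.nat 1 = s.nat 1 := rfl
  have t19 : t.nat 19 = s.nat 19 := rfl
  rcases hr.ends with ⟨h0, h1⟩ | ⟨p, q, hpq, hodd, h1, -, -⟩
  · rw [if_pos (t1.trans h1)]
    refine build _ rfl rfl rfl rfl rfl rfl rfl (Or.inr ⟨u, v, hadj.ne, ?_, rfl, ?_, ?_⟩)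
    · rw [hodd', Finset.card_eq_zero.1 h0, ← Finset.bot_eq_empty, bot_symmDiff]
    · change s.nat 4 + s.nat 14 = u
      rw [hr.zero, hp.sel.vertex]; rfl
    · change s.nat 6 + s.nat 14 = v
      rw [hr.zero, hp.vertex]; rfl
  · have hc : ¬ (oddVertices a.1).card = 0 := by rw [hodd, Finset.card_pair hpq]; norm_num
    obtain ⟨o, hou, ho, h5⟩ := hp.sel.other.resolve_left hc
    have hcl := h.closes.resolve_left hc
    rw [if_neg (by rw [t1, h1]; norm_num), Program.det]
    have hvo : v ∈ oddVertices a.1 ↔ v = o := by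
      rw [ho, Finset.mem_insert, Finset.mem_singleton]
      exact ⟨fun h' => h'.resolve_left hadj.ne', Or.inr⟩
    by_cases h19 : s.nat 19 = 0
    · have hv : v = o := hvo.1 (hcl.1 h19)
      rw [if_pos (show (t.tick 1).nat 19 = 0 from h19)]
      refine build _ rfl rfl rfl rfl rfl rfl rfl (Or.inl ⟨?_, rfl⟩)
      rw [hodd', ho, hv, symmDiff_self]; rfl
    -- The worm stays open: its end moves from `u` to `v`, and `o` remains the other end.
    · have hv : v ≠ o := fun h' => h19 (hcl.2 (hvo.2 h'))
      rw [if_neg (show (t.tick 1).nat 19 ≠ 0 from h19)]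
      refine build _ rfl rfl rfl rfl rfl rfl rfl (Or.inr ⟨v, o, hv, ?_, h1, ?_, ?_⟩)
      · rw [hodd', ho]
        ext w
        simp only [Finset.mem_symmDiff, Finset.mem_insert, Finset.mem_singleton]
        have hvu := hadj.ne
        constructor
        · tauto
        · rintro (rfl | rfl)
          · exact Or.inr ⟨Or.inr rfl, fun h' => h'.elim hvu.symm hv⟩
          · exact Or.inl ⟨Or.inr rfl, fun h' => h'.elim hou (Ne.symm hv)⟩
      · change s.nat 6 + s.nat 14 = v
        rw [hr.zero, hp.vertex]; rfl
      · change s.nat 5 + s.nat 14 = o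
        rw [hr.zero, h5]; rfl

theorem Program.exec_flip (r p : ℕ) (s : Memory) :
    (Program.instr (.flip r p)).exec s =
      (coin (s.real p)).map fun k => (s.setNat r k).tick 1 := rfl

theorem Represents.step [Nonempty (Fin n)] (hdeg : ∀ u, 0 < G.degree u)
    (h : Represents x N c a s) :
    Sim (fun s' b => Represents x N c b s') (stepProgram.exec s) (moveLaw hdeg x a) := by
  rw [stepProgram, Program.exec_seq, Program.exec_flip, PMF.bind_map, h.half, moveLaw]
  refine (Sim.refl _).bind ?_
  rintro k _ rfl
  have hk : Represents x N c a ((s.setNat 8 k).tick 1) :=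
    h.congr rfl rfl rfl rfl rfl rfl rfl rfl rfl rfl rfl rfl
  change Sim _ (ite (k = 0) _ _) _
  by_cases hk0 : k = 0
  · rw [if_pos hk0, if_pos hk0, Program.exec_eq_pure _ rfl]
    exact Sim.pure (hk.congr rfl rfl rfl rfl rfl rfl rfl rfl rfl rfl rfl rfl)
  · rw [if_neg hk0, if_neg hk0, Program.exec_seq]
    refine (hk.tick 1).select.bind fun s₁ u h₁ => ?_
    rw [Program.exec_seq]
    refine (h₁.propose hdeg).bind fun s₂ v h₂ => ?_
    rw [Program.exec_seq_det _ _ rfl]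
    have h₃ := h₂.judge
    rw [Program.exec_seq, Program.exec_flip, PMF.bind_map, h₃.coin_eq]
    refine (Sim.refl _).bind ?_
    rintro j _ rfl
    have hj : Judged x N c a u v ((((acceptProgram.det s₂).setNat 8 j).tick 1).tick 1) := by
      exact ⟨h₃.prop.congr (fun r h8 _ _ _ => Function.update_of_ne h8 _ _) rfl rfl rfl rfl,
        h₃.coin_eq, h₃.closes⟩
    change Sim _ (ite (j = 0) _ _) _
    by_cases hj0 : j = 0
    · rw [if_pos hj0, if_pos hj0, Program.exec_eq_pure _ rfl]
      exact Sim.pure (hj.prop.sel.rep.congr rfl rfl rfl rfl rfl rfl rfl rfl rfl rfl rfl rfl)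
    · rw [if_neg hj0, if_neg hj0, Program.exec_eq_pure _ rfl]
      exact Sim.pure hj.update

end StepProgram

/-! ### The whole program: initialization, burn-in and sampling. -/

section MainProgram

/-- The contribution of one vertex to the sum and the maximum of the degrees. -/
def degreeRound : Program :=
  block [.load 23 22 14, .add 20 20 23, .sub 24 23 21, .add 21 21 24, .add 22 22 13]

/-- The real numbers `n`, `m`, `Δ`, `1`, `1/2` and `tanh β`. -/
def constantsProgram : Program :=
  block [.const 15 2, .cast 10 0, .cast 11 20, .cast 12 15, .rdiv 11 11 12, .cast 13 21,
    .cast 14 13, .rdiv 4 14 12, .rexp 20 0, .rsub 21 22 0, .rexp 21 21, .rsub 23 20 21,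
    .radd 24 20 21, .rdiv 3 23 24]

/-- The real number of which the burn-in time is the ceiling. -/
def burnInProgram : Program :=
  block [.rdiv 25 14 2, .rmul 26 12 25, .rlog 26 26, .rdiv 26 26 11, .rlog 27 12, .radd 26 27 26,
    .rmul 28 12 12, .rmul 26 28 26, .rmul 26 26 13, .rmul 29 11 11, .rmul 26 26 29,
    .rmul 29 10 10, .rmul 29 29 29, .rmul 26 26 29]

/-- The real number of which the sample size is the ceiling. -/
def sampleSizeProgram : Program :=
  block [.rmul 30 28 28, .rmul 31 1 1, .rdiv 30 30 31, .radd 32 14 1, .rmul 32 32 32,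
    .rmul 30 30 32, .rmul 30 30 25, .rmul 30 30 13, .rmul 30 30 11, .rmul 30 30 29,
    .rmul 30 30 10]

/-- The deterministic part at the start. -/
def initProgram : Program :=
  .seq (block [.const 13 1]) (.seq (.loop 0 degreeRound) (.seq constantsProgram
    (.seq burnInProgram (.seq (.instr (.ceil 11 26)) (.seq sampleSizeProgram
      (.instr (.ceil 12 30)))))))

/-- A step of the worm process and an update of the counter. -/
def countProgram : Program :=
  .seq stepProgram (.ifz 1 (block [.add 10 10 13]) (block []))

/-- The worm estimator of the susceptibility. -/
def wormProgram : Program :=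
  .seq initProgram (.seq (.loop 11 stepProgram) (.seq (.loop 12 countProgram)
    (block [.cast 40 12, .cast 41 10, .rdiv 0 40 41])))

/-- The running maximum uses `max a b = a + (b - a)` with truncated subtraction. A round takes seven
units: one for the loop, five instructions and the closing instruction of the block. -/
theorem degreeRound_iterate (s : Memory) (h13 : s.nat 13 = 1) (h14 : s.nat 14 = 0)
    (h20 : s.nat 20 = 0) (h21 : s.nat 21 = 0) (h22 : s.nat 22 = 0) (k : ℕ) :
    ∃ t, (fun s' => degreeRound.det (s'.tick 1))^[k] s = t ∧
      t.nat 0 = s.nat 0 ∧ t.nat 1 = s.nat 1 ∧ t.nat 10 = s.nat 10 ∧ t.nat 13 = 1 ∧ t.nat 14 = 0 ∧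
      t.nat 20 = ∑ i ∈ Finset.range k, s.arr i 0 ∧
      t.nat 21 = (Finset.range k).sup (fun i => s.arr i 0) ∧ t.nat 22 = k ∧
      t.real = s.real ∧ t.arr = s.arr ∧ t.time = s.time + 7 * k := by
  induction k with
  | zero => exact ⟨s, rfl, rfl, rfl, rfl, h13, h14, by simpa using h20, by simpa using h21, h22,
      rfl, rfl, rfl⟩
  | succ k ih =>
    obtain ⟨t, ht, t0, t1, t10, t13, t14, t20, t21, t22, tr, ta, tt⟩ := ih
    refine ⟨degreeRound.det (t.tick 1), by rw [Function.iterate_succ_apply', ht], t0, t1, t10, t13,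
      t14, ?_, ?_, ?_, tr, ta, ?_⟩
    · change t.nat 20 + t.arr (t.nat 22) (t.nat 14) = _
      rw [t20, t22, t14, ta, Finset.sum_range_succ]
    · change t.nat 21 + (t.arr (t.nat 22) (t.nat 14) - t.nat 21) = _
      rw [t22, t14, ta, Finset.range_add_one, Finset.sup_insert, ← t21]
      omega
    · change t.nat 22 + t.nat 13 = _
      rw [t22, t13]
    · change t.time + 1 + 1 + 1 + 1 + 1 + 1 + 1 = _
      rw [tt]; ring

theorem burnInProgram_real (s : Memory) : (burnInProgram.det s).real 26 =
    s.real 12 * s.real 12 * (Real.log (s.real 12) +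
      Real.log (s.real 12 * (s.real 14 / s.real 2)) / s.real 11) * s.real 13 *
      (s.real 11 * s.real 11) * ((s.real 10 * s.real 10) * (s.real 10 * s.real 10)) := by
  simp [burnInProgram, block, Program.det, Instr.det, Memory.setReal,
      Memory.setNat, Memory.tick]

theorem burnInProgram_spec (s : Memory) :
    (burnInProgram.det s).real 25 = s.real 14 / s.real 2 ∧
    (burnInProgram.det s).real 28 = s.real 12 * s.real 12 ∧
    (burnInProgram.det s).real 29 = (s.real 10 * s.real 10) * (s.real 10 * s.real 10) ∧
    (∀ p < 20, (burnInProgram.det s).real p = s.real p) ∧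
    (∀ r ≠ 31, (burnInProgram.det s).nat r = s.nat r) ∧ (burnInProgram.det s).arr = s.arr := by
  refine ⟨?_, ?_, ?_, fun p hp => ?_, fun r hr => ?_, ?_⟩
  · simp [burnInProgram, block, Program.det, Instr.det, Memory.setReal,
      Memory.setNat, Memory.tick]
  · simp [burnInProgram, block, Program.det, Instr.det, Memory.setReal,
      Memory.setNat, Memory.tick]
  · simp [burnInProgram, block, Program.det, Instr.det, Memory.setReal,
      Memory.setNat, Memory.tick]
  · interval_cases p <;> simp [burnInProgram, block, Program.det, Instr.det, Memory.setReal,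
      Memory.setNat, Memory.tick]
  · simp [burnInProgram, block, Program.det, Instr.det, Memory.setReal,
      Memory.setNat, Memory.tick, hr]
  · simp [burnInProgram, block, Program.det, Instr.det, Memory.setReal,
      Memory.setNat, Memory.tick]

theorem sampleSizeProgram_real (s : Memory) : (sampleSizeProgram.det s).real 30 =
    s.real 28 * s.real 28 / (s.real 1 * s.real 1) *
      ((s.real 14 + s.real 1) * (s.real 14 + s.real 1)) * s.real 25 * s.real 13 *
      s.real 11 * s.real 29 * s.real 10 := by
  simp [sampleSizeProgram, block, Program.det, Instr.det, Memory.setReal,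
      Memory.setNat, Memory.tick]

theorem sampleSizeProgram_spec (s : Memory) :
    (∀ p < 20, (sampleSizeProgram.det s).real p = s.real p) ∧
    (∀ r ≠ 31, (sampleSizeProgram.det s).nat r = s.nat r) ∧ (sampleSizeProgram.det s).arr = s.arr := by
  refine ⟨fun p hp => ?_, fun r hr => ?_, ?_⟩
  · interval_cases p <;>
    simp [sampleSizeProgram, block, Program.det, Instr.det, Memory.setReal,
      Memory.setNat, Memory.tick]
  · simp [sampleSizeProgram, block, Program.det, Instr.det, Memory.setReal,
      Memory.setNat, Memory.tick, hr]
  · simp [sampleSizeProgram, block, Program.det, Instr.det, Memory.setReal,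
      Memory.setNat, Memory.tick]

theorem initProgram_det (s : Memory) : initProgram.det s =
    (Instr.ceil 12 30).det (sampleSizeProgram.det ((Instr.ceil 11 26).det
      (burnInProgram.det (constantsProgram.det
        ((fun s' => degreeRound.det (s'.tick 1))^[((block [.const 13 1]).det s).nat 0]
          (((block [.const 13 1]).det s).tick 1)))))) := rfl

variable {n : ℕ} {G : SimpleGraph (Fin n)} [DecidableRel G.Adj]

theorem inputMemory_degree (β ε δ : ℝ) (u : Fin n) :
    (inputMemory G β ε δ).arr u 0 = G.degree u := by
  simp [inputMemory]

theorem inputMemory_neighbor (β ε δ : ℝ) (u : Fin n) (j : ℕ)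
    (hj : j < ((G.neighborFinset u).sort (· ≤ ·)).length) :
    (inputMemory G β ε δ).arr u (j + 1) = ((G.neighborFinset u).sort (· ≤ ·))[j] := by
  have hj' : j < G.degree u := by simpa using hj
  simp [inputMemory, List.getD_eq_getElem?_getD, hj']

theorem inputMemory_high (β ε δ : ℝ) (u j : ℕ) : (inputMemory G β ε δ).arr (n + u) j = 0 := by
  simp [inputMemory]

theorem initProgram_spec [Nonempty (Fin n)] (β ε δ : ℝ) :
    Represents (Real.tanh β) (sampleSize G ε δ) 0 (WormState.zero G)
        (initProgram.det (inputMemory G β ε δ)) ∧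
      (initProgram.det (inputMemory G β ε δ)).nat 11 = burnIn G δ ∧
      (initProgram.det (inputMemory G β ε δ)).time ≤
        50 + 7 * n + burnIn G δ + sampleSize G ε δ := by
  set s := inputMemory G β ε δ with hs
  set s₁ := (block [.const 13 1]).det s with hs₁
  obtain ⟨t, ht, t0, t1, t10, t13, t14, t20, t21, t22, tr, ta, tt⟩ :=
    degreeRound_iterate (s₁.tick 1) rfl rfl rfl rfl rfl n
  have t0' : t.nat 0 = n := t0
  have t1' : t.nat 1 = 0 := t1
  have t10' : t.nat 10 = 0 := t10
  have tr' : t.real = s.real := tr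
  have ta' : t.arr = s.arr := ta
  have tt' : t.time = 3 + 7 * n := tt
  -- The handshake lemma; the factor `2` is divided out in real arithmetic.
  have hm : (t.nat 20 : ℝ) = 2 * G.edgeFinset.card := by
    rw [t20]
    have : ∑ i ∈ Finset.range n, (s₁.tick 1).arr i 0 = 2 * G.edgeFinset.card := by
      rw [← SimpleGraph.sum_degrees_eq_twice_card_edges, Finset.sum_range]
      exact Finset.sum_congr rfl fun u _ => inputMemory_degree β ε δ u
    rw [this]; push_cast; rfl
  have hΔ : t.nat 21 = G.maxDegree := by
    rw [t21]
    refine le_antisymm (Finset.sup_le fun i hi => ?_) ?_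
    · have hi' := Finset.mem_range.1 hi
      have := inputMemory_degree (G := G) β ε δ ⟨i, hi'⟩
      change s.arr i 0 ≤ _
      rw [hs, this]
      exact G.degree_le_maxDegree _
    · obtain ⟨v, hv⟩ := G.exists_maximal_degree_vertex
      rw [hv, ← inputMemory_degree (G := G) β ε δ v]
      exact Finset.le_sup (f := fun i => (s₁.tick 1).arr i 0) (Finset.mem_range.2 v.2)
  set s₂ := constantsProgram.det t with hs₂
  have e10 : s₂.real 10 = n := by
    change ((t.nat 0 : ℕ) : ℝ) = n
    rw [t0']
  have e12 : s₂.real 12 = 2 := by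
    change ((2 : ℕ) : ℝ) = 2
    norm_num
  have e11 : s₂.real 11 = G.edgeFinset.card := by
    change ((t.nat 20 : ℕ) : ℝ) / ((2 : ℕ) : ℝ) = _
    rw [hm]; push_cast; field_simp
  have e13 : s₂.real 13 = G.maxDegree := by
    change ((t.nat 21 : ℕ) : ℝ) = _
    rw [hΔ]
  have e14 : s₂.real 14 = 1 := by
    change ((t.nat 13 : ℕ) : ℝ) = _
    rw [t13]; norm_num
  have e4 : s₂.real 4 = 1 / 2 := by
    have : s₂.real 4 = s₂.real 14 / s₂.real 12 := rfl
    rw [this, e14, e12]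
  have e0 : s₂.real 1 = ε := by
    change t.real 1 = _
    rw [tr']; rfl
  have e2 : s₂.real 2 = δ := by
    change t.real 2 = _
    rw [tr']; rfl
  have e3 : s₂.real 3 = Real.tanh β := by
    change (Real.exp (t.real 0) - Real.exp (t.real 22 - t.real 0)) /
      (Real.exp (t.real 0) + Real.exp (t.real 22 - t.real 0)) = _
    have h0 : t.real 0 = β := by rw [tr']; rfl
    have h22 : t.real 22 = 0 := by rw [tr']; rfl
    rw [h0, h22, zero_sub, Real.tanh_eq]
  have e5 : ∀ r, r ≠ 15 → r ≠ 31 → s₂.nat r = t.nat r := fun r hr hr' =>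
    (Function.update_of_ne hr' _ _).trans (Function.update_of_ne hr _ _)
  have e6 : s₂.arr = t.arr := rfl
  have h2 := constantsProgram.time_le rfl t s₂
    (by rw [constantsProgram.exec_eq_pure rfl]; exact (PMF.mem_support_pure_iff _ _).2 rfl)
  have hdet : initProgram.det s = (Instr.ceil 12 30).det (sampleSizeProgram.det
      ((Instr.ceil 11 26).det (burnInProgram.det s₂))) := by
    rw [initProgram_det, hs₂, ← ht]; rfl
  clear_value s₂
  have f26 := burnInProgram_real s₂
  obtain ⟨f25, f28, f29, freal, fnat, farr⟩ := burnInProgram_spec s₂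
  have h3 := burnInProgram.time_le rfl s₂ (burnInProgram.det s₂)
    (by rw [burnInProgram.exec_eq_pure rfl]; exact (PMF.mem_support_pure_iff _ _).2 rfl)
  set s₃ := burnInProgram.det s₂
  clear_value s₃
  have f11 : ⌈s₃.real 26⌉₊ = burnIn G δ := by
    rw [f26, e10, e11, e12, e13, e14, e2, burnIn, Fintype.card_fin, one_div]
    congr 1
    ring
  set s₄ := (Instr.ceil 11 26).det s₃ with hs₄
  have g11 : s₄.nat 11 = burnIn G δ := f11
  have greal : s₄.real = s₃.real := rfl
  have gnat : ∀ r, r ≠ 11 → s₄.nat r = s₃.nat r := fun r hr => Function.update_of_ne hr _ _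
  have garr : s₄.arr = s₃.arr := rfl
  have h4 : s₄.time = s₃.time + (1 + ⌈s₃.real 26⌉₊) := rfl
  clear_value s₄
  have k30 := sampleSizeProgram_real s₄
  obtain ⟨kreal, knat, karr⟩ := sampleSizeProgram_spec s₄
  have h5 := sampleSizeProgram.time_le rfl s₄ (sampleSizeProgram.det s₄)
    (by rw [sampleSizeProgram.exec_eq_pure rfl]; exact (PMF.mem_support_pure_iff _ _).2 rfl)
  set s₅ := sampleSizeProgram.det s₄
  clear_value s₅
  have low : ∀ p < 20, s₅.real p = s₂.real p := fun p hp => by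
    rw [kreal p hp, greal, freal p hp]
  have f12 : ⌈s₅.real 30⌉₊ = sampleSize G ε δ := by
    rw [k30, greal, f25, f28, f29, freal 1 (by norm_num), freal 10 (by norm_num),
      freal 11 (by norm_num), freal 13 (by norm_num), freal 14 (by norm_num), e0, e10, e11, e12,
      e13, e14, e2, sampleSize, Fintype.card_fin, one_div, div_eq_mul_inv, sq ε]
    congr 1
    ring
  rw [hdet]
  set s₆ := (Instr.ceil 12 30).det s₅
  have l12 : s₆.nat 12 = sampleSize G ε δ := f12
  have lreal : s₆.real = s₅.real := rfl
  have lnat : ∀ r, r ≠ 12 → s₆.nat r = s₅.nat r := fun r hr => Function.update_of_ne hr _ _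
  have larr : s₆.arr = s₅.arr := rfl
  have h6 : s₆.time = s₅.time + (1 + ⌈s₅.real 30⌉₊) := rfl
  clear_value s₆
  have harr : s₆.arr = s.arr := by rw [larr, karr, garr, farr, e6, ta']
  have hnat : ∀ r, r ≠ 11 → r ≠ 12 → r ≠ 15 → r ≠ 31 → s₆.nat r = t.nat r := fun r h11 h12 h15 h31 => by
    rw [lnat r h12, knat r h31, gnat r h11, fnat r h31, e5 r h15 h31]
  refine ⟨⟨(hnat 0 (by decide) (by decide) (by decide) (by decide)).trans t0', (hnat 14 (by decide) (by decide) (by decide) (by decide)).trans t14,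
    (hnat 13 (by decide) (by decide) (by decide) (by decide)).trans t13, (hnat 10 (by decide) (by decide) (by decide) (by decide)).trans t10', l12,
    ?_, ?_, ?_, ?_, ?_, ?_, Or.inl ⟨?_, (hnat 1 (by decide) (by decide) (by decide) (by decide)).trans t1'⟩⟩, ?_, ?_⟩
  · rw [lreal, low 3 (by norm_num), e3]
  · rw [lreal, low 4 (by norm_num), e4]
  · rw [lreal, low 14 (by norm_num), e14]
  · rw [harr]; exact inputMemory_degree β ε δ
  · rw [harr]; exact inputMemory_neighbor β ε δ
  · intro u v
    rw [harr, hs, inputMemory_high]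
    exact (if_neg (Finset.notMem_empty _)).symm
  · have : (WormState.zero G).1 = ∅ := rfl
    rw [this, oddVertices_empty, Finset.card_empty]
  · rw [lnat 11 (by decide), knat 11 (by decide), g11]
  · have c2 : constantsProgram.cost = 15 := rfl
    have c3 : burnInProgram.cost = 15 := rfl
    have c5 : sampleSizeProgram.cost = 12 := rfl
    rw [f11] at h4
    rw [f12] at h6
    omega

theorem Represents.count_step [Nonempty (Fin n)] (hdeg : ∀ u, 0 < G.degree u) {x : ℝ} {N : ℕ}
    {q : WormState G × ℕ} {s : Memory} (h : Represents x N q.2 q.1 s) :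
    Sim (fun s' r => Represents x N r.2 r.1 s') (countProgram.exec s)
      (countStep (moveLaw hdeg x) evenInd q) := by
  rw [countProgram, Program.exec_seq, countStep, ← PMF.bind_pure_comp]
  refine (h.step hdeg).bind fun s₁ b h₁ => ?_
  rw [Program.exec_eq_pure _ rfl]
  refine Sim.pure ?_
  change Represents x N (q.2 + evenInd b) b _
  rw [Program.det]
  rcases h₁.ends with ⟨h0, h1⟩ | ⟨p, r, hpr, hodd, h1, h2, h3⟩
  · rw [if_pos h1]
    have hb : evenInd b = 1 := if_pos h0
    rw [hb]
    refine ⟨h₁.card, h₁.zero, h₁.one, ?_, h₁.size, h₁.weight, h₁.half, h₁.unit, h₁.degree,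
      h₁.neighbor, h₁.edge, h₁.ends⟩
    change s₁.nat 10 + s₁.nat 13 = q.2 + 1
    rw [h₁.count, h₁.one]
  · rw [if_neg (by rw [h1]; norm_num)]
    have hb : evenInd b = 0 := if_neg (by rw [hodd, Finset.card_pair hpr]; norm_num)
    rw [hb]
    exact h₁.congr rfl rfl rfl rfl rfl rfl rfl rfl rfl rfl rfl rfl

/-- Both loops are coupled round by round with the chain. The clock bound is part of the relation,
with constants that exceed the cost of one round. -/
theorem wormProgram_spec [Nonempty (Fin n)] (hdeg : ∀ u, 0 < G.degree u) (β ε δ : ℝ) :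
    Sim (fun s' (q : WormState G × ℕ) =>
        s'.real 0 = 1 / (1 / (sampleSize G ε δ : ℝ) * (q.2 : ℝ)) ∧
        s'.time ≤ 60 + 7 * n + 60 * (sampleSize G ε δ + burnIn G δ))
      (wormProgram.run G β ε δ)
      (countLaw (moveLaw hdeg (Real.tanh β)) evenInd (WormState.zero G) (burnIn G δ)
        (sampleSize G ε δ)) := by
  obtain ⟨h₀, hτ, htime⟩ := initProgram_spec (G := G) β ε δ
  set N := sampleSize G ε δ
  set τ := burnIn G δ
  set x := Real.tanh β
  set t := initProgram.det (inputMemory G β ε δ)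
  set T := 50 + 7 * n + τ + N with hT
  have cs : stepProgram.cost ≤ 50 := by decide
  have cc : countProgram.cost ≤ 55 := by decide
  have hburn := Sim.bindIter
    (R := fun i s' (b : WormState G) => Represents x N 0 b s' ∧ s'.time ≤ T + 1 + 55 * i)
    (f := fun s' => stepProgram.exec (s'.tick 1)) (g := moveLaw hdeg x)
    (Sim.pure (a := t.tick 1) (b := WormState.zero G)
      ⟨h₀.tick 1, by change t.time + 1 ≤ _; omega⟩)
    (fun i s' b hs' => ((hs'.1.tick 1).step hdeg).and_left fun s'' hs'' => by
      have := stepProgram.time_le rfl _ _ hs''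
      have h1 : (s'.tick 1).time = s'.time + 1 := rfl
      have h2 := hs'.2
      omega) τ
  rw [Program.run, wormProgram, Program.exec_seq_det _ _ rfl, Program.exec_seq,
    Program.exec_loop, hτ, countLaw, bindIter_eq_bind _ N, PMF.bind_map]
  refine hburn.bind fun s₁ b h₁ => ?_
  rw [Program.exec_seq, Program.exec_loop, h₁.1.size]
  simp only [Function.comp]
  have hcount := Sim.bindIter
    (R := fun i s' (q : WormState G × ℕ) => Represents x N q.2 q.1 s' ∧
      s'.time ≤ T + 2 + 55 * τ + 58 * i)
    (f := fun s' => countProgram.exec (s'.tick 1)) (g := countStep (moveLaw hdeg x) evenInd)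
    (Sim.pure (a := s₁.tick 1) (b := (b, 0))
      ⟨h₁.1.tick 1, by
        have := h₁.2
        change s₁.time + 1 ≤ _
        omega⟩)
    (fun i s' q hs' => ((hs'.1.tick 1).count_step hdeg).and_left fun s'' hs'' => by
      have := countProgram.time_le rfl _ _ hs''
      have h1 : (s'.tick 1).time = s'.time + 1 := rfl
      have h2 := hs'.2
      omega) N
  -- A trivial step on the side of the chain is the counterpart of the final block that computes the
  -- output.
  rw [← PMF.bind_pure (bindIter _ N (PMF.pure (b, 0)))]
  refine hcount.bind fun s₂ q h₂ => ?_
  rw [Program.exec_eq_pure _ rfl]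
  refine Sim.pure ⟨?_, ?_⟩
  · change (s₂.nat 12 : ℝ) / (s₂.nat 10 : ℝ) = _
    rw [h₂.1.size, h₂.1.count]
    simp
    rw [div_eq_mul_inv, mul_comm]
  · change s₂.time + 1 + 1 + 1 + 1 ≤ _
    have := h₂.2
    omega

end MainProgram

/-! ### Comparison of the time bound with its parameters. -/

section RunningTime

variable {V : Type*} [Fintype V] [DecidableEq V] {G : SimpleGraph V} [DecidableRel G.Adj]

theorem card_le_timeScale {β ε δ : ℝ} (hI : ValidInstance G β ε δ) :
    1 ≤ timeScale G ε δ ∧ (Fintype.card V : ℝ) ≤ timeScale G ε δ := by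
  obtain ⟨hG, hm, -, hε, hε1, hδ, hδ1⟩ := hI
  obtain ⟨hn, -, hΔ⟩ := graph_sizes hG hm
  have hn' : (1 : ℝ) ≤ Fintype.card V := by exact_mod_cast (by omega : 1 ≤ Fintype.card V)
  have hm' : (1 : ℝ) ≤ (G.edgeFinset.card : ℝ) ^ 2 := one_le_pow₀ (by exact_mod_cast hm)
  have hΔ' : (1 : ℝ) ≤ G.maxDegree := by exact_mod_cast hΔ
  have h1 : 1 ≤ δ⁻¹ := one_le_inv_iff₀.2 ⟨hδ, hδ1⟩
  have h2 : 1 ≤ (ε ^ 2)⁻¹ := one_le_inv_iff₀.2 ⟨by positivity, pow_le_one₀ hε.le hε1⟩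
  have h3 : 1 ≤ δ⁻¹ * (ε ^ 2)⁻¹ * (G.maxDegree : ℝ) * (G.edgeFinset.card : ℝ) ^ 2 :=
    one_le_mul_of_one_le_of_one_le (one_le_mul_of_one_le_of_one_le
      (one_le_mul_of_one_le_of_one_le h1 h2) hΔ') hm'
  have h4 : (Fintype.card V : ℝ) ≤ timeScale G ε δ :=
    (le_self_pow₀ hn' (by norm_num)).trans (le_mul_of_one_le_left (by positivity) h3)
  exact ⟨hn'.trans h4, h4⟩

/-- `Δ ≤ n` and `m ≤ n²` remove the dependence on the graph other than through `n`; the fpras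
condition needs this. -/
theorem timeScale_le {β ε δ : ℝ} (hI : ValidInstance G β ε δ) :
    timeScale G ε δ ≤ δ⁻¹ * ε⁻¹ ^ 2 * (Fintype.card V : ℝ) ^ 9 := by
  obtain ⟨hG, hm, -, hε, -, hδ, -⟩ := hI
  have := hG.nonempty
  have hΔ : (G.maxDegree : ℝ) ≤ Fintype.card V := by
    exact_mod_cast G.maxDegree_lt_card_verts.le
  have hE : (G.edgeFinset.card : ℝ) ≤ (Fintype.card V : ℝ) ^ 2 := by
    exact_mod_cast G.card_edgeFinset_le_card_choose_two.trans (Nat.choose_le_pow _ _)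
  calc timeScale G ε δ
      ≤ δ⁻¹ * (ε ^ 2)⁻¹ * (Fintype.card V : ℝ) * ((Fintype.card V : ℝ) ^ 2) ^ 2 *
          (Fintype.card V : ℝ) ^ 4 := by
        unfold timeScale
        gcongr
    _ = δ⁻¹ * ε⁻¹ ^ 2 * (Fintype.card V : ℝ) ^ 9 := by rw [inv_pow]; ring

end RunningTime

/-! ### Output law, running time and the approximation scheme. -/

section Correctness

variable {n : ℕ} {G : SimpleGraph (Fin n)} [DecidableRel G.Adj] {β ε δ : ℝ}

theorem ValidInstance.wormProgram_sim (hI : ValidInstance G β ε δ)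
    (hP : LazyReversible (wormMatrix G (Real.tanh β)) (wormPi G (Real.tanh β))) :
    Sim (fun s' (q : WormState G × ℕ) =>
        s'.real 0 = 1 / (1 / (sampleSize G ε δ : ℝ) * (q.2 : ℝ)) ∧
        s'.time ≤ 60 + 7 * n + 60 * (sampleSize G ε δ + burnIn G δ))
      (wormProgram.run G β ε δ)
      (countLaw hP.step evenInd (WormState.zero G) (burnIn G δ) (sampleSize G ε δ)) := by
  have hne := hI.1.nonempty
  have hn := (graph_sizes hI.1 hI.2.1).1
  have : Nontrivial (Fin n) := Fintype.one_lt_card_iff_nontrivial.1 hn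
  have hdeg : ∀ u, 0 < G.degree u := fun u => hI.1.preconnected.degree_pos_of_nontrivial u
  obtain ⟨hx, hx1⟩ := tanh_mem_of_pos hI.2.2.1
  rw [← funext (moveLaw_eq_step hdeg hx hx1 hP)]
  exact wormProgram_spec hdeg β ε δ

theorem ValidInstance.wormProgram_output (hI : ValidInstance G β ε δ)
    (hP : LazyReversible (wormMatrix G (Real.tanh β)) (wormPi G (Real.tanh β))) :
    wormProgram.output G β ε δ =
      (countLaw hP.step evenInd (WormState.zero G) (burnIn G δ) (sampleSize G ε δ)).map
        fun q => 1 / (1 / (sampleSize G ε δ : ℝ) * (q.2 : ℝ)) :=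
  (hI.wormProgram_sim hP).map_eq _ _ fun _ _ h => h.1

theorem ValidInstance.lazyReversible (hI : ValidInstance G β ε δ) :
    LazyReversible (wormMatrix G (Real.tanh β)) (wormPi G (Real.tanh β)) :=
  have := hI.1.nonempty
  lazyReversible_wormMatrix (tanh_mem_of_pos hI.2.2.1).1 (tanh_mem_of_pos hI.2.2.1).2

theorem wormProgram_time (hI : ValidInstance G β ε δ) (s : Memory)
    (hs : s ∈ (wormProgram.run G β ε δ).support) :
    -- `12067 = 60 + 7 + 60 · 200`: the constant term, the term in `n`, and the worm steps, each
    -- bounded by a multiple of the time scale.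
    (s.time : ℝ) ≤ 12067 * timeScale G ε δ := by
  obtain ⟨q, -, hq⟩ := (hI.wormProgram_sim hI.lazyReversible).exists_of_mem hs
  have h1 := card_le_timeScale hI
  have h2 := sampleSize_add_burnIn_le hI
  rw [Fintype.card_fin] at h1
  have h3 : (s.time : ℝ) ≤
      60 + 7 * (n : ℝ) + 60 * ((sampleSize G ε δ + burnIn G δ : ℕ) : ℝ) := by
    exact_mod_cast hq
  linarith [h1.1, h1.2]

theorem wormProgram_output_apply (hI : ValidInstance G β ε δ) {Ω : Type*} [MeasurableSpace Ω]
    {μ : MeasureTheory.Measure Ω} {X : ℕ → Ω → WormState G}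
    (hX : IsWormProcess G (Real.tanh β) μ X) (y : ℝ) :
    wormProgram.output G β ε δ y =
      μ {ω | 1 / wormSampleMean G (burnIn G δ) (sampleSize G ε δ) X ω = y} := by
  rw [hI.wormProgram_output hI.lazyReversible, ← PMF.toOuterMeasure_apply_singleton,
    PMF.toOuterMeasure_map_apply, ← IsMarkovChain.measure_count hX hI.lazyReversible]
  simp only [wormSampleMean_eq, Set.mem_preimage, Set.mem_singleton_iff]

theorem wormProgram_accuracy (hI : ValidInstance G β ε δ) :
    ENNReal.ofReal (1 - δ) ≤ (wormProgram.output G β ε δ).toMeasure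
      {y | EstimatesWithRelError ε y (susceptibility G β)} := by
  have hmeas : MeasurableSet {y : ℝ | EstimatesWithRelError ε y (susceptibility G β)} :=
    measurableSet_le (by fun_prop) measurable_const
  rw [PMF.toMeasure_apply_eq_toOuterMeasure_apply _ hmeas,
    hI.wormProgram_output hI.lazyReversible, PMF.toOuterMeasure_map_apply]
  exact (countLaw_accuracy hI hI.lazyReversible).trans
    (MeasureTheory.measure_mono fun q hq => hq.2)

theorem isFPRAS_wormProgram :
    IsFPRAS wormProgram (fun _ G _ β => susceptibility G β) := by
  refine ⟨⟨MvPolynomial.C 12067 * (MvPolynomial.X 2 * MvPolynomial.X 1 ^ 2 *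
    MvPolynomial.X 0 ^ 9), ?_⟩, fun n G _ β ε δ hI => wormProgram_accuracy hI⟩
  intro n G _ β ε δ hI s hs
  have h := timeScale_le hI
  rw [Fintype.card_fin] at h
  simpa using (wormProgram_time hI s hs).trans (mul_le_mul_of_nonneg_left h (by norm_num))

end Correctness

end

theorem mainTheorem5 :
    -- the worm estimator is an `(ε, δ)`-approximation of the susceptibility
    (∀ (V : Type*) [Fintype V] [DecidableEq V] (G : SimpleGraph V) [DecidableRel G.Adj]
        (β ε δ : ℝ), ValidInstance G β ε δ →
        ∀ (Ω : Type*) [MeasurableSpace Ω] (μ : MeasureTheory.Measure Ω)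
          [MeasureTheory.IsProbabilityMeasure μ] (X : ℕ → Ω → WormState G),
          IsWormProcess G (Real.tanh β) μ X →
          ENNReal.ofReal (1 - δ) ≤
            μ {ω | 0 < wormSampleMean G (burnIn G δ) (sampleSize G ε δ) X ω ∧
              EstimatesWithRelError ε
                (1 / wormSampleMean G (burnIn G δ) (sampleSize G ε δ) X ω)
                (susceptibility G β)}) ∧
    -- the number of steps of the worm process that it takes
    (∃ C : ℝ, ∀ (V : Type*) [Fintype V] [DecidableEq V] (G : SimpleGraph V) [DecidableRel G.Adj]
        (β ε δ : ℝ), ValidInstance G β ε δ →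
        ((sampleSize G ε δ + burnIn G δ : ℕ) : ℝ) ≤ C * timeScale G ε δ) ∧
    -- a program that computes the estimator, within this time, is an fpras
    (∃ c : Program,
      (∀ (n : ℕ) (G : SimpleGraph (Fin n)) [DecidableRel G.Adj] (β ε δ : ℝ),
        ValidInstance G β ε δ →
        ∀ (Ω : Type*) [MeasurableSpace Ω] (μ : MeasureTheory.Measure Ω)
          [MeasureTheory.IsProbabilityMeasure μ] (X : ℕ → Ω → WormState G),
          IsWormProcess G (Real.tanh β) μ X →
          ∀ y : ℝ, c.output G β ε δ y =
            μ {ω | 1 / wormSampleMean G (burnIn G δ) (sampleSize G ε δ) X ω = y}) ∧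
      (∃ C : ℝ, ∀ (n : ℕ) (G : SimpleGraph (Fin n)) [DecidableRel G.Adj] (β ε δ : ℝ),
        ValidInstance G β ε δ →
        ∀ s ∈ (c.run G β ε δ).support, (s.time : ℝ) ≤ C * timeScale G ε δ) ∧
      IsFPRAS c (fun _ G _ β => susceptibility G β)) :=
  ⟨fun _ _ _ _ _ _ _ _ hI _ _ _ _ _ hX => hX.accuracy hI,
    ⟨200, fun _ _ _ _ _ _ _ _ hI => sampleSize_add_burnIn_le hI⟩,
    wormProgram, fun _ _ _ _ _ _ hI _ _ _ _ _ hX y => wormProgram_output_apply hI hX y,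
    ⟨12067, fun _ _ _ _ _ _ hI s hs => wormProgram_time hI s hs⟩, isFPRAS_wormProgram⟩
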